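/- Let $K$ be a field of characteristic $0$ and let $V=V_0\oplus V_1$ be a finite-dimensional superspace over $K$ with $\dim V_0=p$, $\dim V_1=q$ ($p,q\ge 0$). Let $\mathrm{GL}(V)$ be the general linear supergroup, i.e. the functor sending a supercommutative $K$-superalgebra $R$ to the group of even $R$-linear automorphisms of $V\otimes R$. A finite-dimensional representation of $\mathrm{GL}(V)$ is a finite-dimensional superspace $M$ with group homomorphisms $\mathrm{GL}(V)(R)\to\mathrm{GL}(M)(R)$ natural in $R$; morphisms are even equivariant linear maps, and tensor products are formed with the usual sign rule. The Grothendieck ring of $\mathrm{GL}(V)$ is the commutative ring generated by the classes $[M]$ of finite-dimensional representations, with the relations $[B]=[A]+[C]$ for all short exact sequences $0\to A\to B\to C\to 0$, $[A\otimes B]=[A][B]$ and $[K]=1$ for the trivial purely even line $K$. The split Grothendieck ring is defined in the same way, using only split short exact sequences. For $k\ge 0$ let $\Lambda^kV$ be the degree $k$ part of $T(V)/\langle v\otimes u+(-1)^{|v||u|}u\otimes v : v,u \text{ homogeneous}\rangle$, and let $\Lambda^kV=0$ for $k<0$. Then for every integer $k\ge p-q+1$ the Hankel determinant of order $q+1$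 vanishes: $$\det\bigl([\Lambda^{k+i+j}V]\bigr)_{0\le i,j\le q}=\begin{vmatrix}[\Lambda^kV]&\dots&[\Lambda^{k+q}V]\\ \vdots& &\vdots\\ [\Lambda^{k+q}V]&\dots&[\Lambda^{k+2q}V]\end{vmatrix}=0,$$ both in the Grothendieck ring and in the split Grothendieck ring of finite-dimensional representations of $\mathrm{GL}(V)$. -/

import Mathlib

universe u

open scoped TensorProduct

noncomputable section

namespace SuperGL

/-! ### `ℤ/2`-gradings, superspaces, supercommutative algebras -/

/-- A `ℤ/2`-grading `M = M₀ ⊕ M₁` of a `K`-vector space. -/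
structure Grading (K : Type u) [Field K] (M : Type u) [AddCommGroup M] [Module K M] where
  even : Submodule K M
  odd : Submodule K M
  isCompl : IsCompl even odd

namespace Grading

variable {K : Type u} [Field K] {M : Type u} [AddCommGroup M] [Module K M]

/-- The projection `x ↦ x₀` onto the even part. -/
def evenProj (G : Grading K M) : M →ₗ[K] M := Submodule.projection G.even G.odd G.isCompl

/-- The projection `x ↦ x₁` onto the odd part. -/
def oddProj (G : Grading K M) : M →ₗ[K] M := Submodule.projection G.odd G.even G.isCompl.symm

/-- The parity operator: `x ↦ (-1)^{|x|} x` on homogeneous `x`. -/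
def parity (G : Grading K M) : M →ₗ[K] M := G.evenProj - G.oddProj

theorem evenProj_of_even (G : Grading K M) {x : M} (hx : x ∈ G.even) : G.evenProj x = x :=
  Submodule.projection_apply_of_mem_left _ hx

theorem oddProj_of_odd (G : Grading K M) {x : M} (hx : x ∈ G.odd) : G.oddProj x = x :=
  Submodule.projection_apply_of_mem_left _ hx

theorem evenProj_of_odd (G : Grading K M) {x : M} (hx : x ∈ G.odd) : G.evenProj x = 0 :=
  (Submodule.projection_apply_eq_zero_iff _).2 hx

theorem oddProj_of_even (G : Grading K M) {x : M} (hx : x ∈ G.even) : G.oddProj x = 0 :=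
  (Submodule.projection_apply_eq_zero_iff _).2 hx

theorem parity_of_even (G : Grading K M) {x : M} (hx : x ∈ G.even) : G.parity x = x := by
  simp [parity, G.evenProj_of_even hx, G.oddProj_of_even hx]

theorem parity_of_odd (G : Grading K M) {x : M} (hx : x ∈ G.odd) : G.parity x = -x := by
  simp [parity, G.evenProj_of_odd hx, G.oddProj_of_odd hx]

theorem evenProj_mem (G : Grading K M) (x : M) : G.evenProj x ∈ G.even :=
  Submodule.projection_apply_mem _ x

theorem oddProj_mem (G : Grading K M) (x : M) : G.oddProj x ∈ G.odd :=
  Submodule.projection_apply_mem _ x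

theorem even_add_odd (G : Grading K M) (x : M) : G.evenProj x + G.oddProj x = x :=
  Submodule.projection_add_projection_eq_self G.isCompl x

theorem exists_even_odd (G : Grading K M) (x : M) :
    ∃ a ∈ G.even, ∃ b ∈ G.odd, x = a + b :=
  ⟨_, G.evenProj_mem x, _, G.oddProj_mem x, (G.even_add_odd x).symm⟩

theorem parity_parity (G : Grading K M) (x : M) : G.parity (G.parity x) = x := by
  obtain ⟨a, ha, b, hb, rfl⟩ := G.exists_even_odd x
  simp [G.parity_of_even ha, G.parity_of_odd hb]

theorem mem_even_iff [CharZero K] (G : Grading K M) (x : M) : x ∈ G.even ↔ G.parity x = x := by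
  refine ⟨G.parity_of_even, fun h => ?_⟩
  obtain ⟨a, ha, b, hb, rfl⟩ := G.exists_even_odd x
  simp only [map_add, G.parity_of_even ha, G.parity_of_odd hb] at h
  have h2 : (2 : K) • b = 0 := by
    rw [two_smul]
    have := add_left_cancel h
    exact add_eq_zero_iff_eq_neg.2 this.symm
  have : b = 0 := (smul_eq_zero.1 h2).resolve_left two_ne_zero
  simpa [this] using ha

theorem mem_odd_iff [CharZero K] (G : Grading K M) (x : M) : x ∈ G.odd ↔ G.parity x = -x := by
  refine ⟨G.parity_of_odd, fun h => ?_⟩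
  obtain ⟨a, ha, b, hb, rfl⟩ := G.exists_even_odd x
  simp only [map_add, G.parity_of_even ha, G.parity_of_odd hb, neg_add] at h
  have h2 : (2 : K) • a = 0 := by
    rw [two_smul]
    exact add_eq_zero_iff_eq_neg.2 (add_right_cancel h)
  have : a = 0 := (smul_eq_zero.1 h2).resolve_left two_ne_zero
  simpa [this] using hb

/-- The grading whose even and odd parts are the eigenspaces of an involution `s` for `1`
and `-1`. -/
def ofInvolution [CharZero K] (s : M →ₗ[K] M) (hs : ∀ x, s (s x) = x) : Grading K M where
  even := LinearMap.eqLocus s LinearMap.id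
  odd := LinearMap.eqLocus s (-LinearMap.id)
  isCompl := by
    constructor
    · rw [Submodule.disjoint_def]
      intro x h0 h1
      rw [LinearMap.mem_eqLocus] at h0 h1
      rw [h0] at h1
      have h2 : (2 : K) • x = 0 := by
        rw [two_smul]
        exact add_eq_zero_iff_eq_neg.2 h1
      exact (smul_eq_zero.1 h2).resolve_left two_ne_zero
    · rw [codisjoint_iff, eq_top_iff]
      intro x _
      have hx : x = (2⁻¹ : K) • (x + s x) + (2⁻¹ : K) • (x - s x) := by
        rw [← smul_add, add_add_sub_cancel, ← two_smul K x, smul_smul,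
          inv_mul_cancel₀ two_ne_zero, one_smul]
      rw [hx]
      refine Submodule.add_mem_sup ?_ ?_
      · simp [LinearMap.mem_eqLocus, hs, add_comm]
      · simp only [LinearMap.mem_eqLocus, map_smul, map_sub, hs, LinearMap.neg_apply,
          LinearMap.id_apply]
        rw [neg_sub_neg]

theorem parity_ofInvolution [CharZero K] (s : M →ₗ[K] M) (hs : ∀ x, s (s x) = x) :
    (ofInvolution s hs).parity = s := by
  ext x
  obtain ⟨a, ha, b, hb, rfl⟩ := (ofInvolution s hs).exists_even_odd x
  rw [map_add, map_add, parity_of_even _ ha, parity_of_odd _ hb]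
  have h1 : s a = a := ha
  have h2 : s b = -b := hb
  rw [h1, h2]

end Grading

/-- A finite-dimensional superspace over `K`. -/
structure Superspace (K : Type u) [Field K] where
  carrier : Type u
  [addCommGroup : AddCommGroup carrier]
  [module : Module K carrier]
  [finite : FiniteDimensional K carrier]
  grading : Grading K carrier

attribute [instance] Superspace.addCommGroup Superspace.module Superspace.finite

/-- A supercommutative associative unital `K`-superalgebra. -/
structure SupercommAlgebra (K : Type u) [Field K] where
  carrier : Type u
  [ring : Ring carrier]
  [algebra : Algebra K carrier]
  grading : Grading K carrier
  one_mem : 1 ∈ grading.even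
  even_mul_even : ∀ a ∈ grading.even, ∀ b ∈ grading.even, a * b ∈ grading.even
  even_mul_odd : ∀ a ∈ grading.even, ∀ b ∈ grading.odd, a * b ∈ grading.odd
  odd_mul_even : ∀ a ∈ grading.odd, ∀ b ∈ grading.even, a * b ∈ grading.odd
  odd_mul_odd : ∀ a ∈ grading.odd, ∀ b ∈ grading.odd, a * b ∈ grading.even
  even_comm : ∀ a ∈ grading.even, ∀ b, a * b = b * a
  odd_anticomm : ∀ a ∈ grading.odd, ∀ b ∈ grading.odd, a * b = -(b * a)

attribute [instance] SupercommAlgebra.ring SupercommAlgebra.algebra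

variable {K : Type u} [Field K]

/-- Morphisms of superalgebras: even unital algebra homomorphisms. -/
structure SupercommAlgebra.Hom (R S : SupercommAlgebra K) where
  toAlgHom : R.carrier →ₐ[K] S.carrier
  map_even : ∀ a ∈ R.grading.even, toAlgHom a ∈ S.grading.even
  map_odd : ∀ a ∈ R.grading.odd, toAlgHom a ∈ S.grading.odd

/-! ### The group functor `GL(M)` -/

/-- The right `R`-module `M ⊗ R`. -/
abbrev Ext (M : Superspace K) (R : SupercommAlgebra K) : Type u := M.carrier ⊗[K] R.carrier

/-- Right multiplication by `r` on `M ⊗ R`. -/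
def rmul (M : Superspace K) {R : SupercommAlgebra K} (r : R.carrier) : Ext M R →ₗ[K] Ext M R :=
  LinearMap.lTensor M.carrier (LinearMap.mulRight K r)

/-- The parity operator of `M ⊗ R`. -/
def extParity (M : Superspace K) (R : SupercommAlgebra K) : Ext M R →ₗ[K] Ext M R :=
  TensorProduct.map M.grading.parity R.grading.parity

/-- The map `M ⊗ R → M ⊗ S` induced by `φ : R → S`. -/
def extMap (M : Superspace K) {R S : SupercommAlgebra K} (φ : R.Hom S) : Ext M R →ₗ[K] Ext M S :=
  LinearMap.lTensor M.carrier φ.toAlgHom.toLinearMap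

/-- The group `GL(M)(R)` of even (parity preserving) automorphisms of the right `R`-module
`M ⊗ R`; in a homogeneous basis of `M`, these are the even invertible supermatrices over `R`. -/
def GLPoints (M : Superspace K) (R : SupercommAlgebra K) : Subgroup (Ext M R ≃ₗ[K] Ext M R) where
  carrier := {f | (∀ r x, f (rmul M r x) = rmul M r (f x)) ∧
    ∀ x, f (extParity M R x) = extParity M R (f x)}
  mul_mem' := by
    rintro f g ⟨hf, hf'⟩ ⟨hg, hg'⟩
    exact ⟨fun r x => by simp [hg, hf], fun x => by simp [hg', hf']⟩
  one_mem' := ⟨fun _ _ => rfl, fun _ => rfl⟩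
  inv_mem' := by
    rintro f ⟨hf, hf'⟩
    refine ⟨fun r x => ?_, fun x => ?_⟩
    · apply f.injective
      rw [hf]
      change f (f.symm _) = rmul M r (f (f.symm x))
      simp
    · apply f.injective
      rw [hf']
      change f (f.symm _) = extParity M R (f (f.symm x))
      simp

/-- `h ∈ GL(M)(S)` is the image of `g ∈ GL(M)(R)` under `φ : R → S`. -/
def IsBaseChange {M : Superspace K} {R S : SupercommAlgebra K} (φ : R.Hom S)
    (g : GLPoints M R) (h : GLPoints M S) : Prop :=
  ∀ x, h.1 (extMap M φ x) = extMap M φ (g.1 x)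

/-! ### Representations of the supergroup `GL(V)` -/

/-- A finite-dimensional representation of the supergroup `GL(V)`: a finite-dimensional superspace
`M` with group homomorphisms `GL(V)(R) → GL(M)(R)`, natural in the supercommutative
algebra `R`. -/
structure SuperRep (V : Superspace K) where
  space : Superspace K
  ρ : ∀ R : SupercommAlgebra K, GLPoints V R →* GLPoints space R
  natural : ∀ (R S : SupercommAlgebra K) (φ : R.Hom S) (g : GLPoints V R) (h : GLPoints V S),
    IsBaseChange φ g h → IsBaseChange φ (ρ R g) (ρ S h)

/-- Even linear maps of superspaces. -/
def IsEven {M N : Superspace K} (T : M.carrier →ₗ[K] N.carrier) : Prop :=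
  (∀ x ∈ M.grading.even, T x ∈ N.grading.even) ∧ ∀ x ∈ M.grading.odd, T x ∈ N.grading.odd

/-- Morphisms of representations: even linear maps commuting with the action of `GL(V)`. -/
structure SuperRep.Hom {V : Superspace K} (A B : SuperRep V) where
  toLin : A.space.carrier →ₗ[K] B.space.carrier
  isEven : IsEven toLin
  comm : ∀ (R : SupercommAlgebra K) (g : GLPoints V R) (x : Ext A.space R),
    LinearMap.rTensor R.carrier toLin ((A.ρ R g).1 x) =
      (B.ρ R g).1 (LinearMap.rTensor R.carrier toLin x)

/-- The standard representation of `GL(V)` on `V`. -/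
def SuperRep.std (V : Superspace K) : SuperRep V where
  space := V
  ρ _ := MonoidHom.id _
  natural _ _ _ _ _ h := h

/-- The superspace `M` with the trivial action. -/
def SuperRep.trivial (V M : Superspace K) : SuperRep V where
  space := M
  ρ _ := 1
  natural _ _ _ _ _ _ := fun _ => rfl

/-- The purely even line, with the trivial action. -/
def SuperRep.one (V : Superspace K) : SuperRep V :=
  SuperRep.trivial V { carrier := K, grading := ⟨⊤, ⊥, isCompl_top_bot⟩ }

/-- The zero representation. -/
def SuperRep.zero (V : Superspace K) : SuperRep V :=
  SuperRep.trivial V { carrier := PUnit, grading := ⟨⊤, ⊥, isCompl_top_bot⟩ }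

/-! ### Tensor products -/

section Tensor

variable [CharZero K]

/-- The grading of `M ⊗ N`: `m ⊗ n` has parity `|m| + |n|`, that is, the parity operator of
`M ⊗ N` is the tensor product of the parity operators. -/
def Grading.tensor {M N : Type u} [AddCommGroup M] [Module K M] [AddCommGroup N] [Module K N]
    (G : Grading K M) (H : Grading K N) : Grading K (M ⊗[K] N) :=
  Grading.ofInvolution (TensorProduct.map G.parity H.parity) (by
    intro x
    induction x using TensorProduct.induction_on with
    | zero => simp
    | add x y hx hy => simp [hx, hy]
    | tmul m n => simp [Grading.parity_parity])

theorem Grading.parity_tensor {M N : Type u} [AddCommGroup M] [Module K M] [AddCommGroup N]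
    [Module K N] (G : Grading K M) (H : Grading K N) :
    (G.tensor H).parity = TensorProduct.map G.parity H.parity :=
  Grading.parity_ofInvolution (TensorProduct.map G.parity H.parity) _

/-- The tensor product of superspaces. -/
abbrev Superspace.tensor (M N : Superspace K) : Superspace K where
  carrier := M.carrier ⊗[K] N.carrier
  grading := M.grading.tensor N.grading

variable (M N : Superspace K) (R : SupercommAlgebra K)

/-- The identification `(M ⊗ R) ⊗ N ≃ (M ⊗ N) ⊗ R`, with the sign rule:
`(m ⊗ r) ⊗ n ↦ (-1)^{|r||n|} (m ⊗ n) ⊗ r`. -/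
def braid : Ext M R ⊗[K] N.carrier ≃ₗ[K] Ext (M.tensor N) R :=
  LinearEquiv.ofLinearMap
    ((TensorProduct.rightComm K M.carrier R.carrier N.carrier).toLinearMap ∘ₗ
      (TensorProduct.map (LinearMap.lTensor M.carrier R.grading.evenProj) LinearMap.id +
        TensorProduct.map (LinearMap.lTensor M.carrier R.grading.oddProj) N.grading.parity))
    ((TensorProduct.rightComm K M.carrier N.carrier R.carrier).toLinearMap ∘ₗ
      (TensorProduct.map LinearMap.id R.grading.evenProj +
        TensorProduct.map (LinearMap.lTensor M.carrier N.grading.parity) R.grading.oddProj))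
    (by
      apply TensorProduct.ext_threefold
      intro m n r
      obtain ⟨a, ha, b, hb, rfl⟩ := R.grading.exists_even_odd r
      simp [Grading.evenProj_of_even _ ha, Grading.oddProj_of_even _ ha, TensorProduct.tmul_add,
        Grading.evenProj_of_odd _ hb, Grading.oddProj_of_odd _ hb, Grading.parity_parity])
    (by
      apply TensorProduct.ext_threefold
      intro m r n
      obtain ⟨a, ha, b, hb, rfl⟩ := R.grading.exists_even_odd r
      simp [Grading.evenProj_of_even _ ha, Grading.oddProj_of_even _ ha, TensorProduct.tmul_add,
        TensorProduct.add_tmul,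
        Grading.evenProj_of_odd _ hb, Grading.oddProj_of_odd _ hb, Grading.parity_parity])

variable {M N R}

theorem braid_even (m : M.carrier) (n : N.carrier) {r : R.carrier} (hr : r ∈ R.grading.even) :
    braid M N R ((m ⊗ₜ r) ⊗ₜ n) = (m ⊗ₜ n) ⊗ₜ r := by
  simp [braid, Grading.evenProj_of_even _ hr, Grading.oddProj_of_even _ hr]

theorem braid_odd (m : M.carrier) (n : N.carrier) {r : R.carrier} (hr : r ∈ R.grading.odd) :
    braid M N R ((m ⊗ₜ r) ⊗ₜ n) = (m ⊗ₜ N.grading.parity n) ⊗ₜ r := by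
  simp [braid, Grading.evenProj_of_odd _ hr, Grading.oddProj_of_odd _ hr]

/-- The action of `f` on the first factor of `M ⊗ N`. -/
def actLeft (f : Ext M R ≃ₗ[K] Ext M R) : Ext (M.tensor N) R ≃ₗ[K] Ext (M.tensor N) R :=
  (braid M N R).symm ≪≫ₗ LinearEquiv.rTensor N.carrier f ≪≫ₗ braid M N R

/-- The action of `g` on the second factor of `M ⊗ N`. -/
def actRight (g : Ext N R ≃ₗ[K] Ext N R) : Ext (M.tensor N) R ≃ₗ[K] Ext (M.tensor N) R :=
  TensorProduct.assoc K M.carrier N.carrier R.carrier ≪≫ₗ LinearEquiv.lTensor M.carrier g ≪≫ₗ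
    (TensorProduct.assoc K M.carrier N.carrier R.carrier).symm

/-- `m ⊗ (n ⊗ r) ↦ (m ⊗ n) ⊗ r`. -/
def asc (m : M.carrier) : Ext N R →ₗ[K] Ext (M.tensor N) R :=
  (TensorProduct.assoc K M.carrier N.carrier R.carrier).symm.toLinearMap ∘ₗ
    TensorProduct.mk K M.carrier (Ext N R) m

theorem asc_tmul (m : M.carrier) (n : N.carrier) (r : R.carrier) :
    asc m (n ⊗ₜ[K] r : Ext N R) = ((m ⊗ₜ n) ⊗ₜ r : Ext (M.tensor N) R) := rfl

theorem actLeft_braid (f : Ext M R ≃ₗ[K] Ext M R) (x : Ext M R) (n : N.carrier) :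
    actLeft f (braid M N R (x ⊗ₜ n)) = braid M N R (f x ⊗ₜ n) := by
  simp [actLeft]

theorem actRight_asc (g : Ext N R ≃ₗ[K] Ext N R) (m : M.carrier) (y : Ext N R) :
    actRight g (asc m y) = asc m (g y) := by
  simp [actRight, asc]

@[elab_as_elim]
theorem ext_induction {M : Superspace K} {p : Ext M R → Prop} (x : Ext M R)
    (he : ∀ m, ∀ r ∈ R.grading.even, p (m ⊗ₜ r)) (ho : ∀ m, ∀ r ∈ R.grading.odd, p (m ⊗ₜ r))
    (ha : ∀ x y, p x → p y → p (x + y)) : p x := by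
  induction x using TensorProduct.induction_on with
  | zero => simpa using he 0 0 (zero_mem _)
  | add x y hx hy => exact ha _ _ hx hy
  | tmul m r =>
    obtain ⟨a, ha', b, hb, rfl⟩ := R.grading.exists_even_odd r
    rw [TensorProduct.tmul_add]
    exact ha _ _ (he _ _ ha') (ho _ _ hb)

@[elab_as_elim]
theorem braid_induction {p : Ext (M.tensor N) R → Prop} (z : Ext (M.tensor N) R)
    (ht : ∀ x n, p (braid M N R (x ⊗ₜ n))) (ha : ∀ x y, p x → p y → p (x + y)) : p z := by
  obtain ⟨w, rfl⟩ := (braid M N R).surjective z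
  induction w using TensorProduct.induction_on with
  | zero => simpa using ht 0 0
  | add x y hx hy => rw [map_add]; exact ha _ _ hx hy
  | tmul x n => exact ht x n

@[elab_as_elim]
theorem asc_induction {p : Ext (M.tensor N) R → Prop} (z : Ext (M.tensor N) R)
    (ht : ∀ m y, p (asc m y)) (ha : ∀ x y, p x → p y → p (x + y)) : p z := by
  obtain ⟨w, rfl⟩ := (TensorProduct.assoc K M.carrier N.carrier R.carrier).symm.surjective z
  induction w using TensorProduct.induction_on with
  | zero => simpa using ht 0 0
  | add x y hx hy => rw [map_add]; exact ha _ _ hx hy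
  | tmul x n => exact ht x n

theorem rmul_tmul (m : M.carrier) (r s : R.carrier) :
    rmul M s (m ⊗ₜ r : Ext M R) = m ⊗ₜ (r * s) := rfl

theorem rmul_asc (m : M.carrier) (y : Ext N R) (s : R.carrier) :
    rmul (M.tensor N) s (asc m y) = asc m (rmul N s y) := by
  induction y using TensorProduct.induction_on with
  | zero => simp
  | add x y hx hy => simp only [map_add, hx, hy]
  | tmul n r => rfl

theorem extParity_asc (m : M.carrier) (y : Ext N R) :
    extParity (M.tensor N) R (asc m y) = asc (M.grading.parity m) (extParity N R y) := by
  induction y using TensorProduct.induction_on with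
  | zero => simp
  | add x y hx hy => simp only [map_add, hx, hy]
  | tmul n r => simp [asc_tmul, extParity, Grading.parity_tensor]

theorem extMap_asc {S : SupercommAlgebra K} (φ : R.Hom S) (m : M.carrier) (y : Ext N R) :
    extMap (M.tensor N) φ (asc m y) = asc m (extMap N φ y) := by
  induction y using TensorProduct.induction_on with
  | zero => simp
  | add x y hx hy => simp only [map_add, hx, hy]
  | tmul n r => rfl

theorem rmul_even_braid (x : Ext M R) (n : N.carrier) {s : R.carrier} (hs : s ∈ R.grading.even) :
    rmul (M.tensor N) s (braid M N R (x ⊗ₜ n)) = braid M N R (rmul M s x ⊗ₜ n) := by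
  induction x using ext_induction with
  | ha x y hx hy => simp only [map_add, TensorProduct.add_tmul, hx, hy]
  | he m r hr => rw [braid_even _ _ hr, rmul_tmul, rmul_tmul, braid_even _ _ (R.even_mul_even _ hr _ hs)]
  | ho m r hr => rw [braid_odd _ _ hr, rmul_tmul, rmul_tmul, braid_odd _ _ (R.odd_mul_even _ hr _ hs)]

theorem rmul_odd_braid (x : Ext M R) (n : N.carrier) {s : R.carrier} (hs : s ∈ R.grading.odd) :
    rmul (M.tensor N) s (braid M N R (x ⊗ₜ n)) =
      braid M N R (rmul M s x ⊗ₜ N.grading.parity n) := by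
  induction x using ext_induction with
  | ha x y hx hy => simp only [map_add, TensorProduct.add_tmul, hx, hy]
  | he m r hr =>
    rw [braid_even _ _ hr, rmul_tmul, rmul_tmul, braid_odd _ _ (R.even_mul_odd _ hr _ hs),
      Grading.parity_parity]
  | ho m r hr => rw [braid_odd _ _ hr, rmul_tmul, rmul_tmul, braid_even _ _ (R.odd_mul_odd _ hr _ hs)]

theorem extParity_braid (x : Ext M R) (n : N.carrier) :
    extParity (M.tensor N) R (braid M N R (x ⊗ₜ n)) =
      braid M N R (extParity M R x ⊗ₜ N.grading.parity n) := by
  induction x using ext_induction with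
  | ha x y hx hy => simp only [map_add, TensorProduct.add_tmul, hx, hy]
  | he m r hr =>
    rw [braid_even _ _ hr]
    simp only [extParity, TensorProduct.map_tmul, Grading.parity_tensor, Grading.parity_of_even _ hr]
    rw [braid_even _ _ hr]
  | ho m r hr =>
    rw [braid_odd _ _ hr]
    simp only [extParity, TensorProduct.map_tmul, Grading.parity_tensor, Grading.parity_of_odd _ hr]
    rw [braid_odd _ _ (neg_mem hr)]

theorem extMap_braid {S : SupercommAlgebra K} (φ : R.Hom S) (x : Ext M R) (n : N.carrier) :
    extMap (M.tensor N) φ (braid M N R (x ⊗ₜ n)) = braid M N S (extMap M φ x ⊗ₜ n) := by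
  induction x using ext_induction with
  | ha x y hx hy => simp only [map_add, TensorProduct.add_tmul, hx, hy]
  | he m r hr =>
    rw [braid_even _ _ hr]
    exact (braid_even _ _ (φ.map_even _ hr)).symm
  | ho m r hr =>
    rw [braid_odd _ _ hr]
    exact (braid_odd _ _ (φ.map_odd _ hr)).symm

theorem actLeft_mem {f : Ext M R ≃ₗ[K] Ext M R} (hf : f ∈ GLPoints M R) :
    actLeft f ∈ GLPoints (M.tensor N) R := by
  refine ⟨fun s z => ?_, fun z => ?_⟩
  · obtain ⟨a, ha, b, hb, rfl⟩ := R.grading.exists_even_odd s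
    have h : ∀ P : Superspace K, rmul P (a + b) = rmul P a + rmul P b := fun P => by
      rw [rmul, rmul, rmul, ← LinearMap.lTensor_add]
      congr 1
      ext x
      simp [mul_add]
    induction z using braid_induction with
    | ha x y hx hy => simp only [map_add, hx, hy]
    | ht x n =>
      simp only [h, LinearMap.add_apply, map_add, rmul_even_braid _ _ ha, rmul_odd_braid _ _ hb,
        actLeft_braid, hf.1]
  · induction z using braid_induction with
    | ha x y hx hy => simp only [map_add, hx, hy]
    | ht x n => simp only [extParity_braid, actLeft_braid, hf.2]

theorem actRight_mem {g : Ext N R ≃ₗ[K] Ext N R} (hg : g ∈ GLPoints N R) :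
    actRight g ∈ GLPoints (M.tensor N) R := by
  refine ⟨fun s z => ?_, fun z => ?_⟩
  · induction z using asc_induction with
    | ha x y hx hy => simp only [map_add, hx, hy]
    | ht m y => simp only [rmul_asc, actRight_asc, hg.1]
  · induction z using asc_induction with
    | ha x y hx hy => simp only [map_add, hx, hy]
    | ht m y => simp only [extParity_asc, actRight_asc, hg.2]

theorem tmul_eq_rmul (m : M.carrier) (r : R.carrier) :
    (m ⊗ₜ r : Ext M R) = rmul M r (m ⊗ₜ 1) := by
  rw [rmul_tmul, one_mul]

/-- The `R`-bilinear product `(M ⊗ R) × (N ⊗ R) → (M ⊗ N) ⊗ R` with the sign rule. -/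
def pairing : Ext M R ⊗[K] Ext N R →ₗ[K] Ext (M.tensor N) R :=
  LinearMap.lTensor _ (LinearMap.mul' K R.carrier) ∘ₗ
    (TensorProduct.assoc K (M.tensor N).carrier R.carrier R.carrier).toLinearMap ∘ₗ
    LinearMap.rTensor _ (braid M N R).toLinearMap ∘ₗ
    (TensorProduct.assoc K (Ext M R) N.carrier R.carrier).symm.toLinearMap

theorem pairing_tmul (x : Ext M R) (n : N.carrier) (s : R.carrier) :
    pairing (x ⊗ₜ (n ⊗ₜ s : Ext N R)) = rmul (M.tensor N) s (braid M N R (x ⊗ₜ n)) := by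
  have : ∀ z : Ext (M.tensor N) R, LinearMap.lTensor _ (LinearMap.mul' K R.carrier)
      ((TensorProduct.assoc K (M.tensor N).carrier R.carrier R.carrier) (z ⊗ₜ s)) =
        rmul (M.tensor N) s z := by
    intro z
    induction z using TensorProduct.induction_on with
    | zero => simp
    | add x y hx hy => simp only [map_add, TensorProduct.add_tmul, hx, hy]
    | tmul n r => rfl
  exact this _

theorem pairing_even (m : M.carrier) {r : R.carrier} (hr : r ∈ R.grading.even) (y : Ext N R) :
    pairing ((m ⊗ₜ r : Ext M R) ⊗ₜ y) = asc m (rmul N r y) := by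
  induction y using TensorProduct.induction_on with
  | zero => simp
  | add x y hx hy => simp only [map_add, TensorProduct.tmul_add, hx, hy]
  | tmul n s =>
    rw [pairing_tmul, braid_even _ _ hr, rmul_tmul, rmul_tmul, asc_tmul, R.even_comm r hr]

theorem pairing_odd (m : M.carrier) {r : R.carrier} (hr : r ∈ R.grading.odd) (y : Ext N R) :
    pairing ((m ⊗ₜ r : Ext M R) ⊗ₜ y) = asc m (rmul N r (extParity N R y)) := by
  induction y using ext_induction with
  | ha x y hx hy => simp only [map_add, TensorProduct.tmul_add, hx, hy]
  | he n s hs =>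
    rw [pairing_tmul, braid_odd _ _ hr, rmul_tmul, extParity, TensorProduct.map_tmul, rmul_tmul,
      asc_tmul, Grading.parity_of_even _ hs, R.even_comm s hs]
  | ho n s hs =>
    rw [pairing_tmul, braid_odd _ _ hr, rmul_tmul, extParity, TensorProduct.map_tmul, rmul_tmul,
      asc_tmul, Grading.parity_of_odd _ hs, R.odd_anticomm r hr s hs, neg_mul]

theorem actLeft_asc {f : Ext M R ≃ₗ[K] Ext M R} (hf : f ∈ GLPoints M R) (m : M.carrier)
    (y : Ext N R) : actLeft f (asc m y) = pairing (f (m ⊗ₜ 1) ⊗ₜ y) := by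
  induction y using TensorProduct.induction_on with
  | zero => simp
  | add x y hx hy => simp only [map_add, TensorProduct.tmul_add, hx, hy]
  | tmul n s =>
    rw [pairing_tmul, asc_tmul, tmul_eq_rmul (M := M.tensor N), (actLeft_mem hf).1, ← braid_even _ _ R.one_mem,
      actLeft_braid]

theorem actRight_braid {g : Ext N R ≃ₗ[K] Ext N R} (hg : g ∈ GLPoints N R) (x : Ext M R)
    (n : N.carrier) : actRight g (braid M N R (x ⊗ₜ n)) = pairing (x ⊗ₜ g (n ⊗ₜ 1)) := by
  induction x using ext_induction with
  | ha x y hx hy => simp only [map_add, TensorProduct.add_tmul, hx, hy]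
  | he m r hr =>
    rw [braid_even _ _ hr, pairing_even _ hr, ← hg.1, rmul_tmul, one_mul, ← actRight_asc, asc_tmul]
  | ho m r hr =>
    rw [braid_odd _ _ hr, pairing_odd _ hr, ← hg.2, ← hg.1, extParity, TensorProduct.map_tmul,
      Grading.parity_of_even _ R.one_mem, rmul_tmul, one_mul, ← actRight_asc, asc_tmul]

theorem act_comm {f : Ext M R ≃ₗ[K] Ext M R} (hf : f ∈ GLPoints M R)
    {g : Ext N R ≃ₗ[K] Ext N R} (hg : g ∈ GLPoints N R) :
    actLeft (N := N) f * actRight g = actRight g * actLeft f := by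
  ext z
  change actLeft f (actRight g z) = actRight g (actLeft f z)
  induction z using asc_induction with
  | ha x y hx hy => simp only [map_add, hx, hy]
  | ht m y =>
    induction y using TensorProduct.induction_on with
    | zero => simp
    | add x y hx hy => simp only [map_add, hx, hy]
    | tmul n s =>
      rw [asc_tmul, tmul_eq_rmul (M := M.tensor N), (actRight_mem hg).1, (actLeft_mem hf).1, (actLeft_mem hf).1,
        (actRight_mem hg).1]
      congr 1
      conv_rhs => rw [← braid_even _ _ R.one_mem, actLeft_braid, actRight_braid hg]
      rw [← asc_tmul, actRight_asc, actLeft_asc hf]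

theorem actLeft_mul (f f' : Ext M R ≃ₗ[K] Ext M R) :
    actLeft (N := N) (f * f') = actLeft f * actLeft f' := by
  ext z
  change actLeft (f * f') z = actLeft f (actLeft f' z)
  induction z using braid_induction with
  | ha x y hx hy => simp only [map_add, hx, hy]
  | ht m y => simp only [actLeft_braid]; rfl

theorem actRight_mul (g g' : Ext N R ≃ₗ[K] Ext N R) :
    actRight (M := M) (g * g') = actRight g * actRight g' := by
  ext z
  change actRight (g * g') z = actRight g (actRight g' z)
  induction z using asc_induction with
  | ha x y hx hy => simp only [map_add, hx, hy]
  | ht m y => simp only [actRight_asc]; rfl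

theorem actLeft_one : actLeft (N := N) (1 : Ext M R ≃ₗ[K] Ext M R) = 1 := by
  ext z
  induction z using braid_induction with
  | ha x y hx hy => simp only [map_add, hx, hy]
  | ht m y => rw [actLeft_braid]; rfl

theorem actRight_one : actRight (M := M) (1 : Ext N R ≃ₗ[K] Ext N R) = 1 := by
  ext z
  induction z using asc_induction with
  | ha x y hx hy => simp only [map_add, hx, hy]
  | ht m y => rw [actRight_asc]; rfl

/-- The tensor product of representations: `g` acts by `(ρ_A(g) ⊗ id) ∘ (id ⊗ ρ_B(g))`. -/
def SuperRep.tensor {V : Superspace K} (A B : SuperRep V) : SuperRep V where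
  space := A.space.tensor B.space
  ρ R :=
    { toFun := fun g => ⟨actLeft (A.ρ R g).1 * actRight (B.ρ R g).1,
        mul_mem (actLeft_mem (A.ρ R g).2) (actRight_mem (B.ρ R g).2)⟩
      map_one' := Subtype.ext (by simp [actLeft_one, actRight_one])
      map_mul' := fun g h => Subtype.ext (by
        simp only [map_mul, Subgroup.coe_mul, actLeft_mul, actRight_mul, mul_assoc]
        rw [← mul_assoc (actLeft (A.ρ R h).1), act_comm (A.ρ R h).2 (B.ρ R g).2, mul_assoc]) }
  natural := by
    intro R S φ g h hgh z
    change actLeft (A.ρ S h).1 (actRight (B.ρ S h).1 _) =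
      extMap _ φ (actLeft (A.ρ R g).1 (actRight (B.ρ R g).1 z))
    have hA := A.natural R S φ g h hgh
    have hB := B.natural R S φ g h hgh
    have h1 : ∀ z, actRight (B.ρ S h).1 (extMap (A.space.tensor B.space) φ z) =
        extMap _ φ (actRight (B.ρ R g).1 z) := by
      intro z
      induction z using asc_induction with
      | ha x y hx hy => simp only [map_add, hx, hy]
      | ht m y => rw [extMap_asc, actRight_asc, hB, actRight_asc, extMap_asc]
    have h2 : ∀ z, actLeft (A.ρ S h).1 (extMap (A.space.tensor B.space) φ z) =
        extMap _ φ (actLeft (A.ρ R g).1 z) := by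
      intro z
      induction z using braid_induction with
      | ha x y hx hy => simp only [map_add, hx, hy]
      | ht x n => rw [extMap_braid, actLeft_braid, hA, actLeft_braid, extMap_braid]
    rw [h1, h2]

end Tensor

/-! ### Subrepresentations and quotients -/

section Quotient

/-- The image of `J ⊗ R` in `M ⊗ R`, for a subspace `J` of `M`. -/
def extSub {M : Superspace K} (J : Submodule K M.carrier) (R : SupercommAlgebra K) :
    Submodule K (Ext M R) :=
  LinearMap.range (TensorProduct.map J.subtype (LinearMap.id : R.carrier →ₗ[K] R.carrier))

theorem tmul_mem_extSub {M : Superspace K} {J : Submodule K M.carrier} {R : SupercommAlgebra K}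
    {j : M.carrier} (hj : j ∈ J) (r : R.carrier) : (j ⊗ₜ r : Ext M R) ∈ extSub J R :=
  ⟨(⟨j, hj⟩ : J) ⊗ₜ r, rfl⟩

theorem extSub_le {M : Superspace K} {J : Submodule K M.carrier} {R : SupercommAlgebra K}
    {P : Submodule K (Ext M R)} (h : ∀ j ∈ J, ∀ r, j ⊗ₜ r ∈ P) : extSub J R ≤ P := by
  rintro _ ⟨y, rfl⟩
  induction y using TensorProduct.induction_on with
  | zero => simp
  | add x y hx hy => rw [map_add]; exact add_mem hx hy
  | tmul j r => exact h _ j.2 _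

theorem extSub_stable {M : Superspace K} {J : Submodule K M.carrier} {R : SupercommAlgebra K}
    (f : Ext M R ≃ₗ[K] Ext M R) {P : Submodule K (Ext M R)}
    (h : ∀ j ∈ J, ∀ r, f (j ⊗ₜ r) ∈ P) : ∀ x ∈ extSub J R, f x ∈ P :=
  extSub_le (P := P.comap f.toLinearMap) h

/-- Subrepresentations: graded subspaces `J` such that `J ⊗ R` is stable under `GL(V)(R)` for
all `R`. -/
structure SubRep {V : Superspace K} (A : SuperRep V) where
  carrier : Submodule K A.space.carrier
  parity_mem : ∀ x ∈ carrier, A.space.grading.parity x ∈ carrier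
  stable : ∀ (R : SupercommAlgebra K) (g : GLPoints V R), ∀ x ∈ extSub carrier R,
    (A.ρ R g).1 x ∈ extSub carrier R

variable [CharZero K]

/-- The quotient grading of `M / J`, for a graded subspace `J`. -/
def Grading.quotient {M : Type u} [AddCommGroup M] [Module K M] (G : Grading K M)
    (J : Submodule K M) (hJ : ∀ x ∈ J, G.parity x ∈ J) : Grading K (M ⧸ J) :=
  Grading.ofInvolution (J.mapQ J G.parity hJ) (by
    intro x
    obtain ⟨x, rfl⟩ := J.mkQ_surjective x
    simp [Grading.parity_parity])

theorem Grading.parity_quotient {M : Type u} [AddCommGroup M] [Module K M] (G : Grading K M)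
    (J : Submodule K M) (hJ : ∀ x ∈ J, G.parity x ∈ J) :
    (G.quotient J hJ).parity = J.mapQ J G.parity hJ :=
  Grading.parity_ofInvolution (J.mapQ J G.parity hJ) _

/-- The quotient superspace `M / J`. -/
abbrev Superspace.quotient (M : Superspace K) (J : Submodule K M.carrier)
    (hJ : ∀ x ∈ J, M.grading.parity x ∈ J) : Superspace K where
  carrier := M.carrier ⧸ J
  grading := M.grading.quotient J hJ

variable {M : Superspace K} {J : Submodule K M.carrier} {hJ : ∀ x ∈ J, M.grading.parity x ∈ J}
  {R : SupercommAlgebra K}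

/-- The projection `M ⊗ R → (M / J) ⊗ R`. -/
def extMk (M : Superspace K) (J : Submodule K M.carrier)
    (hJ : ∀ x ∈ J, M.grading.parity x ∈ J) (R : SupercommAlgebra K) :
    Ext M R →ₗ[K] Ext (M.quotient J hJ) R :=
  LinearMap.rTensor R.carrier J.mkQ

theorem extMk_surjective : Function.Surjective (extMk M J hJ R) :=
  LinearMap.rTensor_surjective _ J.mkQ_surjective

/-- The endomorphism of `(M / J) ⊗ R` induced by an endomorphism of `M ⊗ R`. -/
def quotMap (f : Ext M R →ₗ[K] Ext M R) (hf : ∀ x ∈ extSub J R, f x ∈ extSub J R) :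
    Ext (M.quotient J hJ) R →ₗ[K] Ext (M.quotient J hJ) R :=
  (TensorProduct.quotientTensorEquiv R.carrier J).symm.toLinearMap ∘ₗ
    (extSub J R).mapQ (extSub J R) f hf ∘ₗ
    (TensorProduct.quotientTensorEquiv R.carrier J).toLinearMap

theorem quotMap_mk (f : Ext M R →ₗ[K] Ext M R) (hf : ∀ x ∈ extSub J R, f x ∈ extSub J R)
    (x : Ext M R) : quotMap (hJ := hJ) f hf (extMk M J hJ R x) = extMk M J hJ R (f x) := by
  have h : (TensorProduct.quotientTensorEquiv R.carrier J).toLinearMap ∘ₗ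
      LinearMap.rTensor R.carrier J.mkQ = (extSub J R).mkQ := TensorProduct.ext' fun _ _ => rfl
  have h' := LinearMap.congr_fun h
  exact (LinearEquiv.symm_apply_eq _).2 ((congrArg _ (h' x)).trans (h' (f x)).symm)

theorem rmul_mk (s : R.carrier) (x : Ext M R) :
    rmul (M.quotient J hJ) s (extMk M J hJ R x) = extMk M J hJ R (rmul M s x) := by
  induction x using TensorProduct.induction_on with
  | zero => simp
  | add x y hx hy => simp only [map_add, hx, hy]
  | tmul m r => rfl

theorem extParity_mk (x : Ext M R) :
    extParity (M.quotient J hJ) R (extMk M J hJ R x) = extMk M J hJ R (extParity M R x) := by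
  induction x using TensorProduct.induction_on with
  | zero => simp
  | add x y hx hy => simp only [map_add, hx, hy]
  | tmul m r => simp [extMk, extParity, Grading.parity_quotient]

theorem extMap_mk {S : SupercommAlgebra K} (φ : R.Hom S) (x : Ext M R) :
    extMap (M.quotient J hJ) φ (extMk M J hJ R x) = extMk M J hJ S (extMap M φ x) := by
  induction x using TensorProduct.induction_on with
  | zero => simp
  | add x y hx hy => simp only [map_add, hx, hy]
  | tmul m r => rfl

/-- The element of `GL(M / J)(R)` induced by an element of `GL(M)(R)` preserving `J ⊗ R`. -/
def quotAct (hJ : ∀ x ∈ J, M.grading.parity x ∈ J) (f : GLPoints M R)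
    (hf : ∀ x ∈ extSub J R, f.1 x ∈ extSub J R)
    (hf' : ∀ x ∈ extSub J R, f⁻¹.1 x ∈ extSub J R) : GLPoints (M.quotient J hJ) R :=
  ⟨LinearEquiv.ofLinearMap (quotMap f.1.toLinearMap hf) (quotMap f⁻¹.1.toLinearMap hf')
    (LinearMap.ext fun z => by
      obtain ⟨x, rfl⟩ := extMk_surjective z
      rw [LinearMap.comp_apply, quotMap_mk, quotMap_mk]
      exact congrArg _ (f.1.apply_symm_apply x))
    (LinearMap.ext fun z => by
      obtain ⟨x, rfl⟩ := extMk_surjective z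
      rw [LinearMap.comp_apply, quotMap_mk, quotMap_mk]
      exact congrArg _ (f.1.symm_apply_apply x)), by
    constructor
    · intro r z
      obtain ⟨x, rfl⟩ := extMk_surjective z
      rw [LinearEquiv.coe_ofLinearMap, rmul_mk, quotMap_mk, quotMap_mk, rmul_mk]
      exact congrArg _ (f.2.1 r x)
    · intro z
      obtain ⟨x, rfl⟩ := extMk_surjective z
      rw [LinearEquiv.coe_ofLinearMap, extParity_mk, quotMap_mk, quotMap_mk, extParity_mk]
      exact congrArg _ (f.2.2 x)⟩

theorem quotAct_mk (f : GLPoints M R) (hf : ∀ x ∈ extSub J R, f.1 x ∈ extSub J R)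
    (hf' : ∀ x ∈ extSub J R, f⁻¹.1 x ∈ extSub J R) (x : Ext M R) :
    (quotAct hJ f hf hf').1 (extMk M J hJ R x) = extMk M J hJ R (f.1 x) :=
  quotMap_mk _ hf x

theorem quotAct_one (f : GLPoints M R) (hf : ∀ x ∈ extSub J R, f.1 x ∈ extSub J R)
    (hf' : ∀ x ∈ extSub J R, f⁻¹.1 x ∈ extSub J R) (h : f = 1) : quotAct hJ f hf hf' = 1 := by
  refine Subtype.ext (LinearEquiv.ext fun z => ?_)
  obtain ⟨x, rfl⟩ := extMk_surjective z
  rw [quotAct_mk, h]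
  rfl

theorem quotAct_mul (f g k : GLPoints M R) (hf : ∀ x ∈ extSub J R, f.1 x ∈ extSub J R)
    (hf' : ∀ x ∈ extSub J R, f⁻¹.1 x ∈ extSub J R) (hg : ∀ x ∈ extSub J R, g.1 x ∈ extSub J R)
    (hg' : ∀ x ∈ extSub J R, g⁻¹.1 x ∈ extSub J R) (hk : ∀ x ∈ extSub J R, k.1 x ∈ extSub J R)
    (hk' : ∀ x ∈ extSub J R, k⁻¹.1 x ∈ extSub J R) (h : k = f * g) :
    quotAct hJ k hk hk' = quotAct hJ f hf hf' * quotAct hJ g hg hg' := by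
  refine Subtype.ext (LinearEquiv.ext fun z => ?_)
  obtain ⟨x, rfl⟩ := extMk_surjective z
  rw [quotAct_mk, Subgroup.coe_mul, LinearEquiv.mul_apply, quotAct_mk, quotAct_mk, h]
  rfl

/-- The quotient of a representation by a subrepresentation. -/
def SuperRep.quotient {V : Superspace K} (A : SuperRep V) (J : SubRep A) : SuperRep V where
  space := A.space.quotient J.carrier J.parity_mem
  ρ R :=
    { toFun := fun g => quotAct J.parity_mem (A.ρ R g) (J.stable R g) (by
        rw [← map_inv]
        exact J.stable R g⁻¹)
      map_one' := quotAct_one _ _ _ (map_one _)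
      map_mul' := fun g h => quotAct_mul _ _ _ _ _ _ _ _ _ (map_mul _ g h) }
  natural := by
    intro R S φ g h hgh z
    obtain ⟨x, rfl⟩ := extMk_surjective z
    rw [extMap_mk]
    exact (quotAct_mk _ _ _ _).trans (((congrArg _ (A.natural R S φ g h hgh x)).trans
      (extMap_mk φ _).symm).trans (congrArg _ (quotAct_mk _ _ _ _).symm))

end Quotient

/-! ### Exterior powers -/

section Exterior

variable [CharZero K]

/-- The swap of the first two factors with the sign rule:
`v ⊗ (u ⊗ w) ↦ (-1)^{|v||u|} u ⊗ (v ⊗ w)`. -/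
def swapFirst (M N : Superspace K) :
    (M.tensor (M.tensor N)).carrier →ₗ[K] (M.tensor (M.tensor N)).carrier :=
  (TensorProduct.leftComm K M.carrier M.carrier N.carrier).toLinearMap ∘ₗ
    (TensorProduct.map M.grading.evenProj LinearMap.id +
      TensorProduct.map M.grading.oddProj (LinearMap.rTensor N.carrier M.grading.parity))

variable {M N : Superspace K} {R : SupercommAlgebra K}

theorem swapFirst_even {v : M.carrier} (hv : v ∈ M.grading.even) (u : M.carrier) (w : N.carrier) :
    swapFirst M N (v ⊗ₜ (u ⊗ₜ w)) = u ⊗ₜ (v ⊗ₜ w) := by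
  simp [swapFirst, Grading.evenProj_of_even _ hv, Grading.oddProj_of_even _ hv]

theorem swapFirst_odd {v : M.carrier} (hv : v ∈ M.grading.odd) (u : M.carrier) (w : N.carrier) :
    swapFirst M N (v ⊗ₜ (u ⊗ₜ w)) = M.grading.parity u ⊗ₜ (v ⊗ₜ w) := by
  simp [swapFirst, Grading.evenProj_of_odd _ hv, Grading.oddProj_of_odd _ hv]

theorem swapFirst_swapFirst (z : (M.tensor (M.tensor N)).carrier) :
    swapFirst M N (swapFirst M N z) = z := by
  induction z using TensorProduct.induction_on with
  | zero => simp
  | add x y hx hy => simp only [map_add, hx, hy]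
  | tmul v y =>
    induction y using TensorProduct.induction_on with
    | zero => simp
    | add x y hx hy => simp only [map_add, TensorProduct.tmul_add, hx, hy]
    | tmul u w =>
      obtain ⟨a, ha, b, hb, rfl⟩ := M.grading.exists_even_odd v
      obtain ⟨c, hc, d, hd, rfl⟩ := M.grading.exists_even_odd u
      simp only [TensorProduct.add_tmul, TensorProduct.tmul_add, map_add, swapFirst_even ha,
        swapFirst_odd hb, swapFirst_even hc, swapFirst_odd hd, Grading.parity_of_even _ ha,
        Grading.parity_of_odd _ hb, Grading.parity_of_even _ hc, Grading.parity_of_odd _ hd,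
        TensorProduct.neg_tmul, map_neg, neg_neg]

theorem swapFirst_parity (z : (M.tensor (M.tensor N)).carrier) :
    swapFirst M N ((M.tensor (M.tensor N)).grading.parity z) =
      (M.tensor (M.tensor N)).grading.parity (swapFirst M N z) := by
  simp only [Grading.parity_tensor]
  induction z using TensorProduct.induction_on with
  | zero => simp
  | add x y hx hy => simp only [map_add, hx, hy]
  | tmul v y =>
    induction y using TensorProduct.induction_on with
    | zero => simp
    | add x y hx hy => simp only [map_add, TensorProduct.tmul_add, hx, hy]
    | tmul u w =>
      obtain ⟨a, ha, b, hb, rfl⟩ := M.grading.exists_even_odd v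
      simp only [TensorProduct.add_tmul, map_add, swapFirst_even ha,
        swapFirst_odd hb, TensorProduct.map_tmul, Grading.parity_of_even _ ha,
        Grading.parity_of_odd _ hb, TensorProduct.neg_tmul, TensorProduct.tmul_neg, map_neg]

/-- The `R`-linear extension of `swapFirst`. -/
def extSwap (M N : Superspace K) (R : SupercommAlgebra K) :
    Ext (M.tensor (M.tensor N)) R →ₗ[K] Ext (M.tensor (M.tensor N)) R :=
  LinearMap.rTensor R.carrier (swapFirst M N)

theorem extSwap_extSwap (z : Ext (M.tensor (M.tensor N)) R) :
    extSwap M N R (extSwap M N R z) = z := by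
  induction z using TensorProduct.induction_on with
  | zero => simp
  | add x y hx hy => simp only [map_add, hx, hy]
  | tmul m r => exact congrArg (· ⊗ₜ[K] r) (swapFirst_swapFirst m)

theorem extSwap_rmul (s : R.carrier) (z : Ext (M.tensor (M.tensor N)) R) :
    extSwap M N R (rmul _ s z) = rmul _ s (extSwap M N R z) := by
  induction z using TensorProduct.induction_on with
  | zero => simp
  | add x y hx hy => simp only [map_add, hx, hy]
  | tmul m r => rfl

theorem extSwap_asc_even {m : M.carrier} (hm : m ∈ M.grading.even) (n : M.carrier) (y : Ext N R) :
    extSwap M N R (asc m (asc n y)) = asc n (asc m y) := by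
  induction y using TensorProduct.induction_on with
  | zero => simp
  | add x y hx hy => simp only [map_add, hx, hy]
  | tmul w r => exact congrArg (· ⊗ₜ[K] r) (swapFirst_even hm n w)

theorem extSwap_asc_odd {m : M.carrier} (hm : m ∈ M.grading.odd) (n : M.carrier) (y : Ext N R) :
    extSwap M N R (asc m (asc n y)) = asc (M.grading.parity n) (asc m y) := by
  induction y using TensorProduct.induction_on with
  | zero => simp
  | add x y hx hy => simp only [map_add, hx, hy]
  | tmul w r => exact congrArg (· ⊗ₜ[K] r) (swapFirst_odd hm n w)

theorem asc_tmul' (m n : M.carrier) (w : N.carrier) (r : R.carrier) :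
    asc m ((n ⊗ₜ[K] w) ⊗ₜ[K] r : Ext (M.tensor N) R) =
      ((m ⊗ₜ (n ⊗ₜ w)) ⊗ₜ r : Ext (M.tensor (M.tensor N)) R) := rfl

theorem two_extSwap_braid (x : Ext M R) (n : M.carrier) (w : N.carrier) :
    (2 : K) • extSwap M N R (braid M (M.tensor N) R (x ⊗ₜ (n ⊗ₜ w))) =
      asc n (braid M N R ((x + extParity M R x) ⊗ₜ w)) +
        asc (M.grading.parity n) (braid M N R ((x - extParity M R x) ⊗ₜ w)) := by
  induction x using TensorProduct.induction_on with
  | zero => simp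
  | add x y hx hy =>
    rw [TensorProduct.add_tmul, map_add, map_add, smul_add, hx, hy, map_add, add_sub_add_comm,
      add_add_add_comm x, TensorProduct.add_tmul (x + _), TensorProduct.add_tmul (x - _)]
    simp only [map_add]
    abel
  | tmul m r =>
    obtain ⟨a, ha, b, hb, rfl⟩ := M.grading.exists_even_odd m
    obtain ⟨c, hc, d, hd, rfl⟩ := R.grading.exists_even_odd r
    have hn := Grading.parity_parity M.grading n
    simp only [two_smul, TensorProduct.add_tmul, TensorProduct.tmul_add, map_add, extParity,
      TensorProduct.map_tmul, Grading.parity_of_even _ ha, Grading.parity_of_odd _ hb,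
      Grading.parity_of_even _ hc, Grading.parity_of_odd _ hd, TensorProduct.neg_tmul,
      TensorProduct.tmul_neg, neg_neg, TensorProduct.sub_tmul, map_sub, map_neg,
      braid_even _ _ hc, braid_odd _ _ hd, Grading.parity_tensor, extSwap,
      LinearMap.rTensor_tmul, swapFirst_even ha, swapFirst_odd hb, hn]
    simp only [fun m k (v : N.carrier) s => asc_tmul' (R := R) m k v s]
    abel

theorem extSwap_actLeft {f : Ext M R ≃ₗ[K] Ext M R} (hf : f ∈ GLPoints M R)
    (z : Ext (M.tensor (M.tensor N)) R) :
    extSwap M N R (actLeft f z) = actRight (actLeft f) (extSwap M N R z) := by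
  have h2 : ∀ x y : Ext (M.tensor (M.tensor N)) R, (2 : K) • x = (2 : K) • y → x = y :=
    fun x y h => smul_right_injective _ (two_ne_zero : (2 : K) ≠ 0) h
  have key : ∀ (m n : M.carrier) (w : N.carrier),
      extSwap M N R (actLeft f (asc m (asc n (w ⊗ₜ 1)))) =
        actRight (actLeft f) (extSwap M N R (asc m (asc n (w ⊗ₜ 1)))) := by
    intro m n w
    have hadd : ∀ (a b : M.carrier) (y : Ext (M.tensor N) R),
        asc (a + b) y = asc a y + asc b y := fun a b y => by simp [asc]
    obtain ⟨a, ha, b, hb, rfl⟩ := M.grading.exists_even_odd m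
    simp only [hadd, map_add]
    congr 1
    · apply h2
      have h : asc a (asc n (w ⊗ₜ[K] (1 : R.carrier))) =
          braid M (M.tensor N) R ((a ⊗ₜ 1) ⊗ₜ (n ⊗ₜ w)) := (braid_even _ _ R.one_mem).symm
      rw [extSwap_asc_even ha, h, actLeft_braid, two_extSwap_braid, ← hf.2, actRight_asc,
        asc_tmul, ← braid_even _ _ R.one_mem, actLeft_braid]
      simp [extParity, Grading.parity_of_even _ ha, Grading.parity_of_even _ R.one_mem, two_smul,
        TensorProduct.add_tmul]
    · apply h2
      have h : asc b (asc n (w ⊗ₜ[K] (1 : R.carrier))) =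
          braid M (M.tensor N) R ((b ⊗ₜ 1) ⊗ₜ (n ⊗ₜ w)) := (braid_even _ _ R.one_mem).symm
      rw [extSwap_asc_odd hb, h, actLeft_braid, two_extSwap_braid, ← hf.2, actRight_asc,
        asc_tmul, ← braid_even _ _ R.one_mem, actLeft_braid]
      simp [extParity, Grading.parity_of_odd _ hb, Grading.parity_of_even _ R.one_mem, two_smul,
        TensorProduct.add_tmul, TensorProduct.neg_tmul]
  have hR := actRight_mem (M := M) (actLeft_mem (N := N) hf)
  have hL := actLeft_mem (N := M.tensor N) hf
  induction z using asc_induction with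
  | ha x y hx hy => simp only [map_add, hx, hy]
  | ht m y =>
    induction y using asc_induction with
    | ha x y hx hy => simp only [map_add, hx, hy]
    | ht n y =>
      induction y using TensorProduct.induction_on with
      | zero => simp
      | add x y hx hy => simp only [map_add, hx, hy]
      | tmul w r =>
        have h : asc m (asc n (w ⊗ₜ[K] r)) =
            rmul (M.tensor (M.tensor N)) r (asc m (asc n (w ⊗ₜ[K] (1 : R.carrier)))) := by
          rw [rmul_asc, rmul_asc, rmul_tmul, one_mul]
        rw [h, hL.1, extSwap_rmul, extSwap_rmul, hR.1, key]

theorem extSwap_actRight {f : Ext M R ≃ₗ[K] Ext M R} (hf : f ∈ GLPoints M R)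
    (z : Ext (M.tensor (M.tensor N)) R) :
    extSwap M N R (actRight (actLeft f) z) = actLeft f (extSwap M N R z) := by
  have h := extSwap_actLeft hf (extSwap M N R z)
  rw [extSwap_extSwap] at h
  rw [← h, extSwap_extSwap]

theorem extSwap_actRight_actRight (g : Ext N R ≃ₗ[K] Ext N R)
    (z : Ext (M.tensor (M.tensor N)) R) :
    extSwap M N R (actRight (actRight g) z) = actRight (actRight g) (extSwap M N R z) := by
  induction z using asc_induction with
  | ha x y hx hy => simp only [map_add, hx, hy]
  | ht m y =>
    induction y using asc_induction with
    | ha x y hx hy => simp only [map_add, hx, hy]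
    | ht n y =>
      have hadd : ∀ (a b : M.carrier) (y : Ext (M.tensor N) R),
          asc (a + b) y = asc a y + asc b y := fun a b y => by simp [asc]
      obtain ⟨a, ha, b, hb, rfl⟩ := M.grading.exists_even_odd m
      simp only [hadd, map_add, actRight_asc, extSwap_asc_even ha, extSwap_asc_odd hb]

theorem extSwap_tensor {V : Superspace K} (A B : SuperRep V) (g : GLPoints V R)
    (z : Ext (A.space.tensor (A.space.tensor B.space)) R) :
    extSwap A.space B.space R (((A.tensor (A.tensor B)).ρ R g).1 z) =
      ((A.tensor (A.tensor B)).ρ R g).1 (extSwap A.space B.space R z) := by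
  have e : ∀ z : Ext (A.space.tensor (A.space.tensor B.space)) R,
      ((A.tensor (A.tensor B)).ρ R g).1 z = actLeft (A.ρ R g).1
        (actRight (actLeft (A.ρ R g).1) (actRight (actRight (B.ρ R g).1) z)) := fun z =>
    congrArg (actLeft (A.ρ R g).1) (DFunLike.congr_fun
      (actRight_mul (M := A.space) (actLeft (N := B.space) (A.ρ R g).1) (actRight (B.ρ R g).1)) z)
  have hc := fun z => DFunLike.congr_fun
    (act_comm (A.ρ R g).2 (actLeft_mem (N := B.space) (A.ρ R g).2)) z
  refine (congrArg _ (e z)).trans (Eq.trans ?_ (e _).symm)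
  rw [extSwap_actLeft (A.ρ R g).2, extSwap_actRight (A.ρ R g).2, extSwap_actRight_actRight]
  exact (hc _).symm

theorem parity_mem_tensorLeft {J : Submodule K N.carrier}
    (hJ : ∀ x ∈ J, N.grading.parity x ∈ J) :
    ∀ x ∈ LinearMap.range (LinearMap.lTensor M.carrier J.subtype),
      (M.tensor N).grading.parity x ∈ LinearMap.range (LinearMap.lTensor M.carrier J.subtype) := by
  rintro _ ⟨y, rfl⟩
  rw [Grading.parity_tensor]
  induction y using TensorProduct.induction_on with
  | zero => simp
  | add x y hx hy => simp only [map_add]; exact add_mem hx hy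
  | tmul a j => exact ⟨M.grading.parity a ⊗ₜ ⟨_, hJ j j.2⟩, rfl⟩

theorem extSub_tensorLeft_le {J : Submodule K N.carrier} {Q : Submodule K (Ext (M.tensor N) R)}
    (hQ : ∀ a : M.carrier, ∀ j ∈ J, ∀ r : R.carrier, (a ⊗ₜ j) ⊗ₜ r ∈ Q) :
    extSub (M := M.tensor N) (LinearMap.range (LinearMap.lTensor M.carrier J.subtype)) R ≤ Q := by
  refine extSub_le ?_
  rintro _ ⟨y, rfl⟩ r
  induction y using TensorProduct.induction_on with
  | zero => simp
  | add x y hx hy => simp only [map_add, TensorProduct.add_tmul]; exact add_mem hx hy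
  | tmul a j => exact hQ a j j.2 r

theorem stable_tensorLeft {J : Submodule K N.carrier} (hJ : ∀ x ∈ J, N.grading.parity x ∈ J)
    {f : Ext M R ≃ₗ[K] Ext M R} (hf : f ∈ GLPoints M R) {g : Ext N R ≃ₗ[K] Ext N R}
    (hg : ∀ x ∈ extSub J R, g x ∈ extSub J R) :
    ∀ x ∈ extSub (M := M.tensor N)
        (LinearMap.range (LinearMap.lTensor M.carrier J.subtype)) R,
      actLeft f (actRight g x) ∈ extSub (M := M.tensor N)
        (LinearMap.range (LinearMap.lTensor M.carrier J.subtype)) R := by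
  set P : Submodule K (Ext (M.tensor N) R) := extSub (M := M.tensor N)
    (LinearMap.range (LinearMap.lTensor M.carrier J.subtype)) R with hP
  have hmem : ∀ a : M.carrier, ∀ j ∈ J, ∀ r : R.carrier, (a ⊗ₜ j) ⊗ₜ r ∈ P := fun a j hj r =>
    tmul_mem_extSub (M := M.tensor N) (J := LinearMap.range
      (LinearMap.lTensor M.carrier J.subtype)) ⟨a ⊗ₜ ⟨j, hj⟩, rfl⟩ r
  have hr : P ≤ P.comap (actRight g).toLinearMap := by
    refine extSub_tensorLeft_le fun a j hj r => ?_
    have h1 : extSub J R ≤ P.comap (asc a) := extSub_le fun j hj r => hmem a j hj r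
    change actRight g (asc a (j ⊗ₜ r)) ∈ P
    rw [actRight_asc]
    exact h1 (hg _ (tmul_mem_extSub hj r))
  have hrm : ∀ s, P ≤ P.comap (rmul (M.tensor N) s) := fun s =>
    extSub_tensorLeft_le fun a j hj r => hmem a j hj (r * s)
  have hb : ∀ x : Ext M R, ∀ j ∈ J, braid M N R (x ⊗ₜ j) ∈ P := by
    intro x j hj
    induction x using ext_induction with
    | ha x y hx hy => rw [TensorProduct.add_tmul, map_add]; exact add_mem hx hy
    | he m r hr => rw [braid_even _ _ hr]; exact hmem _ _ hj _
    | ho m r hr => rw [braid_odd _ _ hr]; exact hmem _ _ (hJ _ hj) _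
  have hl : P ≤ P.comap (actLeft (N := N) f).toLinearMap := by
    refine extSub_tensorLeft_le fun a j hj r => ?_
    change actLeft f _ ∈ P
    rw [tmul_eq_rmul (M := M.tensor N), (actLeft_mem hf).1, ← braid_even _ _ R.one_mem,
      actLeft_braid]
    exact hrm r (hb _ j hj)
  exact fun x hx => hl (hr hx)

/-- The subrepresentation `A ⊗ J` of `A ⊗ B`. -/
def SubRep.tensorLeft {V : Superspace K} (A : SuperRep V) {B : SuperRep V} (J : SubRep B) :
    SubRep (A.tensor B) where
  carrier := LinearMap.range (LinearMap.lTensor A.space.carrier J.carrier.subtype)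
  parity_mem := parity_mem_tensorLeft J.parity_mem
  stable R g := stable_tensorLeft J.parity_mem (A.ρ R g).2 (J.stable R g)

theorem parity_mem_antisymm : ∀ x ∈ LinearMap.range (LinearMap.id + swapFirst M N),
    (M.tensor (M.tensor N)).grading.parity x ∈
      LinearMap.range (LinearMap.id + swapFirst M N) := by
  rintro _ ⟨y, rfl⟩
  refine ⟨(M.tensor (M.tensor N)).grading.parity y, ?_⟩
  rw [LinearMap.add_apply, LinearMap.add_apply, map_add, swapFirst_parity]
  rfl

theorem stable_antisymm (f : Ext (M.tensor (M.tensor N)) R ≃ₗ[K] Ext (M.tensor (M.tensor N)) R)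
    (hf : ∀ z, extSwap M N R (f z) = f (extSwap M N R z)) :
    ∀ x ∈ extSub (M := M.tensor (M.tensor N)) (LinearMap.range (LinearMap.id + swapFirst M N)) R,
      f x ∈ extSub (M := M.tensor (M.tensor N))
        (LinearMap.range (LinearMap.id + swapFirst M N)) R := by
  have h0 : ∀ (m : (M.tensor (M.tensor N)).carrier) (r : R.carrier),
      ((LinearMap.id + swapFirst M N :
        (M.tensor (M.tensor N)).carrier →ₗ[K] (M.tensor (M.tensor N)).carrier) m) ⊗ₜ[K] r = m ⊗ₜ[K] r + extSwap M N R (m ⊗ₜ r) :=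
    fun m r => TensorProduct.add_tmul _ _ _
  have h1 : ∀ z : Ext (M.tensor (M.tensor N)) R, z + extSwap M N R z ∈
      extSub (M := M.tensor (M.tensor N)) (LinearMap.range (LinearMap.id + swapFirst M N)) R := by
    intro z
    induction z using TensorProduct.induction_on with
    | zero => simp
    | add x y hx hy => rw [map_add, add_add_add_comm]; exact add_mem hx hy
    | tmul m r =>
      rw [← h0]
      exact tmul_mem_extSub (M := M.tensor (M.tensor N)) (LinearMap.mem_range_self _ m) r
  refine extSub_stable f ?_
  rintro _ ⟨m, rfl⟩ r
  rw [h0, map_add, ← hf]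
  exact h1 _

/-- The subrepresentation of `A ⊗ (A ⊗ B)` spanned by the elements
`v ⊗ (u ⊗ w) + (-1)^{|v||u|} u ⊗ (v ⊗ w)`. -/
def SubRep.antisymm {V : Superspace K} (A B : SuperRep V) :
    SubRep (A.tensor (A.tensor B)) where
  carrier := LinearMap.range (LinearMap.id + swapFirst A.space B.space)
  parity_mem := parity_mem_antisymm
  stable _ g := stable_antisymm _ (extSwap_tensor A B g)

/-- The sum of two subrepresentations. -/
def SubRep.sup {V : Superspace K} {A : SuperRep V} (I J : SubRep A) : SubRep A where
  carrier := I.carrier ⊔ J.carrier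
  parity_mem := by
    intro x hx
    obtain ⟨a, ha, b, hb, rfl⟩ := Submodule.mem_sup.1 hx
    rw [map_add]
    exact Submodule.add_mem_sup (I.parity_mem a ha) (J.parity_mem b hb)
  stable := by
    intro R g
    have hI : extSub I.carrier R ≤ extSub (I.carrier ⊔ J.carrier) R :=
      extSub_le fun j hj r => tmul_mem_extSub (Submodule.mem_sup_left hj) r
    have hJ : extSub J.carrier R ≤ extSub (I.carrier ⊔ J.carrier) R :=
      extSub_le fun j hj r => tmul_mem_extSub (Submodule.mem_sup_right hj) r
    refine extSub_stable _ ?_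
    intro x hx r
    obtain ⟨a, ha, b, hb, rfl⟩ := Submodule.mem_sup.1 hx
    rw [TensorProduct.add_tmul, map_add]
    exact add_mem (hI (I.stable R g _ (tmul_mem_extSub ha r)))
      (hJ (J.stable R g _ (tmul_mem_extSub hb r)))

/-- The zero subrepresentation. -/
def SubRep.bot {V : Superspace K} (A : SuperRep V) : SubRep A where
  carrier := ⊥
  parity_mem := by
    rintro x hx
    rw [Submodule.mem_bot] at hx ⊢
    rw [hx, map_zero]
  stable := by
    intro R g
    refine extSub_stable _ ?_
    intro x hx r
    rw [Submodule.mem_bot] at hx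
    simp [hx]

/-- The tensor powers `V^{⊗ k}` of the standard representation. -/
def tensorPower (V : Superspace K) : ℕ → SuperRep V
  | 0 => SuperRep.one V
  | k + 1 => (SuperRep.std V).tensor (tensorPower V k)

/-- The degree `k` component of the two-sided ideal of the tensor algebra `T(V)` generated by the
elements `v ⊗ u + (-1)^{|v||u|} u ⊗ v`. -/
def exteriorRel (V : Superspace K) : ∀ k : ℕ, SubRep (tensorPower V k)
  | 0 => SubRep.bot _
  | 1 => SubRep.bot _
  | k + 2 => SubRep.sup (SubRep.tensorLeft (SuperRep.std V) (exteriorRel V (k + 1)))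
      (SubRep.antisymm (SuperRep.std V) (tensorPower V k))

/-- The exterior powers `Λ^k V`, with `Λ^k V = 0` for `k < 0`. -/
def exteriorPower (V : Superspace K) : ℤ → SuperRep V
  | Int.ofNat k => (tensorPower V k).quotient (exteriorRel V k)
  | Int.negSucc _ => SuperRep.zero V

end Exterior

/-! ### Grothendieck rings -/

section Grothendieck

/-- Short exact sequences `0 → A → B → C → 0` of representations. -/
def IsShortExact {V : Superspace K} {A B C : SuperRep V} (i : A.Hom B) (p : B.Hom C) : Prop :=
  Function.Injective i.toLin ∧ Function.Exact i.toLin p.toLin ∧ Function.Surjective p.toLin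

/-- Split short exact sequences. -/
def IsSplitExact {V : Superspace K} {A B C : SuperRep V} (i : A.Hom B) (p : B.Hom C) : Prop :=
  IsShortExact i p ∧ ∃ s : C.Hom B, ∀ x, p.toLin (s.toLin x) = x

variable [CharZero K]

/-- The relations `[A ⊗ B] = [A] [B]` and `[1] = 1`. -/
def tensorRelations (V : Superspace K) : Set (MvPolynomial (SuperRep V) ℤ) :=
  {x | ∃ A B : SuperRep V, x = .X (A.tensor B) - .X A * .X B} ∪ {.X (SuperRep.one V) - 1}

/-- The relations `[B] = [A] + [C]` for all short exact sequences `0 → A → B → C → 0`. -/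
def exactRelations (V : Superspace K) : Set (MvPolynomial (SuperRep V) ℤ) :=
  {x | ∃ (A B C : SuperRep V) (i : A.Hom B) (p : B.Hom C), IsShortExact i p ∧
    x = .X B - .X A - .X C}

/-- The relations `[B] = [A] + [C]` for all split short exact sequences `0 → A → B → C → 0`. -/
def splitRelations (V : Superspace K) : Set (MvPolynomial (SuperRep V) ℤ) :=
  {x | ∃ (A B C : SuperRep V) (i : A.Hom B) (p : B.Hom C), IsSplitExact i p ∧
    x = .X B - .X A - .X C}

/-- The Grothendieck ring of the abelian tensor category of finite-dimensional representations of
the supergroup `GL(V)`: the commutative ring generated by the classes `[A]` of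
representations, with `[B] = [A] + [C]` for short exact sequences, `[A ⊗ B] = [A] [B]`, and unit
the class of the trivial line. -/
abbrev GrothendieckRing (V : Superspace K) : Type (u + 1) :=
  MvPolynomial (SuperRep V) ℤ ⧸ Ideal.span (exactRelations V ∪ tensorRelations V)

/-- The split Grothendieck ring: only `[A ⊕ C] = [A] + [C]` is imposed, so that equality of classes
`[A] = [B]` means that `A` and `B` are stably isomorphic. -/
abbrev SplitGrothendieckRing (V : Superspace K) : Type (u + 1) :=
  MvPolynomial (SuperRep V) ℤ ⧸ Ideal.span (splitRelations V ∪ tensorRelations V)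

/-- The class of a representation in the Grothendieck ring. -/
def grothendieckClass {V : Superspace K} (A : SuperRep V) : GrothendieckRing V :=
  Ideal.Quotient.mk _ (MvPolynomial.X A)

/-- The class of a representation in the split Grothendieck ring. -/
def splitClass {V : Superspace K} (A : SuperRep V) : SplitGrothendieckRing V :=
  Ideal.Quotient.mk _ (MvPolynomial.X A)

end Grothendieck

end SuperGL

end

/-! The proof is that the Hankel determinant is, up to sign, the class of an honest representation,
and that this representation has dimension zero, hence is zero. Everything happens in the split
Grothendieck ring; the other ring is a quotient of it.

Expanding the determinant gives a signed sum over permutations `σ` of products of exterior powers of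
total degree `n = (q + 1)(k + q)`. Let `S_n` act on `V^{⊗ n}` so that adjacent transpositions act by
minus the super swap. Then `Λ^n V` is the image of the average over `S_n` (`exteriorRel_carrier`),
and a product of exterior powers is the class of the image of the average over a Young subgroup
(`exists_word_class_eq_prod`). So the determinant is the image, under an additive and
equivalence-invariant function on idempotents (`isRankFunction_image`), of a signed sum of
idempotents of `K[S_n]`. A term with an exterior power of negative degree corresponds to the
idempotent `0`.

This virtual idempotent is a Jacobi–Trudi determinant for a rectangle, so it should be a single
irreducible up to sign. Irreducibility is not needed: it suffices that its norm, measured by the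
dimensions of the corners `e K[S_n] f`, is one. For Young averages such a dimension counts double
cosets, that is, matrices of natural numbers with given margins (`cornerTrace_wordStabilizer`), and
the signed sum of these numbers is a coefficient of the Cauchy determinant identity
(`sum_sign_mul_sum_sign_mul_matrixCount`). In a von Neumann regular algebra, such as `K[S_n]` by
Maschke, cancelling common pieces of opposite sign reduces a virtual idempotent of norm one to plus
or minus a single idempotent (`IsRankFunction.exists_idem_of_norm_eq_one`). Hence the determinant is
plus or minus the class of some `A` (`exists_det_eq`).

Ordinary dimension is a ring homomorphism to the integers. The dimensions of the exterior powers
have generating function `(1 + t)^p / (1 - t)^q`, so they satisfy a recurrence of order `q` in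
degrees above `p`, which makes the `q + 1` columns dependent as soon as `k + q > p`
(`det_wordCount`). Thus `dim A = 0` and `A = 0`. -/

/-! ### Functions on the idempotents of a ring that are additive and invariant under equivalence -/

/-- A function on the idempotents of a ring that is additive on orthogonal idempotents and takes
the same value on equivalent idempotents. -/
structure IsRankFunction {R G : Type*} [Ring R] [AddCommGroup G] (Ψ : R → G) : Prop where
  add : ∀ e f, e * e = e → f * f = f → e * f = 0 → f * e = 0 → Ψ (e + f) = Ψ e + Ψ f
  comm : ∀ a b, a * b * a = a → b * a * b = b → Ψ (a * b) = Ψ (b * a)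

namespace IsRankFunction

variable {R G ι : Type*} [Ring R] [AddCommGroup G] {Ψ : R → G}

theorem map_zero (h : IsRankFunction Ψ) : Ψ 0 = 0 := by
  have := h.add 0 0 (by simp) (by simp) (by simp) (by simp)
  simpa using this

theorem sub (h : IsRankFunction Ψ) {e f : R} (he : e * e = e) (hf : f * f = f) (hef : e * f = f)
    (hfe : f * e = f) : Ψ (e - f) = Ψ e - Ψ f := by
  have := h.add (e - f) f (by simp [mul_sub, sub_mul, he, hf, hef, hfe]) hf
    (by simp [sub_mul, hf, hef]) (by simp [mul_sub, hf, hfe])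
  rw [sub_add_cancel] at this
  rw [this, add_sub_cancel_right]

/-- Removing equivalent subidempotents from two idempotents of opposite signs does not change the
signed sum of the values. -/
theorem sum_update [Fintype ι] [DecidableEq ι] (h : IsRankFunction Ψ) {ε : ι → ℤ} {e : ι → R}
    (he : ∀ i, e i * e i = e i) {i j : ι} (hij : i ≠ j) (hε : ε i + ε j = 0) {a b : R}
    (hab : a * b * a = a) (hba : b * a * b = b) (hia : e i * a = a) (haj : a * e j = a)
    (hjb : e j * b = b) (hbi : b * e i = b) :
    ∑ k, ε k • Ψ (Function.update (Function.update e i (e i - a * b)) j (e j - b * a) k) =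
      ∑ k, ε k • Ψ (e k) := by
  have h1 : Ψ (e i - a * b) = Ψ (e i) - Ψ (a * b) :=
    h.sub (he i) (by rw [← mul_assoc, hab]) (by rw [← mul_assoc, hia]) (by rw [mul_assoc, hbi])
  have h2 : Ψ (e j - b * a) = Ψ (e j) - Ψ (a * b) := by
    rw [h.comm a b hab hba]
    exact h.sub (he j) (by rw [← mul_assoc, hba]) (by rw [← mul_assoc, hjb])
      (by rw [mul_assoc, haj])
  rw [← sub_eq_zero, ← Finset.sum_sub_distrib]
  have h3 : ∀ k, k ∉ ({i, j} : Finset ι) →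
      ε k • Ψ (Function.update (Function.update e i (e i - a * b)) j (e j - b * a) k) -
        ε k • Ψ (e k) = 0 := by
    intro k hk
    simp only [Finset.mem_insert, Finset.mem_singleton, not_or] at hk
    rw [Function.update_of_ne hk.2, Function.update_of_ne hk.1, sub_self]
  rw [← Finset.sum_subset (Finset.subset_univ {i, j}) fun k _ hk => h3 k hk,
    Finset.sum_pair hij, Function.update_of_ne hij, Function.update_self, Function.update_self,
    h1, h2, ← smul_sub, ← smul_sub, sub_sub_cancel_left, sub_sub_cancel_left, ← add_smul, hε,
    zero_smul]

end IsRankFunction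

/-! ### Dimensions of the corners `e R f`, and virtual idempotents of norm one. -/

section CornerTrace

variable (K : Type*) {R : Type*} [Field K] [Ring R] [Algebra K R]

/-- The trace of `x ↦ e x f`; for idempotents `e` and `f`, this is the dimension of `e R f`. -/
noncomputable def cornerTrace (e f : R) : K :=
  LinearMap.trace K R (LinearMap.mulLeft K e ∘ₗ LinearMap.mulRight K f)

variable {K}

theorem cornerTrace_add_left (e e' f : R) :
    cornerTrace K (e + e') f = cornerTrace K e f + cornerTrace K e' f := by
  rw [cornerTrace, cornerTrace, cornerTrace, ← map_add]
  congr 1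
  ext x
  simp [add_mul]

theorem cornerTrace_add_right (e f f' : R) :
    cornerTrace K e (f + f') = cornerTrace K e f + cornerTrace K e f' := by
  rw [cornerTrace, cornerTrace, cornerTrace, ← map_add]
  congr 1
  ext x
  simp [mul_add]

theorem cornerTrace_smul_left (c : K) (e f : R) :
    cornerTrace K (c • e) f = c * cornerTrace K e f := by
  rw [cornerTrace, cornerTrace, ← smul_eq_mul, ← map_smul]
  congr 1
  ext x
  simp

theorem cornerTrace_smul_right (c : K) (e f : R) :
    cornerTrace K e (c • f) = c * cornerTrace K e f := by
  rw [cornerTrace, cornerTrace, ← smul_eq_mul, ← map_smul]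
  congr 1
  ext x
  simp

theorem cornerTrace_zero_left (f : R) : cornerTrace K 0 f = 0 := by
  simp [cornerTrace, LinearMap.mulLeft_zero_eq_zero]

theorem cornerTrace_zero_right (e : R) : cornerTrace K e 0 = 0 := by
  simp [cornerTrace, LinearMap.mulRight_zero_eq_zero]

theorem cornerTrace_sum_left {ι : Type*} (s : Finset ι) (e : ι → R) (f : R) :
    cornerTrace K (∑ i ∈ s, e i) f = ∑ i ∈ s, cornerTrace K (e i) f := by
  classical
  induction s using Finset.induction_on with
  | empty => simp [cornerTrace_zero_left]
  | insert a s ha ih => rw [Finset.sum_insert ha, Finset.sum_insert ha, cornerTrace_add_left, ih]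

theorem cornerTrace_sum_right {ι : Type*} (s : Finset ι) (e : R) (f : ι → R) :
    cornerTrace K e (∑ i ∈ s, f i) = ∑ i ∈ s, cornerTrace K e (f i) := by
  classical
  induction s using Finset.induction_on with
  | empty => simp [cornerTrace_zero_right]
  | insert a s ha ih => rw [Finset.sum_insert ha, Finset.sum_insert ha, cornerTrace_add_right, ih]

/-- As `f` is idempotent, `x ↦ a b x f` is the composite of `x ↦ b x f` and `x ↦ a x f`, so
equivalence invariance is `trace (S T) = trace (T S)`. -/
theorem isRankFunction_cornerTrace_left {f : R} (hf : f * f = f) :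
    IsRankFunction fun e : R => cornerTrace K e f where
  add e e' _ _ _ _ := cornerTrace_add_left e e' f
  comm a b _ _ := by
    have h : ∀ a b : R, LinearMap.mulLeft K (a * b) ∘ₗ LinearMap.mulRight K f =
        (LinearMap.mulLeft K a ∘ₗ LinearMap.mulRight K f) *
          (LinearMap.mulLeft K b ∘ₗ LinearMap.mulRight K f) := fun a b => by
      ext x
      simp [mul_assoc, hf]
    rw [cornerTrace, cornerTrace, h, h, LinearMap.trace_mul_comm]

theorem isRankFunction_cornerTrace_right {e : R} (he : e * e = e) :
    IsRankFunction fun f : R => cornerTrace K e f where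
  add f f' _ _ _ _ := cornerTrace_add_right e f f'
  comm a b _ _ := by
    have h : ∀ a b : R, LinearMap.mulLeft K e ∘ₗ LinearMap.mulRight K (a * b) =
        (LinearMap.mulLeft K e ∘ₗ LinearMap.mulRight K b) *
          (LinearMap.mulLeft K e ∘ₗ LinearMap.mulRight K a) := fun a b => by
      ext x
      simp [← mul_assoc, he]
    rw [cornerTrace, cornerTrace, h, h, LinearMap.trace_mul_comm]

/-- The trace of an idempotent is its rank. -/
theorem trace_eq_finrank_range_of_idem {M : Type*} [AddCommGroup M] [Module K M]
    [FiniteDimensional K M] {f : M →ₗ[K] M} (hf : ∀ x, f (f x) = f x) :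
    LinearMap.trace K M f = (Module.finrank K (LinearMap.range f) : K) :=
  LinearMap.IsProj.trace (p := LinearMap.range f)
    ⟨fun x => LinearMap.mem_range_self f x, by rintro _ ⟨x, rfl⟩; exact hf x⟩

/-- The map `x ↦ e x f` is a projection onto `e R f`, so its trace is a dimension, and it vanishes
only if the corner does. -/
theorem cornerTrace_eq_natCast [FiniteDimensional K R] {e f : R} (he : e * e = e)
    (hf : f * f = f) : ∃ n : ℕ, cornerTrace K e f = n ∧ (n = 0 → ∀ x, e * x * f = 0) := by
  refine ⟨_, trace_eq_finrank_range_of_idem fun x => ?_, fun h x => ?_⟩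
  · simp only [LinearMap.comp_apply, LinearMap.mulLeft_apply, LinearMap.mulRight_apply]
    simp only [mul_assoc, hf]
    rw [← mul_assoc, he]
  · rw [Submodule.finrank_eq_zero] at h
    have := LinearMap.mem_range_self (LinearMap.mulLeft K e ∘ₗ LinearMap.mulRight K f) x
    rw [h, Submodule.mem_bot] at this
    simpa [mul_assoc] using this

/-- In a von Neumann regular algebra, a signed sum of idempotents of norm one is, up to sign, the
class of a single idempotent. -/
theorem IsRankFunction.exists_idem_of_norm_eq_one [CharZero K] [FiniteDimensional K R]
    (hR : ∀ x : R, ∃ y, x * y * x = x) {G ι : Type*} [AddCommGroup G] [Fintype ι] {Φ : R → G}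
    (hΦ : IsRankFunction Φ) (ε : ι → ℤ) (hε : ∀ i, ε i = 1 ∨ ε i = -1) (e : ι → R)
    (he : ∀ i, e i * e i = e i)
    (hnorm : ∑ i, ε i • ∑ j, ε j • cornerTrace K (e i) (e j) = 1) :
    ∃ g : R, g * g = g ∧ (∑ i, ε i • Φ (e i) = Φ g ∨ ∑ i, ε i • Φ (e i) = -Φ g) := by
  classical
  have hd : ∀ {e f : R}, e * e = e → f * f = f →
      ∃ n : ℕ, cornerTrace K e f = n ∧ (n = 0 → ∀ x, e * x * f = 0) :=
    fun he hf => cornerTrace_eq_natCast he hf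
  obtain ⟨N, hN⟩ : ∃ N : ℕ, ∑ i, cornerTrace K 1 (e i) = N := by
    choose n hn using fun i => hd (one_mul (1 : R)) (he i)
    exact ⟨∑ i, n i, by simp [fun i => (hn i).1]⟩
  -- The induction is on the total dimension of the left ideals `R e_i`: as long as two idempotents
  -- of opposite signs have a nonzero corner between them, a common piece is split off both.
  induction N using Nat.strong_induction_on generalizing e with
  | _ N ih =>
    by_cases hx : ∃ i j, ε i + ε j = 0 ∧ ∃ x, e i * x * e j ≠ 0
    · obtain ⟨i, j, hij, x, hx⟩ := hx
      set a := e i * x * e j with ha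
      obtain ⟨y, hy⟩ := hR a
      have hia : e i * a = a := by rw [ha, ← mul_assoc, ← mul_assoc, he]
      have haj : a * e j = a := by rw [ha, mul_assoc, he]
      -- Taking `y a y` in place of `y` makes the inverse reflexive (`b a b = b` as well as `a b a =
      -- a`), and the outer factors put `b` in the opposite corner. Then `a b` and `b a` are
      -- equivalent idempotents below `e i` and `e j`.
      set b := e j * y * a * y * e i with hb
      have hjb : e j * b = b := by rw [hb]; simp only [← mul_assoc, he]
      have hbi : b * e i = b := by rw [hb]; simp only [mul_assoc, he]
      have hbe : b = e j * (y * (a * (y * e i))) := by rw [hb]; simp only [mul_assoc]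
      have haj' : ∀ z, a * (e j * z) = a * z := fun z => by rw [← mul_assoc, haj]
      have hia' : ∀ z, e i * (a * z) = a * z := fun z => by rw [← mul_assoc, hia]
      have hy' : ∀ z, a * (y * (a * z)) = a * z := fun z => by
        rw [← mul_assoc, ← mul_assoc, hy]
      have hab : a * b * a = a := by
        rw [hbe]
        simp only [mul_assoc, haj', hia, hy']
        rw [← mul_assoc, hy]
      have hba : b * a * b = b := by
        rw [hbe]
        simp only [mul_assoc, haj', hia', hy']
      have hne : i ≠ j := by
        rintro rfl
        rcases hε i with h | h <;> omega
      set e' := Function.update (Function.update e i (e i - a * b)) j (e j - b * a) with he'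
      have hidem : ∀ k, e' k * e' k = e' k := by
        intro k
        by_cases hkj : k = j
        · subst hkj
          have h1 : e k * (b * a) = b * a := by rw [← mul_assoc, hjb]
          have h2 : b * a * e k = b * a := by rw [mul_assoc, haj]
          have h3 : b * a * (b * a) = b * a := by rw [← mul_assoc, hba]
          rw [he', Function.update_self]
          simp only [mul_sub, sub_mul, he, h1, h2, h3]
          abel
        · by_cases hki : k = i
          · subst hki
            have h1 : e k * (a * b) = a * b := by rw [← mul_assoc, hia]
            have h2 : a * b * e k = a * b := by rw [mul_assoc, hbi]
            have h3 : a * b * (a * b) = a * b := by rw [← mul_assoc, hab]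
            rw [he', Function.update_of_ne hne, Function.update_self]
            simp only [mul_sub, sub_mul, he, h1, h2, h3]
            abel
          · rw [he', Function.update_of_ne hkj, Function.update_of_ne hki, he]
      have key' : ∀ {Ψ : R → K}, IsRankFunction Ψ →
          ∑ k, ε k • Ψ (e' k) = ∑ k, ε k • Ψ (e k) := fun h =>
        h.sum_update he hne hij hab hba hia haj hjb hbi
      -- The corner dimension is a rank function in each argument separately, so the cancellation
      -- may be undone first on the right and then on the left.
      have hnorm' : ∑ i, ε i • ∑ j, ε j • cornerTrace K (e' i) (e' j) = 1 := by
        rw [← hnorm]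
        calc _ = ∑ i, ε i • ∑ j, ε j • cornerTrace K (e' i) (e j) :=
              Finset.sum_congr rfl fun i _ => by
                rw [key' (isRankFunction_cornerTrace_right (hidem i))]
          _ = ∑ j, ε j • ∑ i, ε i • cornerTrace K (e' i) (e j) := by
              simp only [Finset.smul_sum]
              rw [Finset.sum_comm]
              exact Finset.sum_congr rfl fun _ _ => Finset.sum_congr rfl fun _ _ => smul_comm _ _ _
          _ = ∑ j, ε j • ∑ i, ε i • cornerTrace K (e i) (e j) :=
              Finset.sum_congr rfl fun i _ => by
                rw [key' (isRankFunction_cornerTrace_left (he i))]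
          _ = _ := by
              simp only [Finset.smul_sum]
              rw [Finset.sum_comm]
              exact Finset.sum_congr rfl fun _ _ => Finset.sum_congr rfl fun _ _ => smul_comm _ _ _
      obtain ⟨N', hN'⟩ : ∃ N' : ℕ, ∑ i, cornerTrace K 1 (e' i) = N' := by
        choose n hn using fun i => hd (one_mul (1 : R)) (hidem i)
        exact ⟨∑ i, n i, by simp [fun i => (hn i).1]⟩
      have hlt : N' < N := by
        have hΨ := isRankFunction_cornerTrace_right (K := K) (one_mul (1 : R))
        have hba2 : b * a * (b * a) = b * a := by rw [← mul_assoc, hba]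
        obtain ⟨n, hn, hn0⟩ := hd (one_mul (1 : R)) hba2
        have h1 : cornerTrace K 1 (e i - a * b) = cornerTrace K 1 (e i) - n := by
          rw [← hn, ← hΨ.comm a b hab hba]
          exact hΨ.sub (he i) (by rw [← mul_assoc, hab]) (by rw [← mul_assoc, hia])
            (by rw [mul_assoc, hbi])
        have h2 : cornerTrace K 1 (e j - b * a) = cornerTrace K 1 (e j) - n := by
          rw [← hn]
          exact hΨ.sub (he j) hba2 (by rw [← mul_assoc, hjb]) (by rw [mul_assoc, haj])
        have hpos : n ≠ 0 := fun h => hx (by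
          have h0 := hn0 h 1
          rw [one_mul, one_mul] at h0
          rw [← hab, mul_assoc, h0, mul_zero])
        -- Both `a b` and `b a` remove the same dimension `n`, which is nonzero because `a = a (b
        -- a)` is nonzero.
        have hsum : (N' : K) = N - (n + n) := by
          rw [← hN, ← hN', eq_sub_iff_add_eq', ← eq_sub_iff_add_eq, ← Finset.sum_sub_distrib]
          have h3 : ∀ k, k ∉ ({i, j} : Finset ι) →
              cornerTrace K 1 (e k) - cornerTrace K 1 (e' k) = 0 := by
            intro k hk
            simp only [Finset.mem_insert, Finset.mem_singleton, not_or] at hk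
            rw [he', Function.update_of_ne hk.2, Function.update_of_ne hk.1, sub_self]
          rw [← Finset.sum_subset (Finset.subset_univ {i, j}) fun k _ hk => h3 k hk,
            Finset.sum_pair hne, he', Function.update_of_ne hne, Function.update_self,
            Function.update_self, h1, h2]
          ring
        have : N' + (n + n) = N := by
          have : ((N' + (n + n) : ℕ) : K) = (N : ℕ) := by push_cast; rw [hsum]; ring
          exact Nat.cast_injective this
        omega
      obtain ⟨g, hg, h⟩ := ih N' hlt e' hidem hnorm' hN'
      rw [hΦ.sum_update he hne hij hab hba hia haj hjb hbi] at h
      exact ⟨g, hg, h⟩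
    -- Now corners between opposite signs vanish, so every term of the norm is a natural number.
    -- Each nonzero `e i` contributes at least one through its own corner, which contains `e i`; a
    -- total of one leaves at most one nonzero idempotent.
    · push Not at hx
      choose n hn hn0 using fun i j => hd (he i) (he j)
      have h1 : ∀ i j, ε i • ε j • cornerTrace K (e i) (e j) = n i j := by
        intro i j
        rw [hn]
        have h0 : ε i + ε j = 0 → cornerTrace K (e i) (e j) = 0 := by
          intro hij
          have : LinearMap.mulLeft K (e i) ∘ₗ LinearMap.mulRight K (e j) = 0 := by
            ext x
            simpa [mul_assoc] using hx i j hij x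
          rw [cornerTrace, this, _root_.map_zero]
        rw [hn] at h0
        rcases hε i with h | h <;> rcases hε j with h' | h' <;> simp_all
      have h2 : ∑ i, ∑ j, n i j = 1 := by
        have : ((∑ i, ∑ j, n i j : ℕ) : K) = (1 : ℕ) := by
          push_cast
          simp only [Finset.smul_sum, h1] at hnorm
          exact hnorm
        exact Nat.cast_injective this
      obtain ⟨i, hi⟩ : ∃ i, ∀ k, k ≠ i → e k = 0 := by
        have hii : ∀ i, e i ≠ 0 → 1 ≤ ∑ j, n i j := by
          intro i hi
          refine le_trans (Nat.one_le_iff_ne_zero.2 fun h => hi ?_)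
            (Finset.single_le_sum (f := n i) (fun _ _ => Nat.zero_le _) (Finset.mem_univ i))
          have := hn0 i i h 1
          rwa [mul_one, he] at this
        have hex : ∃ i : ι, True := by
          by_contra hcon
          push Not at hcon
          rw [Finset.sum_eq_zero fun i _ => (hcon i).elim] at h2
          omega
        by_cases h0 : ∀ i, e i = 0
        · exact ⟨hex.choose, fun k _ => h0 k⟩
        · push Not at h0
          obtain ⟨i, hi⟩ := h0
          refine ⟨i, fun k hk => ?_⟩
          by_contra hk0
          have := Finset.sum_le_sum_of_subset (f := fun i => ∑ j, n i j)
            (Finset.subset_univ {i, k})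
          rw [Finset.sum_pair (Ne.symm hk)] at this
          have := hii i hi
          have := hii k hk0
          omega
      refine ⟨e i, he i, ?_⟩
      rw [Finset.sum_eq_single i (fun k _ hk => by rw [hi k hk, hΦ.map_zero, smul_zero])
        (fun h => absurd (Finset.mem_univ i) h)]
      rcases hε i with h | h <;> simp [h]

end CornerTrace

/-! ### Averages over subgroups in the group algebra -/

section Average

variable (K : Type*) [Field K] {G : Type*} [Group G] [Finite G]

open scoped Classical in
/-- The average of a subgroup, as an idempotent of the group algebra. -/
noncomputable def Subgroup.average (H : Subgroup G) : MonoidAlgebra K G :=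
  letI := Fintype.ofFinite G
  (Fintype.card H : K)⁻¹ • ∑ h : H, MonoidAlgebra.of K G h

theorem Subgroup.of_mul_average (H : Subgroup G) {h : G} (hh : h ∈ H) :
    MonoidAlgebra.of K G h * H.average K = H.average K := by
  classical
  simp only [Subgroup.average, mul_smul_comm, Finset.mul_sum, ← map_mul]
  congr 1
  let := Fintype.ofFinite G
  exact Fintype.sum_equiv (Equiv.mulLeft (⟨h, hh⟩ : H)) _ _ fun _ => rfl

variable [CharZero K]

instance : FiniteDimensional K (MonoidAlgebra K G) :=
  Module.Finite.of_basis (MonoidAlgebra.basis G K)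

/-- Von Neumann regularity from Maschke's theorem: choose a left ideal `q` complementary to the one
generated by `x` and write `1 = y x + b` with `b` in `q`. Then `x b = x - x y x` lies in both
ideals, hence is zero. -/
theorem MonoidAlgebra.exists_mul_mul_eq (x : MonoidAlgebra K G) : ∃ y, x * y * x = x := by
  have : NeZero (Nat.card G : K) := ⟨Nat.cast_ne_zero.2 Nat.card_pos.ne'⟩
  obtain ⟨q, hq⟩ := MonoidAlgebra.Submodule.exists_isCompl (k := K) (G := G)
    (Submodule.span (MonoidAlgebra K G) {x})
  have h1 : (1 : MonoidAlgebra K G) ∈ Submodule.span (MonoidAlgebra K G) {x} ⊔ q := by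
    rw [hq.sup_eq_top]
    trivial
  obtain ⟨a, ha, b, hb, hab⟩ := Submodule.mem_sup.1 h1
  obtain ⟨y, rfl⟩ := Submodule.mem_span_singleton.1 ha
  refine ⟨y, ?_⟩
  have h2 : x * b = x - x * y * x := by
    rw [eq_sub_iff_add_eq', mul_assoc, ← smul_eq_mul y x, ← mul_add, hab, mul_one]
  have h3 : x * b = 0 := by
    refine Submodule.disjoint_def.1 hq.disjoint _ ?_ (q.smul_mem x hb)
    rw [h2]
    exact sub_mem (Submodule.mem_span_singleton_self x)
      (Submodule.smul_mem _ (x * y) (Submodule.mem_span_singleton_self x))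
  rw [h3] at h2
  exact (sub_eq_zero.1 h2.symm).symm

theorem Subgroup.average_mul_average (H : Subgroup G) :
    H.average K * H.average K = H.average K := by
  classical
  let := Fintype.ofFinite G
  have hne : (Fintype.card H : K) ≠ 0 := Nat.cast_ne_zero.2 Fintype.card_ne_zero
  conv_lhs => enter [1]; rw [Subgroup.average]
  rw [smul_mul_assoc, Finset.sum_mul, Finset.sum_congr rfl fun h _ => H.of_mul_average K h.2,
    Finset.sum_const, Finset.card_univ, ← Nat.cast_smul_eq_nsmul K, smul_smul,
    inv_mul_cancel₀ hne, one_smul]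

/-- The map `x ↦ h x l` permutes the basis of group elements, so its trace counts fixed points. -/
theorem cornerTrace_of_of [DecidableEq G] [Fintype G] (h l : G) :
    cornerTrace K (MonoidAlgebra.of K G h) (MonoidAlgebra.of K G l) =
      ((Finset.univ.filter fun g : G => h * g * l = g).card : K) := by
  rw [cornerTrace, LinearMap.trace_eq_matrix_trace K (MonoidAlgebra.basis G K), Matrix.trace,
    Finset.card_filter, Nat.cast_sum]
  refine Finset.sum_congr rfl fun g _ => ?_
  simp [LinearMap.toMatrix_apply, MonoidAlgebra.basis, MonoidAlgebra.single_mul_single, 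
    Finsupp.single_apply, mul_assoc]

/-- The multiplicity space of two permutation representations has a basis of double cosets. -/
theorem cornerTrace_average_average {X : Type*} (H L : Subgroup G) (f : G → X)
    (hf : ∀ g g', f g = f g' ↔ ∃ h ∈ H, ∃ l ∈ L, h * g * l = g') :
    cornerTrace K (H.average K) (L.average K) = Nat.card (Set.range f) := by
  classical
  let := Fintype.ofFinite G
  -- Double cosets are the orbits of this action, and Burnside's lemma counts them by the fixed
  -- points whose sums appear as corner traces. The inverse that makes it a left action disappears
  -- after reindexing the sum by inversion on `L`.
  let inst : MulAction (H × L) G :=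
    { smul := fun k g => k.1 * g * (k.2 : G)⁻¹
      one_smul := fun g => by
        change (1 : G) * g * (1 : G)⁻¹ = g
        simp
      mul_smul := fun k k' g => by
        change (k.1 * k'.1 : G) * g * (k.2 * k'.2 : G)⁻¹ =
          k.1 * (k'.1 * g * (k'.2 : G)⁻¹) * (k.2 : G)⁻¹
        simp [mul_assoc] }
  have hsmul : ∀ (k : H × L) (g : G), k • g = k.1 * g * (k.2 : G)⁻¹ := fun _ _ => rfl
  have hb := MulAction.sum_card_fixedBy_eq_card_orbits_mul_card_group (H × L) G
  have hcard : Fintype.card (Quotient (MulAction.orbitRel (H × L) G)) =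
      Nat.card (Set.range f) := by
    rw [← Nat.card_eq_fintype_card]
    refine Nat.card_congr (Equiv.ofBijective (Quotient.lift (Set.rangeFactorization f) ?_) ⟨?_, ?_⟩)
    · rintro g g' ⟨k, rfl⟩
      refine Subtype.ext ((hf _ _).2 ⟨(k.1 : G)⁻¹, inv_mem k.1.2, k.2, k.2.2, ?_⟩)
      simp [hsmul, mul_assoc]
    · intro a b
      refine Quotient.inductionOn₂ a b fun g g' h => ?_
      obtain ⟨h, hh, l, hl, e⟩ := (hf g' g).1 (Subtype.ext_iff.1 h).symm
      refine Quotient.sound ⟨(⟨h, hh⟩, ⟨l⁻¹, inv_mem hl⟩), ?_⟩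
      simp [hsmul, ← e]
    · rintro ⟨_, g, rfl⟩
      exact ⟨Quotient.mk _ g, rfl⟩
  rw [hcard] at hb
  have hH : (Fintype.card H : K) ≠ 0 := Nat.cast_ne_zero.2 Fintype.card_ne_zero
  have hL : (Fintype.card L : K) ≠ 0 := Nat.cast_ne_zero.2 Fintype.card_ne_zero
  have hsum : ∑ h : H, ∑ l : L, cornerTrace K (MonoidAlgebra.of K G h) (MonoidAlgebra.of K G l) =
      Nat.card (Set.range f) * (Fintype.card H * Fintype.card L) := by
    rw [← Nat.cast_mul, ← Nat.cast_mul, ← Fintype.card_prod, ← hb, Nat.cast_sum,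
      ← Fintype.sum_prod_type',
      ← Fintype.sum_equiv ((Equiv.refl H).prodCongr (Equiv.inv L))
        (fun k => cornerTrace K (MonoidAlgebra.of K G (k.1 : G))
          (MonoidAlgebra.of K G ((k.2⁻¹ : L) : G))) _ fun k => rfl]
    refine Finset.sum_congr rfl fun k _ => ?_
    rw [cornerTrace_of_of, Fintype.card_subtype]
    rfl
  simp only [Subgroup.average, cornerTrace_smul_left, cornerTrace_smul_right,
    cornerTrace_sum_left, cornerTrace_sum_right]
  rw [← Finset.mul_sum, Finset.sum_comm, hsum]
  field_simp

end Average

/-! ### Words, their stabilizers, and double cosets -/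

section WordStabilizer

open Equiv

/-- Two words in which every letter occurs equally often are rearrangements of each other: match the
fibers letter by letter. -/
theorem exists_perm_of_card_fiber_eq {α S : Type*} [Fintype α] [DecidableEq S] {f g : α → S}
    (h : ∀ s, Fintype.card {x // f x = s} = Fintype.card {x // g x = s}) :
    ∃ π : Perm α, g ∘ π = f := by
  let e : ∀ s, {x // f x = s} ≃ {x // g x = s} := fun s => Fintype.equivOfCardEq (h s)
  refine ⟨(Equiv.sigmaFiberEquiv f).symm.trans
    ((Equiv.sigmaCongrRight e).trans (Equiv.sigmaFiberEquiv g)), ?_⟩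
  funext x
  exact (e (f x) ⟨x, rfl⟩).2

theorem exists_word_of_card_fiber {S : Type*} [Fintype S] [DecidableEq S] (N : S → ℕ) {n : ℕ}
    (h : ∑ s, N s = n) : ∃ f : Fin n → S, ∀ s, Fintype.card {x // f x = s} = N s := by
  have hc : Fintype.card (Fin n) = Fintype.card (Σ s, Fin (N s)) := by simp [h]
  let e := Fintype.equivOfCardEq hc
  refine ⟨fun x => (e x).1, fun s => ?_⟩
  rw [Fintype.card_congr (e.subtypeEquiv (q := fun y => y.1 = s) fun x => Iff.rfl),
    Fintype.card_congr (Equiv.sigmaSubtype s), Fintype.card_fin]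

theorem card_fiber_comp_perm {α S : Type*} [Fintype α] [DecidableEq S] (f : α → S) (π : Perm α)
    (s : S) : Fintype.card {x // (f ∘ π) x = s} = Fintype.card {x // f x = s} :=
  Fintype.card_congr (π.subtypeEquiv fun _ => Iff.rfl)

/-- The group of permutations that preserve a word. -/
def wordStabilizer {α S : Type*} (c : α → S) : Subgroup (Perm α) where
  carrier := {π | c ∘ π = c}
  mul_mem' := by
    intro π τ hπ hτ
    change (c ∘ π) ∘ τ = c
    rw [show c ∘ π = c from hπ]
    exact hτ
  one_mem' := rfl
  inv_mem' := by
    intro π hπ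
    funext x
    have := congrFun hπ (π⁻¹ x)
    simpa using this.symm

theorem mem_wordStabilizer {α S : Type*} {c : α → S} {π : Perm α} :
    π ∈ wordStabilizer c ↔ c ∘ π = c := Iff.rfl

/-- The number of matrices of natural numbers with given row and column sums. -/
noncomputable def matrixCount {m : ℕ} (a b : Fin m → ℕ) : ℕ :=
  Nat.card {M : Fin m × Fin m → ℕ // (∀ i, ∑ j, M (i, j) = a i) ∧ ∀ j, ∑ i, M (i, j) = b j}

/-- Double cosets of Young subgroups are classified by contingency matrices: `g` is sent to the
matrix whose entry `(i, j)` counts the positions `x` with `c (g x) = i` and `c' x = j`. Its row and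
column sums are the letter multiplicities of `c` and `c'`. -/
theorem cornerTrace_wordStabilizer (K : Type*) [Field K] [CharZero K] {n m : ℕ}
    {c c' : Fin n → Fin m} {a b : Fin m → ℕ} (ha : ∀ i, Fintype.card {x // c x = i} = a i)
    (hb : ∀ i, Fintype.card {x // c' x = i} = b i) :
    cornerTrace K ((wordStabilizer c).average K) ((wordStabilizer c').average K) =
      matrixCount a b := by
  let f : Perm (Fin n) → Fin m × Fin m → ℕ := fun g s =>
    Fintype.card {x // (c (g x), c' x) = s}
  have hrow : ∀ (u v : Fin n → Fin m) (i : Fin m),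
      ∑ j, Fintype.card {x // (u x, v x) = (i, j)} = Fintype.card {x // u x = i} := by
    intro u v i
    rw [← Fintype.card_sigma]
    exact Fintype.card_congr
      { toFun := fun x => ⟨x.2.1, congrArg Prod.fst x.2.2⟩
        invFun := fun x => ⟨v x.1, x.1, Prod.ext x.2 rfl⟩
        left_inv := by
          rintro ⟨j, x, hx⟩
          obtain rfl : v x = j := congrArg Prod.snd hx
          rfl
        right_inv := fun _ => rfl }
  have hcol : ∀ (u v : Fin n → Fin m) (j : Fin m),
      ∑ i, Fintype.card {x // (u x, v x) = (i, j)} = Fintype.card {x // v x = j} := by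
    intro u v j
    rw [← hrow v u j]
    refine Finset.sum_congr rfl fun i _ => Fintype.card_congr (Equiv.subtypeEquivRight fun x => ?_)
    simp [and_comm]
  rw [cornerTrace_average_average K _ _ f, matrixCount]
  · congr 1
    refine Nat.card_congr (Equiv.subtypeEquivRight fun M => ⟨?_, ?_⟩)
    · rintro ⟨g, rfl⟩
      exact ⟨fun i => (hrow _ _ i).trans ((card_fiber_comp_perm c g i).trans (ha i)),
        fun j => (hcol _ _ j).trans (hb j)⟩
    -- To realize a matrix `M`, take a word `w` of pairs with multiplicities `M`, rearrange it by
    -- `π` so that its second components spell `c'`, and then choose `g` so that `c ∘ g` spells the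
    -- first components.
    · rintro ⟨h1, h2⟩
      have hn : ∑ s, M s = n := by
        rw [Fintype.sum_prod_type, Finset.sum_congr rfl fun i _ => (h1 i).trans (ha i).symm,
          ← Fintype.card_sigma, Fintype.card_congr (Equiv.sigmaFiberEquiv c), Fintype.card_fin]
      obtain ⟨w, hw⟩ := exists_word_of_card_fiber M hn
      obtain ⟨π, hπ⟩ : ∃ π : Perm (Fin n), (fun x => (w x).2) ∘ π = c' := by
        refine exists_perm_of_card_fiber_eq fun j => ?_
        rw [hb, ← h2 j, ← hcol (fun x => (w x).1)]
        exact Finset.sum_congr rfl fun i _ => (hw (i, j)).symm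
      obtain ⟨g, hg⟩ : ∃ g : Perm (Fin n), c ∘ g = fun x => (w (π x)).1 := by
        refine exists_perm_of_card_fiber_eq fun i => ?_
        rw [ha, ← h1 i]
        refine (card_fiber_comp_perm (fun x => (w x).1) π i).trans ?_
        rw [← hrow _ fun x => (w x).2]
        exact Finset.sum_congr rfl fun j _ => hw (i, j)
      refine ⟨g, funext fun s => ?_⟩
      rw [← hw s, ← card_fiber_comp_perm w π s]
      refine Fintype.card_congr (Equiv.subtypeEquivRight fun x => ?_)
      have e1 := congrFun hg x
      have e2 := congrFun hπ x
      simp only [Function.comp_apply] at e1 e2 ⊢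
      rw [e1, ← e2]
  · intro g g'
    constructor
    · intro h
      obtain ⟨π, hπ⟩ := exists_perm_of_card_fiber_eq (f := fun x => (c (g x), c' x))
        (g := fun x => (c (g' x), c' x)) fun s => congrFun h s
      -- Equal matrices give a rearrangement `π` carrying the word of pairs of `g'` to that of `g`.
      -- It preserves `c'` by the second components, and `g' π g⁻¹` preserves `c` by the first.
      refine ⟨g' * π * g⁻¹, ?_, π⁻¹, inv_mem ?_, by simp [mul_assoc]⟩
      · rw [mem_wordStabilizer]
        funext x
        have := congrArg Prod.fst (congrFun hπ (g⁻¹ x))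
        simpa using this
      · rw [mem_wordStabilizer]
        funext x
        exact congrArg Prod.snd (congrFun hπ x)
    · rintro ⟨h, hh, l, hl, rfl⟩
      funext s
      refine Fintype.card_congr (Equiv.symm (l.subtypeEquiv fun x => ?_))
      have e1 := congrFun hh (g (l x))
      have e2 := congrFun hl x
      simp only [Function.comp_apply, Perm.mul_apply] at e1 e2 ⊢
      rw [e1, e2]

end WordStabilizer

/-! ### The Cauchy determinant -/

section Cauchy

open Finset

/-- The point is that the coefficients, up to sign elementary symmetric functions of the `y k`, do
not depend on `u` and `v`. In the Cauchy determinant the same coefficients are used at `(1, x i)`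
and at `(y i, 1)`. -/
theorem exists_prod_sub_mul_eq_sum {S ι : Type*} [CommRing S] (s : Finset ι) (y : ι → S) :
    ∃ c : ℕ → S, ∀ u v : S, ∏ k ∈ s, (u - v * y k) =
      ∑ l ∈ range (s.card + 1), c l * (v ^ l * u ^ (s.card - l)) := by
  classical
  refine ⟨fun l => ∑ t ∈ s.powersetCard l, ∏ k ∈ t, (-y k), fun u v => ?_⟩
  have : ∀ k, u - v * y k = v * -y k + u := fun k => by ring
  simp only [this, prod_add]
  rw [sum_powerset]
  refine sum_congr rfl fun l _ => ?_
  rw [sum_mul]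
  refine sum_congr rfl fun t ht => ?_
  rw [mem_powersetCard] at ht
  rw [prod_mul_distrib, prod_const, prod_const, ht.2, card_sdiff_of_subset ht.1, ht.2]
  ring

/-- The Cauchy determinant. -/
theorem det_cauchy {S : Type*} [CommRing S] [IsDomain S] {m : ℕ} {x y : Fin m → S}
    (hy : Function.Injective y) {F : Fin m → Fin m → S}
    (hF : ∀ i j, (1 - x i * y j) * F i j = 1) :
    (Matrix.of F).det =
      (Matrix.vandermonde x).det * (Matrix.vandermonde y).det * ∏ i, ∏ j, F i j := by
  choose c hc using fun j : Fin m => exists_prod_sub_mul_eq_sum (univ.erase j) y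
  have hcard : ∀ j : Fin m, (univ.erase j).card + 1 = m := fun j => by
    rw [card_erase_of_mem (mem_univ j), card_univ, Fintype.card_fin]
    have := j.pos
    omega
  -- Multiplying `C` by the Vandermonde matrix of `x` gives the Cauchy matrix with the denominators
  -- of each row cleared. Multiplying it by the reversed Vandermonde matrix of `y` gives a diagonal
  -- matrix, which determines `det C`.
  set C : Matrix (Fin m) (Fin m) S := Matrix.of fun l j => c j l with hC
  have h1 : Matrix.vandermonde x * C =
      Matrix.of fun i j => ∏ k ∈ univ.erase j, (1 - x i * y k) := by
    ext i j
    rw [Matrix.mul_apply, Matrix.of_apply, hc j 1 (x i), hcard j,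
      ← Fin.sum_univ_eq_sum_range fun l => c j l * (x i ^ l * 1 ^ _)]
    refine sum_congr rfl fun l _ => ?_
    rw [Matrix.vandermonde_apply, hC, Matrix.of_apply, one_pow, mul_one, mul_comm]
  have h2 : Matrix.projVandermonde 1 y * C =
      Matrix.diagonal fun j => ∏ k ∈ univ.erase j, (y j - y k) := by
    ext i j
    have h3 : (Matrix.projVandermonde 1 y * C) i j = ∏ k ∈ univ.erase j, (y i - 1 * y k) := by
      rw [Matrix.mul_apply, hc j (y i) 1, hcard j,
        ← Fin.sum_univ_eq_sum_range fun l => c j l * (1 ^ l * y i ^ ((univ.erase j).card - l))]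
      refine sum_congr rfl fun l _ => ?_
      rw [Matrix.projVandermonde_apply, hC, Matrix.of_apply, Pi.one_apply, mul_comm, Fin.val_rev]
      congr 3
      have := hcard j
      omega
    rw [h3, Matrix.diagonal_apply]
    split_ifs with h
    · subst h
      simp
    · refine prod_eq_zero (mem_erase.2 ⟨h, mem_univ i⟩) ?_
      simp
  have hsplit : ∏ j, ∏ k ∈ univ.erase j, (y j - y k) =
      (Matrix.vandermonde y).det * (Matrix.projVandermonde 1 y).det := by
    have h4 : ∀ j : Fin m, ∏ k ∈ univ.erase j, (y j - y k) =
        (∏ k ∈ Iio j, (y j - y k)) * ∏ k ∈ Ioi j, (y j - y k) := by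
      intro j
      rw [← prod_union]
      · refine prod_congr ?_ fun _ _ => rfl
        ext k
        simp [lt_or_lt_iff_ne]
      · rw [disjoint_left]
        intro k hk hk'
        rw [mem_Iio] at hk
        rw [mem_Ioi] at hk'
        exact absurd hk hk'.not_gt
    simp only [h4, prod_mul_distrib]
    rw [Matrix.det_vandermonde, Matrix.det_projVandermonde]
    congr 1
    · rw [prod_sigma', prod_sigma']
      refine prod_bij' (fun a _ => ⟨a.2, a.1⟩) (fun a _ => ⟨a.2, a.1⟩) ?_ ?_ ?_ ?_ ?_ <;> simp
    · simp
  -- Injectivity of `y` in a domain permits cancelling this determinant in the formula for `det C`.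
  have hne : (Matrix.projVandermonde 1 y).det ≠ 0 := by
    rw [Matrix.det_projVandermonde]
    refine prod_ne_zero_iff.2 fun i _ => prod_ne_zero_iff.2 fun j hj => ?_
    rw [Pi.one_apply, Pi.one_apply, one_mul, one_mul, sub_ne_zero]
    exact hy.ne (mem_Ioi.1 hj).ne
  have hdet : C.det = (Matrix.vandermonde y).det := by
    have h5 := congrArg Matrix.det h2
    rw [Matrix.det_mul, Matrix.det_diagonal, hsplit, mul_comm] at h5
    exact mul_right_cancel₀ hne h5
  have h6 : Matrix.of F = Matrix.of fun i j =>
      (∏ k, F i k) * (Matrix.of fun i j => ∏ k ∈ univ.erase j, (1 - x i * y k)) i j := by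
    ext i j
    simp only [Matrix.of_apply]
    rw [← mul_prod_erase univ (F i) (mem_univ j), mul_assoc, ← prod_mul_distrib,
      prod_eq_one fun k _ => by rw [mul_comm, hF], mul_one]
  rw [h6, Matrix.det_mul_column, ← h1, Matrix.det_mul, hdet, mul_comm]

end Cauchy

/-! ### Signed sums of numbers of matrices with given margins -/

section MatrixCount

open Finset MvPowerSeries

variable {σ : Type*}

open scoped Classical in
/-- The geometric series in the monomial `s`. -/
noncomputable def geometricSeries (s : σ →₀ ℕ) : MvPowerSeries σ ℤ :=
  fun d => if ∃ k : ℕ, d = k • s then 1 else 0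

open scoped Classical in
theorem coeff_geometricSeries (s d : σ →₀ ℕ) :
    coeff d (geometricSeries s) = if ∃ k : ℕ, d = k • s then 1 else 0 := rfl

theorem one_sub_monomial_mul_geometricSeries {s : σ →₀ ℕ} (hs : s ≠ 0) :
    (1 - monomial s (1 : ℤ)) * geometricSeries s = 1 := by
  classical
  ext d
  rw [sub_mul, one_mul, map_sub, coeff_monomial_mul, coeff_one, coeff_geometricSeries,
    coeff_geometricSeries, one_mul]
  have key : (∃ k : ℕ, d = k • s) ↔ d = 0 ∨ (s ≤ d ∧ ∃ k : ℕ, d - s = k • s) := by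
    constructor
    · rintro ⟨k, rfl⟩
      rcases k with _ | k
      · exact Or.inl (zero_smul _ _)
      · right
        rw [add_smul, one_smul]
        exact ⟨le_add_self, k, add_tsub_cancel_right _ _⟩
    · rintro (rfl | ⟨h, k, hk⟩)
      · exact ⟨0, (zero_smul _ _).symm⟩
      · exact ⟨k + 1, by rw [add_smul, one_smul, ← hk, tsub_add_cancel_of_le h]⟩
  have key' : ¬(d = 0 ∧ s ≤ d) := by
    rintro ⟨rfl, h⟩
    exact hs (le_antisymm h (zero_le))
  by_cases h1 : d = 0 <;> by_cases h2 : s ≤ d <;> by_cases h3 : ∃ k : ℕ, d - s = k • s <;>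
    simp_all

/-- Choosing a term of each geometric series means choosing multiplicities `M p`; as the exponents
are nonzero, distinct multiplicities give distinct terms. -/
theorem coeff_prod_geometricSeries {P : Type*} [Fintype P] (s : P → σ →₀ ℕ) (hs : ∀ p, s p ≠ 0)
    (d : σ →₀ ℕ) : coeff d (∏ p, geometricSeries (s p)) =
      Nat.card {M : P → ℕ // ∑ p, M p • s p = d} := by
  classical
  rw [coeff_prod]
  simp only [coeff_geometricSeries]
  simp only [prod_boole, sum_boole, mem_univ, true_implies]
  rw [← Nat.card_eq_finsetCard]
  congr 1
  symm
  refine Nat.card_congr (Equiv.ofBijective (fun M => ⟨Finsupp.equivFunOnFinite.symm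
    fun p => M.1 p • s p, ?_⟩) ⟨?_, ?_⟩)
  · rw [mem_filter, mem_finsuppAntidiag]
    exact ⟨⟨M.2, subset_univ _⟩, fun i => ⟨M.1 i, rfl⟩⟩
  · intro M M' h
    have h1 := Finsupp.equivFunOnFinite.symm.injective (Subtype.ext_iff.1 h)
    refine Subtype.ext (funext fun p => ?_)
    obtain ⟨a, ha⟩ := Finsupp.ne_iff.1 (hs p)
    have h2 := DFunLike.congr_fun (congrFun h1 p) a
    simp only [Finsupp.smul_apply, smul_eq_mul] at h2
    exact mul_right_cancel₀ ha h2
  · rintro ⟨l, hl⟩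
    rw [mem_filter, mem_finsuppAntidiag] at hl
    choose M hM using hl.2
    refine ⟨⟨M, ?_⟩, Subtype.ext (Finsupp.ext fun p => (hM p).symm)⟩
    rw [← hl.1.1]
    exact sum_congr rfl fun p _ => (hM p).symm

/-- The exponent of `x_i y_j`. -/
noncomputable def pairExponent {m : ℕ} (i j : Fin m) : Fin m ⊕ Fin m →₀ ℕ :=
  Finsupp.single (.inl i) 1 + Finsupp.single (.inr j) 1

/-- The exponent of `∏ x_i ^ a_i * ∏ y_i ^ b_i`. -/
noncomputable def marginExponent {m : ℕ} (a b : Fin m → ℕ) : Fin m ⊕ Fin m →₀ ℕ :=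
  Finsupp.equivFunOnFinite.symm (Sum.elim a b)

variable {m : ℕ}

theorem pairExponent_ne_zero (i j : Fin m) : pairExponent i j ≠ 0 := by
  intro h
  have := DFunLike.congr_fun h (.inl i)
  simp [pairExponent] at this

theorem sum_smul_pairExponent_eq_iff {P : Type*} [Fintype P] (r c : P → Fin m) (M : P → ℕ)
    (a b : Fin m → ℕ) : ∑ p, M p • pairExponent (r p) (c p) = marginExponent a b ↔
      (∀ i, ∑ p, (if r p = i then M p else 0) = a i) ∧
        ∀ j, ∑ p, (if c p = j then M p else 0) = b j := by
  rw [Finsupp.ext_iff, Sum.forall]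
  simp [pairExponent, marginExponent, Finsupp.finsetSum_apply, Finsupp.single_apply]

theorem coeff_prod_geometricSeries_pairExponent (a b : Fin m → ℕ) :
    coeff (marginExponent a b) (∏ i, ∏ j, geometricSeries (pairExponent i j)) =
      matrixCount a b := by
  rw [← Fintype.prod_prod_type' fun i j => geometricSeries (pairExponent (m := m) i j),
    coeff_prod_geometricSeries (fun p : Fin m × Fin m => pairExponent p.1 p.2)
      (fun p => pairExponent_ne_zero p.1 p.2), matrixCount]
  congr 1
  refine Nat.card_congr (Equiv.subtypeEquivRight fun M => ?_)
  rw [sum_smul_pairExponent_eq_iff Prod.fst Prod.snd]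
  refine and_congr (forall_congr' fun i => ?_) (by simp [Fintype.sum_prod_type])
  rw [Fintype.sum_prod_type, Finset.sum_comm]
  simp

/-- A term of the Cauchy determinant only involves the monomials `x_{π i} y_i`. Matching the
`y`-exponents forces the multiplicities to be `μ`; matching the `x`-exponents then forces `μ ∘ π =
μ`, so `π = 1` because the `μ i` are distinct. -/
theorem coeff_prod_geometricSeries_perm {μ : Fin m → ℕ} (hμ : Function.Injective μ)
    (π : Equiv.Perm (Fin m)) :
    coeff (marginExponent μ μ) (∏ i, geometricSeries (pairExponent (π i) i)) =
      if π = 1 then 1 else 0 := by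
  rw [coeff_prod_geometricSeries _ fun p => pairExponent_ne_zero _ _]
  have h : ∀ M : Fin m → ℕ, ∑ p, M p • pairExponent (π p) p = marginExponent μ μ ↔
      M = μ ∧ π = 1 := by
    intro M
    rw [sum_smul_pairExponent_eq_iff π fun i => i]
    simp only [Finset.sum_ite_eq', mem_univ, if_true]
    have h1 : ∀ i, ∑ p, (if π p = i then M p else 0) = M (π.symm i) := by
      intro i
      rw [Finset.sum_eq_single (π.symm i)]
      · simp
      · intro p _ hp
        rw [if_neg]
        rintro rfl
        simp at hp
      · simp
    simp only [h1]
    constructor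
    · rintro ⟨h2, h3⟩
      refine ⟨funext h3, ?_⟩
      ext i
      have := h2 (π i)
      rw [Equiv.symm_apply_apply, h3] at this
      rw [← hμ this]
      rfl
    · rintro ⟨rfl, rfl⟩
      exact ⟨fun _ => rfl, fun _ => rfl⟩
  simp only [h]
  split_ifs with hπ
  · simp [hπ]
  · simp [hπ]

/-- Reversing the order of the exponents changes both determinants by the same sign, which cancels
in the product. The reversed form produces the shifts `μ i - rev (σ i)` of the Jacobi–Trudi formula.
-/
theorem det_vandermonde_mul_det_vandermonde {S : Type*} [CommRing S] (x y : Fin m → S) :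
    (Matrix.vandermonde x).det * (Matrix.vandermonde y).det =
      (Matrix.of fun i j : Fin m => x j ^ (Fin.rev i : ℕ)).det *
        (Matrix.of fun i j : Fin m => y j ^ (Fin.rev i : ℕ)).det := by
  have h : ∀ x : Fin m → S, (Matrix.of fun i j : Fin m => x j ^ (Fin.rev i : ℕ)).det =
      ((Equiv.Perm.sign (Fin.revPerm (n := m)) : ℤ) : S) * (Matrix.vandermonde x).det := by
    intro x
    rw [← Matrix.det_transpose (Matrix.vandermonde x), ← Matrix.det_permute]
    rfl
  rw [h, h, mul_mul_mul_comm, ← Int.cast_mul, ← Units.val_mul, Int.units_mul_self]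
  simp

theorem prod_X_pow_mul_prod_X_pow (e f : Fin m → ℕ) :
    (∏ i, (X (.inl i) : MvPowerSeries (Fin m ⊕ Fin m) ℤ) ^ e i) * ∏ i, X (.inr i) ^ f i =
      monomial (marginExponent e f) 1 := by
  classical
  rw [marginExponent, ← Finsupp.univ_sum_single (Finsupp.equivFunOnFinite.symm (Sum.elim e f)),
    Fintype.sum_sum_type]
  simp only [Finsupp.equivFunOnFinite_symm_apply_apply, Sum.elim_inl, Sum.elim_inr]
  have h : ∀ s : Finset (Fin m), ∀ (g : Fin m → Fin m ⊕ Fin m) (e : Fin m → ℕ),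
      (∏ i ∈ s, (X (g i) : MvPowerSeries (Fin m ⊕ Fin m) ℤ) ^ e i) =
        monomial (∑ i ∈ s, Finsupp.single (g i) (e i)) 1 := by
    intro s g e
    induction s using Finset.induction_on with
    | empty => simp
    | insert a s ha ih =>
      rw [prod_insert ha, sum_insert ha, ih, X_pow_eq, monomial_mul_monomial, one_mul]
  rw [h, h, monomial_mul_monomial, one_mul]

theorem marginExponent_le_iff (a b c d : Fin m → ℕ) :
    marginExponent a b ≤ marginExponent c d ↔ (∀ i, a i ≤ c i) ∧ ∀ i, b i ≤ d i := by
  rw [Finsupp.le_def, Sum.forall]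
  rfl

theorem marginExponent_sub (a b c d : Fin m → ℕ) :
    marginExponent c d - marginExponent a b =
      marginExponent (fun i => c i - a i) fun i => d i - b i := by
  ext s
  rcases s with s | s <;> rfl

/-- The virtual representation given by a Jacobi–Trudi determinant has norm one. -/
theorem sum_sign_mul_sum_sign_mul_matrixCount {μ : Fin m → ℕ} (hμ : Function.Injective μ) :
    ∑ σ : Equiv.Perm (Fin m), (Equiv.Perm.sign σ : ℤ) * ∑ τ : Equiv.Perm (Fin m),
      (Equiv.Perm.sign τ : ℤ) *
        (if (∀ i, (Fin.rev (σ i) : ℕ) ≤ μ i) ∧ ∀ i, (Fin.rev (τ i) : ℕ) ≤ μ i then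
          (matrixCount (fun i => μ i - Fin.rev (σ i)) fun i => μ i - Fin.rev (τ i) : ℤ)
        else 0) = 1 := by
  classical
  have hF : ∀ i j : Fin m, (1 - (X (.inl i) : MvPowerSeries (Fin m ⊕ Fin m) ℤ) * X (.inr j)) *
      geometricSeries (pairExponent i j) = 1 := by
    intro i j
    rw [X_def, X_def, monomial_mul_monomial, one_mul]
    exact one_sub_monomial_mul_geometricSeries (pairExponent_ne_zero i j)
  have hy : Function.Injective fun j : Fin m =>
      (X (.inr j) : MvPowerSeries (Fin m ⊕ Fin m) ℤ) := by
    intro i j h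
    simpa using X_inj.1 h
  have : IsDomain (MvPowerSeries (Fin m ⊕ Fin m) ℤ) := NoZeroDivisors.to_isDomain _
  -- Compare coefficients of `x^μ y^μ`: the determinant of the `1 / (1 - x_i y_j)` contributes only
  -- the identity permutation. On the other side, the two expanded Vandermonde determinants shift
  -- the margins counted by `∏ 1 / (1 - x_i y_j)`.
  have hdet := det_cauchy hy hF
  rw [det_vandermonde_mul_det_vandermonde, Matrix.det_apply', Matrix.det_apply',
    Matrix.det_apply'] at hdet
  have hc := congrArg (coeff (marginExponent μ μ)) hdet
  have hint : ∀ (z : ℤ) (f : MvPowerSeries (Fin m ⊕ Fin m) ℤ) d,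
      coeff d ((z : MvPowerSeries (Fin m ⊕ Fin m) ℤ) * f) = z * coeff d f := by
    intro z f d
    rw [← zsmul_eq_mul, map_zsmul, smul_eq_mul]
  have hl : coeff (marginExponent μ μ) (∑ σ : Equiv.Perm (Fin m),
      ((Equiv.Perm.sign σ : ℤ) : MvPowerSeries (Fin m ⊕ Fin m) ℤ) *
        ∏ i, Matrix.of (fun i j => geometricSeries (pairExponent i j)) (σ i) i) = 1 := by
    rw [map_sum]
    simp only [hint, Matrix.of_apply, coeff_prod_geometricSeries_perm hμ]
    simp
  rw [hl] at hc
  rw [hc, sum_mul, sum_mul, map_sum]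
  refine sum_congr rfl fun σ _ => ?_
  rw [mul_assoc, mul_assoc, hint]
  congr 1
  rw [sum_mul, mul_sum, map_sum]
  refine sum_congr rfl fun τ _ => ?_
  simp only [Matrix.of_apply]
  rw [mul_assoc, mul_left_comm, hint]
  congr 1
  rw [← mul_assoc, prod_X_pow_mul_prod_X_pow, coeff_monomial_mul, one_mul, marginExponent_sub,
    coeff_prod_geometricSeries_pairExponent]
  simp only [marginExponent_le_iff]

end MatrixCount

/-! ### Signed permutations of words -/

section Words

variable (K : Type*) [Field K] {n : ℕ} {ι : Type*}

open Equiv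

/-- The sign `-1` if the permutation `π` changes the order of the two given elements. -/
def orderSign (π : Perm (Fin n)) : Sym2 (Fin n) → K :=
  Sym2.lift ⟨fun i j => if (i < j ↔ π i < π j) then 1 else -1, fun i j => by
    have : (i < j ↔ π i < π j) ↔ (j < i ↔ π j < π i) := by
      rcases lt_trichotomy i j with h | rfl | h
      · have := π.injective.ne h.ne
        grind
      · simp
      · have := π.injective.ne h.ne
        grind
    simp only [this]⟩

theorem orderSign_mk (π : Perm (Fin n)) (i j : Fin n) :
    orderSign K π s(i, j) = if (i < j ↔ π i < π j) then 1 else -1 := rfl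

theorem orderSign_mul (π τ : Perm (Fin n)) (z : Sym2 (Fin n)) :
    orderSign K (π * τ) z = orderSign K π (z.map τ) * orderSign K τ z := by
  induction z with
  | _ i j =>
    simp only [Sym2.map_mk, orderSign_mk, Perm.mul_apply]
    by_cases h1 : i < j <;> by_cases h2 : τ i < τ j <;> by_cases h3 : π (τ i) < π (τ j) <;>
      simp [h1, h2, h3]

theorem orderSign_one (z : Sym2 (Fin n)) : orderSign K 1 z = 1 := by
  induction z with
  | _ i j => simp [orderSign_mk]

/-- The sign by which the permutation `π` acts on words with letters in `ι`, some of which are odd: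
an exchange of two letters contributes `-1` unless both are odd. -/
def wordSign (odd : ι → Bool) (π : Perm (Fin n)) (w : Fin n → ι) : K :=
  ∏ z : Sym2 (Fin n), if ∀ i ∈ z, odd (w i) = true then 1 else orderSign K π z

variable (odd : ι → Bool)

/-- The order sign of a pair is a cocycle; reindexing the pairs by `τ` moves the parity condition
from the rearranged word back to `w`. -/
theorem wordSign_mul (π τ : Perm (Fin n)) (w : Fin n → ι) :
    wordSign K odd (π * τ) w = wordSign K odd π (w ∘ τ.symm) * wordSign K odd τ w := by
  have h : wordSign K odd π (w ∘ τ.symm) = ∏ z : Sym2 (Fin n),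
      if ∀ i ∈ z, odd (w i) = true then 1 else orderSign K π (z.map τ) := by
    rw [wordSign]
    symm
    refine Fintype.prod_bijective (Sym2.map τ)
      (Finite.injective_iff_bijective.1 (Sym2.map.injective τ.injective)) _ _ fun z => ?_
    induction z with
    | _ i j => simp
  rw [h, wordSign, wordSign, ← Finset.prod_mul_distrib]
  refine Finset.prod_congr rfl fun z _ => ?_
  split_ifs
  · rw [one_mul]
  · rw [orderSign_mul]

theorem wordSign_one (w : Fin n → ι) : wordSign K odd 1 w = 1 := by
  simp [wordSign, orderSign_one]

/-- An adjacent transposition changes the order of no pair other than `{i, j}`. -/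
theorem wordSign_swap (i j : Fin n) (hij : (j : ℕ) = i + 1) (w : Fin n → ι) :
    wordSign K odd (swap i j) w = if odd (w i) = true ∧ odd (w j) = true then 1 else -1 := by
  have hlt : i < j := by rw [Fin.lt_def]; omega
  rw [wordSign, Finset.prod_eq_single s(i, j)]
  · simp [orderSign_mk, hlt, hlt.not_gt]
  · intro z _ hz
    induction z with
    | _ a b =>
      split_ifs
      · rfl
      · rw [orderSign_mk, if_pos]
        have h0 : ¬(a = i ∧ b = j) ∧ ¬(a = j ∧ b = i) := by
          constructor <;> rintro ⟨rfl, rfl⟩ <;> simp [Sym2.eq_swap] at hz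
        simp only [swap_apply_def]
        simp only [Fin.ext_iff, Fin.lt_def] at *
        split_ifs <;> omega
  · simp

variable {K} {M : Type*} [AddCommGroup M] [Module K M] (B : Module.Basis (Fin n → ι) K M)

/-- The signed permutation action on a vector space with a basis of words. -/
noncomputable def wordAct : Perm (Fin n) →* Module.End K M where
  toFun π := B.constr K fun w => wordSign K odd π w • B (w ∘ π.symm)
  map_one' := B.ext fun w => by
    rw [Module.Basis.constr_basis, wordSign_one, one_smul]
    rfl
  map_mul' π τ := B.ext fun w => by
    simp only [Module.Basis.constr_basis, Module.End.mul_apply, map_smul, smul_smul]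
    rw [wordSign_mul, mul_comm]
    rfl

theorem wordAct_basis (π : Perm (Fin n)) (w : Fin n → ι) :
    wordAct odd B π (B w) = wordSign K odd π w • B (w ∘ π.symm) :=
  B.constr_basis _ _ _

end Words

/-! ### The dimension of the space of invariants of signed permutations -/

section WordInvariants

open Equiv

variable (K : Type*) [Field K] {n : ℕ} {ι : Type*} (odd : ι → Bool)

/-- The positions need not be adjacent. The transposition preserves the word, so it acts on the
pairs other than `{i, j}` as an involution under which signs cancel; the pair `{i, j}` itself
contributes `-1`. -/
theorem wordSign_swap_of_even {w : Fin n → ι} {i j : Fin n} (hij : i ≠ j) (h : w i = w j)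
    (hi : odd (w i) = false) : wordSign K odd (swap i j) w = -1 := by
  classical
  have hw : ∀ t, w (swap i j t) = w t := by
    intro t
    rw [swap_apply_def]
    split_ifs with h1 h2
    · rw [h1, h]
    · rw [h2, h]
    · rfl
  rw [wordSign, ← Finset.mul_prod_erase Finset.univ _ (Finset.mem_univ s(i, j)),
    Finset.prod_involution (fun z _ => z.map (swap i j)), mul_one, if_neg (by simp [hi]),
    orderSign_mk, swap_apply_left, swap_apply_right, if_neg]
  · have := lt_or_gt_of_ne hij
    grind
  · intro z _
    have h1 : (∀ a ∈ z.map (swap i j), odd (w a) = true) ↔ ∀ a ∈ z, odd (w a) = true := by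
      simp [Sym2.mem_map, hw]
    simp only [h1]
    split_ifs
    · rw [one_mul]
    · rw [mul_comm, ← orderSign_mul, swap_mul_self, orderSign_one]
  · intro z hz h1 h2
    have hz' := Finset.ne_of_mem_erase hz
    induction z with
    | _ a b =>
      simp only [Sym2.map_mk, Sym2.eq_iff] at h2 hz'
      refine h1 ?_
      split_ifs
      · rfl
      · rw [orderSign_mk, if_pos]
        rcases h2 with ⟨h2, h3⟩ | ⟨h2, h3⟩
        · rw [h2, h3]
        · simp only [swap_apply_def] at h2 h3
          grind
  · intro z hz
    refine Finset.mem_erase.2 ⟨fun h1 => Finset.ne_of_mem_erase hz ?_, Finset.mem_univ _⟩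
    have := congrArg (Sym2.map (swap i j)) h1
    rw [Sym2.map_map, ← Perm.coe_mul, swap_mul_self] at this
    simpa [Sym2.eq_swap] using this
  · intro z hz
    rw [Sym2.map_map, ← Perm.coe_mul, swap_mul_self]
    simp

/-- Pairs of odd positions contribute nothing by definition, and pairs of even positions are fixed.
For a fixed even position `i`, the mixed pairs contribute the product over odd `j` of the signs
comparing `i` with `j` and with `π j`; as `π` permutes the odd positions, this is a square of signs.
-/
theorem wordSign_of_fixed {w : Fin n → ι} {π : Perm (Fin n)} (hπ : w ∘ π = w)
    (h : ∀ i, odd (w i) = false → π i = i) : wordSign K odd π w = 1 := by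
  classical
  let s : Fin n → Fin n → K := fun i j => if i < j then 1 else -1
  have hs : ∀ i j, s i j * s i j = 1 := fun i j => by dsimp only [s]; split_ifs <;> simp
  let E := Finset.univ.filter fun i => odd (w i) = false
  let O := Finset.univ.filter fun i => odd (w i) = true
  have h1 : wordSign K odd π w = ∏ x ∈ E ×ˢ O, orderSign K π s(x.1, x.2) := by
    rw [wordSign]
    symm
    refine Finset.prod_of_injOn (fun x : Fin n × Fin n => s(x.1, x.2)) ?_ (by simp) ?_ ?_
    · rintro ⟨a, b⟩ hab ⟨c, d⟩ hcd h1
      simp only [Finset.coe_product, Set.mem_prod, Finset.mem_coe, E, O, Finset.mem_filter,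
        Finset.mem_univ, true_and] at hab hcd
      rcases Sym2.eq_iff.1 h1 with ⟨rfl, rfl⟩ | ⟨rfl, rfl⟩
      · rfl
      · exact absurd (hab.1.symm.trans hcd.2) (by simp)
    · intro z _ hz
      induction z with
      | _ a b =>
        split_ifs with h1
        · rfl
        · rw [orderSign_mk]
          by_cases ha : odd (w a) = true
          · by_cases hb : odd (w b) = true
            · simp [ha, hb] at h1
            · refine absurd ⟨(b, a), ?_, Sym2.eq_swap⟩ hz
              simp [E, O, ha, hb]
          · by_cases hb : odd (w b) = true
            · refine absurd ⟨(a, b), ?_, rfl⟩ hz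
              simp [E, O, ha, hb]
            · rw [h a (by simpa using ha), h b (by simpa using hb), if_pos Iff.rfl]
    · rintro ⟨a, b⟩ hab
      simp only [Finset.mem_product, E, O, Finset.mem_filter, Finset.mem_univ, true_and] at hab
      rw [if_neg]
      simp [hab.1]
  rw [h1, Finset.prod_product]
  refine Finset.prod_eq_one fun i hi => ?_
  have hi' : odd (w i) = false := by simpa [E] using hi
  have h2 : ∀ j, orderSign K π s(i, j) = s i j * s i (π j) := by
    intro j
    rw [orderSign_mk, h i hi']
    dsimp only [s]
    by_cases h3 : i < j <;> by_cases h4 : i < π j <;> simp [h3, h4]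
  have h3 : ∏ j ∈ O, s i (π j) = ∏ j ∈ O, s i j := by
    refine Finset.prod_equiv π (fun j => ?_) fun _ _ => rfl
    simp only [O, Finset.mem_filter, Finset.mem_univ, true_and]
    rw [show w (π j) = w j from congrFun hπ j]
  rw [Finset.prod_congr rfl fun j _ => h2 j, Finset.prod_mul_distrib, h3,
    ← Finset.prod_mul_distrib]
  exact Finset.prod_eq_one fun j _ => hs i j

/-- The signs of the permutations that preserve a word add up to zero if an even letter is
repeated, and to the order of the stabilizer otherwise. -/
theorem sum_wordSign_stabilizer [CharZero K] [Fintype ι] [DecidableEq ι] (w : Fin n → ι) :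
    ∑ π : Perm (Fin n), (if w ∘ π = w then wordSign K odd π w else 0) =
      if ∀ s, odd s = false → Fintype.card {x // w x = s} ≤ 1 then
        (Fintype.card {π : Perm (Fin n) // w ∘ π = w} : K) else 0 := by
  split_ifs with h
  · rw [Fintype.card_subtype, Finset.cast_card, Finset.sum_filter]
    refine Finset.sum_congr rfl fun π _ => ?_
    split_ifs with hπ
    · refine wordSign_of_fixed K odd hπ fun i hi => ?_
      have := Fintype.card_le_one_iff.1 (h (w i) hi) ⟨π i, congrFun hπ i⟩ ⟨i, rfl⟩
      exact Subtype.ext_iff.1 this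
    · rfl
  · push Not at h
    obtain ⟨s, hs, h⟩ := h
    obtain ⟨⟨i, hi⟩, ⟨j, hj⟩, hij⟩ := Fintype.one_lt_card_iff.1 h
    have hij' : i ≠ j := fun h => hij (Subtype.ext h)
    have hsw : w ∘ swap i j = w := by
      funext t
      rw [Function.comp_apply, swap_apply_def]
      split_ifs with h1 h2
      · rw [h1, hi, hj]
      · rw [h2, hi, hj]
      · rfl
    have hsw' : w ∘ (swap i j).symm = w := by rwa [symm_swap]
    -- Right multiplication by the transposition of two equal even letters permutes the stabilizer
    -- and changes every sign, so the sum equals its own negative.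
    have h1 : ∑ π : Perm (Fin n), (if w ∘ π = w then wordSign K odd π w else 0) =
        ∑ π : Perm (Fin n), -(if w ∘ π = w then wordSign K odd π w else 0) := by
      refine Fintype.sum_equiv (Equiv.mulRight (swap i j)) _ _ fun π => ?_
      have h2 : w ∘ (π * swap i j : Perm _) = w ↔ w ∘ π = w := by
        rw [Perm.coe_mul, ← Function.comp_assoc]
        constructor
        · intro h
          have := congrArg (· ∘ swap i j) h
          simp only [Function.comp_assoc, ← Perm.coe_mul, hsw] at this
          simpa using this
        · intro h
          rw [h, hsw]
      rw [Equiv.coe_mulRight]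
      simp only [h2]
      split_ifs
      · rw [wordSign_mul, hsw', wordSign_swap_of_even K odd hij' (hi.trans hj.symm) (hi ▸ hs),
          mul_neg_one, neg_neg]
      · rw [neg_zero]
    rw [Finset.sum_neg_distrib] at h1
    exact self_eq_neg.1 h1

/-- Orbit counting: the words with a given content `N` form one orbit. For a word `w₀` in it, the
fibers of `π ↦ w₀ ∘ π` are cosets of stabilizers, so the stabilizers along the orbit have total size
`n!`. -/
theorem sum_card_stabilizer [Fintype ι] [DecidableEq ι] (n : ℕ) (P : (ι → ℕ) → Prop)
    [DecidablePred P] :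
    ∑ w : Fin n → ι, (if P (fun s => Fintype.card {x // w x = s}) then
      Fintype.card {π : Perm (Fin n) // w ∘ π = w} else 0) =
    n.factorial * ((Finset.univ.finsuppAntidiag n).filter fun N : ι →₀ ℕ => P N).card := by
  let c : (Fin n → ι) → ι →₀ ℕ := fun w =>
    Finsupp.equivFunOnFinite.symm fun s => Fintype.card {x // w x = s}
  have hc : ∀ w, (c w : ι → ℕ) = fun s => Fintype.card {x // w x = s} := fun _ => rfl
  rw [← Finset.sum_filter, mul_comm, ← smul_eq_mul, ← Finset.sum_const,
    ← Finset.sum_fiberwise_of_maps_to (t := (Finset.univ.finsuppAntidiag n).filter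
      fun N : ι →₀ ℕ => P N) (g := c)]
  · refine Finset.sum_congr rfl fun N hN => ?_
    rw [Finset.mem_filter, Finset.mem_finsuppAntidiag] at hN
    obtain ⟨w₀, hw₀⟩ := exists_word_of_card_fiber N hN.1.1
    have h1 : n.factorial = (Finset.univ : Finset (Perm (Fin n))).card := by
      rw [Finset.card_univ, Fintype.card_perm, Fintype.card_fin]
    rw [h1, Finset.card_eq_sum_card_fiberwise (f := fun π : Perm (Fin n) => w₀ ∘ π)
      (t := (Finset.univ.filter fun w => P fun s => Fintype.card {x // w x = s}).filter
        fun w => c w = N)]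
    · refine Finset.sum_congr rfl fun w hw => ?_
      rw [Finset.mem_filter] at hw
      have hcw : ∀ s, Fintype.card {x // w x = s} = N s := fun s => DFunLike.congr_fun hw.2 s
      obtain ⟨π₀, hπ₀⟩ := exists_perm_of_card_fiber_eq fun s => (hcw s).trans (hw₀ s).symm
      rw [Fintype.card_subtype]
      refine Finset.card_equiv (Equiv.mulLeft π₀) fun π => ?_
      simp only [Finset.mem_filter, Finset.mem_univ, true_and, Equiv.coe_mulLeft, Perm.coe_mul,
        ← Function.comp_assoc, hπ₀]
    · intro π _
      have h2 : c (w₀ ∘ π) = N := by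
        ext s
        exact (card_fiber_comp_perm w₀ π s).trans (hw₀ s)
      simp only [Finset.coe_filter, Finset.mem_filter, Finset.mem_univ, true_and,
        Set.mem_ofPred_eq]
      refine ⟨?_, h2⟩
      rw [← hc, h2]
      exact hN.2
  · intro w hw
    rw [Finset.mem_filter] at hw
    rw [Finset.mem_filter, Finset.mem_finsuppAntidiag]
    refine ⟨⟨?_, Finset.subset_univ _⟩, hw.2⟩
    change ∑ s, Fintype.card {x // w x = s} = n
    rw [← Fintype.card_sigma, Fintype.card_congr (Equiv.sigmaFiberEquiv w), Fintype.card_fin]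

theorem trace_wordAct [Fintype ι] [DecidableEq ι] {M : Type*} [AddCommGroup M] [Module K M]
    (B : Module.Basis (Fin n → ι) K M) (π : Perm (Fin n)) :
    LinearMap.trace K M (wordAct odd B π) =
      ∑ w, if w ∘ π = w then wordSign K odd π w else 0 := by
  rw [LinearMap.trace_eq_matrix_trace K B, Matrix.trace]
  refine Finset.sum_congr rfl fun w _ => ?_
  rw [Matrix.diag_apply, LinearMap.toMatrix_apply, wordAct_basis, map_smul, Finsupp.smul_apply,
    B.repr_self, Finsupp.single_apply, smul_eq_mul, mul_ite, mul_one, mul_zero]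
  refine if_congr ?_ rfl rfl
  rw [Equiv.comp_symm_eq, eq_comm]

/-- The trace of the averaging projection is the dimension of the invariants: a content contributes
one if no even letter is repeated, and nothing otherwise. -/
theorem trace_sum_wordAct [CharZero K] [Fintype ι] [DecidableEq ι] {M : Type*} [AddCommGroup M]
    [Module K M] (B : Module.Basis (Fin n → ι) K M) :
    LinearMap.trace K M ((n.factorial : K)⁻¹ • ∑ π, wordAct odd B π) =
      (((Finset.univ.finsuppAntidiag n).filter fun N : ι →₀ ℕ =>
        ∀ s, odd s = false → N s ≤ 1).card : K) := by
  rw [map_smul, map_sum, Finset.sum_congr rfl fun π _ => trace_wordAct K odd B π,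
    Finset.sum_comm]
  simp only [sum_wordSign_stabilizer]
  have := congrArg (Nat.cast (R := K))
    (sum_card_stabilizer n fun N : ι → ℕ => ∀ s, odd s = false → N s ≤ 1)
  push_cast at this
  rw [this, smul_eq_mul, inv_mul_cancel_left₀ (Nat.cast_ne_zero.2 n.factorial_ne_zero)]

end WordInvariants

/-! ### Generating function of the dimensions of exterior powers, and the resulting recurrence. -/

section SuperDimension

open PowerSeries

/-- The number of supersymmetric monomials of degree `n` in `p` even and `q` odd letters. -/
def wordCount (p q n : ℕ) : ℕ :=
  ((Finset.univ.finsuppAntidiag n).filter fun N : Fin p ⊕ Fin q →₀ ℕ =>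
    ∀ s, s.isRight = false → N s ≤ 1).card

/-- An even letter occurs at most once, giving a factor `1 + X`; an odd letter occurs any number of
times, giving `1 / (1 - X)`. -/
theorem mk_wordCount (p q : ℕ) :
    (mk fun n => (wordCount p q n : ℤ)) * (1 - X) ^ q = (1 + X) ^ p := by
  have h : (mk fun n => (wordCount p q n : ℤ)) =
      ∏ s : Fin p ⊕ Fin q, Sum.elim (fun _ => 1 + X) (fun _ => mk 1) s := by
    ext n
    rw [coeff_mk, coeff_prod, wordCount, Finset.cast_card, Finset.sum_filter]
    refine Finset.sum_congr rfl fun N _ => ?_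
    rw [Fintype.prod_sum_type]
    simp only [Sum.elim_inl, Sum.elim_inr, coeff_mk, Pi.one_apply, Finset.prod_const_one, mul_one]
    have h1 : ∀ a : ℕ, coeff a (1 + X : ℤ⟦X⟧) = if a ≤ 1 then 1 else 0 := by
      intro a
      rw [map_add, coeff_one, coeff_X]
      rcases a with _ | _ | a <;> simp
    simp only [h1, Finset.prod_ite_zero, Finset.prod_const_one]
    refine if_congr ?_ rfl rfl
    simp
  rw [h, Fintype.prod_sum_type]
  simp only [Sum.elim_inl, Sum.elim_inr, Finset.prod_const, Finset.card_univ, Fintype.card_fin]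
  rw [mul_assoc, ← mul_pow, mk_one_mul_one_sub_eq_one, one_pow, mul_one]

/-- The Hankel determinants of order `q + 1` of the dimensions of the exterior powers vanish. -/
theorem det_wordCount (p q : ℕ) (k : ℤ) (hk : (p : ℤ) - q + 1 ≤ k) (d : ℤ → ℤ)
    (hd : ∀ n : ℕ, d n = wordCount p q n) (hd' : ∀ a < 0, d a = 0) :
    (Matrix.of fun i j : Fin (q + 1) => d (k + (i : ℤ) + (j : ℤ))).det = 0 := by
  rw [← Matrix.exists_mulVec_eq_zero_iff]
  -- The coefficients of the denominator, in reverse order, form a vector in the kernel; its last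
  -- entry is `c 0 = 1`, so it is nonzero.
  let c : ℕ → ℤ := fun b => coeff b ((1 - X : ℤ⟦X⟧) ^ q)
  have hc : ∀ b, q < b → c b = 0 := by
    intro b hb
    have : ((1 - X : ℤ⟦X⟧) ^ q) = ((1 - Polynomial.X : Polynomial ℤ) ^ q : Polynomial ℤ) := by simp
    dsimp only [c]
    rw [this, Polynomial.coeff_coe]
    refine Polynomial.coeff_eq_zero_of_natDegree_lt (lt_of_le_of_lt ?_ hb)
    refine Polynomial.natDegree_pow_le_of_le q (m := 1) ?_ |>.trans (by simp)
    compute_degree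
  refine ⟨fun j => c (q - j), fun h => ?_, ?_⟩
  · have := congrFun h (Fin.last q)
    simp [c] at this
  · funext i
    -- Row `i` applied to the vector is the coefficient of degree `N = k + i + q` in `(1 + X)^p`.
    -- The bound on `k` says exactly that `N > p` for every `i`.
    obtain ⟨N, hN⟩ : ∃ N : ℕ, (N : ℤ) = k + i + q := ⟨(k + i + q).toNat, by omega⟩
    have hp : coeff N ((1 + X : ℤ⟦X⟧) ^ p) = 0 := by
      have : ((1 + X : ℤ⟦X⟧) ^ p) =
          ((1 + Polynomial.X : Polynomial ℤ) ^ p : Polynomial ℤ) := by simp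
      rw [this, Polynomial.coeff_coe]
      refine Polynomial.coeff_eq_zero_of_natDegree_lt (lt_of_le_of_lt ?_ (by omega : p < N))
      refine Polynomial.natDegree_pow_le_of_le p (m := 1) ?_ |>.trans (by simp)
      compute_degree
    rw [← mk_wordCount, mul_comm, coeff_mul, Finset.Nat.sum_antidiagonal_eq_sum_range_succ_mk] at hp
    rw [Matrix.mulVec, dotProduct, Pi.zero_apply, ← hp]
    -- The convolution runs to `N` and the row to `q`. Both are extended to a common range: terms
    -- with `b > N` vanish since `d` is zero in negative degrees, terms with `b > q` since `c` is.
    have h1 : ∑ b ∈ Finset.range (N + 1), c b * (mk fun n => (wordCount p q n : ℤ)).coeff (N - b) =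
        ∑ b ∈ Finset.range (N + q + 1), c b * d (N - b) := by
      rw [← Finset.sum_subset (Finset.range_mono (by omega : N + 1 ≤ N + q + 1))]
      · refine Finset.sum_congr rfl fun b hb => ?_
        rw [coeff_mk, ← hd, Nat.cast_sub (by simpa [Nat.lt_succ_iff] using hb)]
      · intro b _ hb
        rw [hd' _ (by simp at hb; omega), mul_zero]
    refine Eq.trans ?_ h1.symm
    rw [← Finset.sum_subset (Finset.range_mono (by omega : q + 1 ≤ N + q + 1))]
    · rw [← Finset.sum_range_reflect, ← Fin.sum_univ_eq_sum_range
        (fun j => c (q + 1 - 1 - j) * d (N - (q + 1 - 1 - j : ℕ)))]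
      refine Finset.sum_congr rfl fun j _ => ?_
      rw [mul_comm, Matrix.of_apply]
      congr 2
      have := j.2
      push_cast [Nat.cast_sub (by omega : (j : ℕ) ≤ q + 1 - 1)]
      omega
    · intro b _ hb
      rw [hc b (by simp at hb; omega), zero_mul]

end SuperDimension

noncomputable section

namespace SuperGL

variable {K : Type u} [Field K] [CharZero K] {V : Superspace K}

/-! ### Morphisms of representations -/

theorem isEven_iff {M N : Superspace K} {T : M.carrier →ₗ[K] N.carrier} :
    IsEven T ↔ ∀ x, T (M.grading.parity x) = N.grading.parity (T x) := by
  constructor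
  · rintro ⟨h0, h1⟩ x
    obtain ⟨a, ha, b, hb, rfl⟩ := M.grading.exists_even_odd x
    simp only [map_add, Grading.parity_of_even _ ha, Grading.parity_of_odd _ hb,
      Grading.parity_of_even _ (h0 a ha), Grading.parity_of_odd _ (h1 b hb), map_neg]
  · refine fun h => ⟨fun x hx => ?_, fun x hx => ?_⟩
    · rw [Grading.mem_even_iff, ← h, Grading.parity_of_even _ hx]
    · rw [Grading.mem_odd_iff, ← h, Grading.parity_of_odd _ hx, map_neg]

namespace SuperRep

variable {A B C D : SuperRep V}

theorem Hom.parity (f : A.Hom B) (x : A.space.carrier) :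
    f.toLin (A.space.grading.parity x) = B.space.grading.parity (f.toLin x) :=
  isEven_iff.1 f.isEven x

/-- A linear map commuting with the parity operators and the action is a morphism. -/
def Hom.mk' (T : A.space.carrier →ₗ[K] B.space.carrier)
    (h : ∀ x, T (A.space.grading.parity x) = B.space.grading.parity (T x))
    (hc : ∀ (R : SupercommAlgebra K) (g : GLPoints V R) (x : Ext A.space R),
      LinearMap.rTensor R.carrier T ((A.ρ R g).1 x) =
        (B.ρ R g).1 (LinearMap.rTensor R.carrier T x)) : A.Hom B :=
  ⟨T, isEven_iff.2 h, hc⟩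

/-- The identity morphism. -/
def Hom.id (A : SuperRep V) : A.Hom A :=
  Hom.mk' LinearMap.id (fun _ => rfl) fun R g x => by
    rw [LinearMap.rTensor_id]
    rfl

/-- Composition of morphisms. -/
def Hom.comp (g : B.Hom C) (f : A.Hom B) : A.Hom C :=
  Hom.mk' (g.toLin ∘ₗ f.toLin) (fun x => by
    rw [LinearMap.comp_apply, f.parity, g.parity]
    rfl) fun R k x => by
    rw [LinearMap.rTensor_comp, LinearMap.comp_apply, f.comm, g.comm]
    rfl

/-- The inverse of a bijective morphism. -/
def Hom.inverse (f : A.Hom B) (e : A.space.carrier ≃ₗ[K] B.space.carrier)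
    (he : e.toLinearMap = f.toLin) : B.Hom A :=
  Hom.mk' e.symm.toLinearMap (fun x => by
    apply e.injective
    have h := f.parity (e.symm x)
    rw [← he] at h
    simp only [LinearEquiv.coe_coe, LinearEquiv.apply_symm_apply] at h ⊢
    rw [h]) fun R g x => by
    have h1 : ∀ y, LinearMap.rTensor R.carrier e.symm.toLinearMap
        (LinearMap.rTensor R.carrier e.toLinearMap y) = y := fun y => by
      rw [← LinearMap.comp_apply, ← LinearMap.rTensor_comp, LinearEquiv.symm_comp,
        LinearMap.rTensor_id, LinearMap.id_apply]
    have h2 : ∀ y, LinearMap.rTensor R.carrier e.toLinearMap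
        (LinearMap.rTensor R.carrier e.symm.toLinearMap y) = y := fun y => by
      rw [← LinearMap.comp_apply, ← LinearMap.rTensor_comp, LinearEquiv.comp_symm,
        LinearMap.rTensor_id, LinearMap.id_apply]
    have h := f.comm R g (LinearMap.rTensor R.carrier e.symm.toLinearMap x)
    rw [← he, h2] at h
    rw [← h, h1]

/-- The zero morphism. -/
def Hom.zero (A B : SuperRep V) : A.Hom B :=
  Hom.mk' 0 (fun x => by simp) fun R g x => by simp

/-- Equivariant even endomorphisms, as a subalgebra of all endomorphisms. -/
def endAlgebra (A : SuperRep V) : Subalgebra K (Module.End K A.space.carrier) where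
  carrier := {T | (∀ x, T (A.space.grading.parity x) = A.space.grading.parity (T x)) ∧
    ∀ (R : SupercommAlgebra K) (g : GLPoints V R) (x : Ext A.space R),
      LinearMap.rTensor R.carrier T ((A.ρ R g).1 x) =
        (A.ρ R g).1 (LinearMap.rTensor R.carrier T x)}
  mul_mem' := by
    rintro S T ⟨hS, hS'⟩ ⟨hT, hT'⟩
    refine ⟨fun x => by simp only [Module.End.mul_apply, hT, hS], fun R g x => ?_⟩
    rw [Module.End.mul_eq_comp, LinearMap.rTensor_comp, LinearMap.comp_apply, hT', hS']
    rfl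
  add_mem' := by
    rintro S T ⟨hS, hS'⟩ ⟨hT, hT'⟩
    refine ⟨fun x => by simp only [LinearMap.add_apply, hT, hS, map_add], fun R g x => ?_⟩
    rw [LinearMap.rTensor_add, LinearMap.add_apply, hS', hT', LinearMap.add_apply, map_add]
  algebraMap_mem' c := by
    refine ⟨fun x => by simp, fun R g x => ?_⟩
    have : LinearMap.rTensor R.carrier (algebraMap K (Module.End K A.space.carrier) c) =
        c • LinearMap.id := by
      rw [← LinearMap.rTensor_id, ← LinearMap.rTensor_smul]
      rfl
    rw [this]
    simp

/-- An element of `A.endAlgebra` as a morphism. -/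
def endHom (T : A.endAlgebra) : A.Hom A := Hom.mk' T.1 T.2.1 T.2.2

/-- A morphism `A → A` as an element of `A.endAlgebra`. -/
def Hom.toEnd (f : A.Hom A) : A.endAlgebra := ⟨f.toLin, f.parity, f.comm⟩

theorem rTensor_mem_extSub_range (T : A.space.carrier →ₗ[K] A.space.carrier)
    (R : SupercommAlgebra K) : ∀ x, LinearMap.rTensor R.carrier T x ∈ extSub (M := A.space) (LinearMap.range T) R := by
  intro x
  induction x using TensorProduct.induction_on with
  | zero => simp
  | add x y hx hy => rw [map_add]; exact add_mem hx hy
  | tmul m r => exact tmul_mem_extSub (M := A.space) (LinearMap.mem_range_self T m) r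

/-- The image of an equivariant endomorphism. -/
def range (T : A.endAlgebra) : SubRep A where
  carrier := LinearMap.range T.1
  parity_mem := by
    rintro _ ⟨x, rfl⟩
    exact ⟨_, T.2.1 x⟩
  stable R g := by
    refine extSub_stable _ ?_
    rintro _ ⟨m, rfl⟩ r
    have h := T.2.2 R g (m ⊗ₜ r)
    rw [LinearMap.rTensor_tmul] at h
    exact h ▸ rTensor_mem_extSub_range T.1 R _

/-- The projection onto a quotient representation. -/
def mkHom (A : SuperRep V) (J : SubRep A) : A.Hom (A.quotient J) :=
  Hom.mk' J.carrier.mkQ (fun x => by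
    change _ = (A.space.grading.quotient J.carrier J.parity_mem).parity _
    rw [Grading.parity_quotient]
    rfl) fun R g x => (quotAct_mk _ _ _ _).symm

/-- The morphism induced on a quotient representation. -/
def liftHom (J : SubRep A) (f : A.Hom B) (h : ∀ x ∈ J.carrier, f.toLin x = 0) :
    (A.quotient J).Hom B :=
  Hom.mk' (J.carrier.liftQ f.toLin h) (fun x => by
    obtain ⟨x, rfl⟩ := J.carrier.mkQ_surjective x
    change J.carrier.liftQ f.toLin h
      ((A.space.grading.quotient J.carrier J.parity_mem).parity _) = _
    rw [Grading.parity_quotient]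
    exact f.parity x) fun R g x => by
    obtain ⟨x, rfl⟩ := extMk_surjective x
    have h1 : ∀ y, LinearMap.rTensor R.carrier (J.carrier.liftQ f.toLin h)
        (extMk A.space J.carrier J.parity_mem R y) = LinearMap.rTensor R.carrier f.toLin y := by
      intro y
      induction y using TensorProduct.induction_on with
      | zero => simp
      | add x y hx hy => rw [map_add, map_add, map_add, hx, hy]
      | tmul m r => rfl
    exact (congrArg _ (quotAct_mk _ _ _ _)).trans ((h1 _).trans
      ((f.comm R g x).trans (congrArg _ (h1 x).symm)))

theorem mkHom_surjective (J : SubRep A) : Function.Surjective (mkHom A J).toLin :=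
  J.carrier.mkQ_surjective

end SuperRep

/-! ### Classes in the split Grothendieck ring -/

open SuperRep

variable {A B C D : SuperRep V}

theorem splitClass_of_splitExact (i : A.Hom B) (p : B.Hom C) (h : IsSplitExact i p) :
    splitClass B = splitClass A + splitClass C := by
  rw [← sub_eq_zero, ← sub_sub]
  exact Ideal.Quotient.eq_zero_iff_mem.2
    (Ideal.subset_span (Or.inl ⟨A, B, C, i, p, h, rfl⟩))

theorem splitClass_tensor (A B : SuperRep V) :
    splitClass (A.tensor B) = splitClass A * splitClass B := by
  rw [← sub_eq_zero]
  exact Ideal.Quotient.eq_zero_iff_mem.2 (Ideal.subset_span (Or.inr (Or.inl ⟨A, B, rfl⟩)))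

theorem splitClass_one : splitClass (SuperRep.one V) = 1 := by
  rw [← sub_eq_zero]
  exact Ideal.Quotient.eq_zero_iff_mem.2 (Ideal.subset_span (Or.inr (Or.inr rfl)))

/-- The class of a biproduct. -/
theorem splitClass_of_biprod (i : A.Hom B) (p : B.Hom C) (r : B.Hom A) (s : C.Hom B)
    (hri : ∀ x, r.toLin (i.toLin x) = x) (hps : ∀ x, p.toLin (s.toLin x) = x)
    (hpi : ∀ x, p.toLin (i.toLin x) = 0)
    (h : ∀ x, i.toLin (r.toLin x) + s.toLin (p.toLin x) = x) :
    splitClass B = splitClass A + splitClass C := by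
  refine splitClass_of_splitExact i p ⟨⟨Function.LeftInverse.injective hri,
    fun x => ⟨fun hx => ?_, ?_⟩,
    Function.RightInverse.surjective hps⟩, s, hps⟩
  · have := h x
    rw [hx, map_zero, add_zero] at this
    exact ⟨_, this⟩
  · rintro ⟨y, rfl⟩
    exact hpi y

/-- If `A` is zero, identities exhibit it as a biproduct of two copies of itself, so `[A] = [A] +
[A]`. -/
theorem splitClass_zero_of_subsingleton (A : SuperRep V) (h : ∀ x : A.space.carrier, x = 0) :
    splitClass A = 0 := by
  have h2 := splitClass_of_biprod (Hom.id A) (Hom.id A) (Hom.id A) (Hom.id A) (fun _ => rfl)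
    (fun _ => rfl) h fun x => (h _).trans (h _).symm
  simpa using h2

/-- Invariance under isomorphism follows from the split relations: `B` is a biproduct of `A` and the
zero representation. -/
theorem splitClass_eq_of_inverse (f : A.Hom B) (g : B.Hom A) (hgf : ∀ x, g.toLin (f.toLin x) = x)
    (hfg : ∀ x, f.toLin (g.toLin x) = x) : splitClass A = splitClass B := by
  have h0 := splitClass_zero_of_subsingleton (SuperRep.zero V) fun _ => rfl
  have := splitClass_of_biprod f (Hom.zero B (SuperRep.zero V)) g (Hom.zero _ _) hgf
    (fun _ => rfl) (fun _ => rfl) fun x => (add_zero _).trans (hfg x)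
  rw [this, h0, add_zero]

theorem splitClass_zero : splitClass (SuperRep.zero V) = 0 :=
  splitClass_zero_of_subsingleton _ fun _ => rfl

/-! ### Images of idempotents -/

namespace SuperRep

/-- The image of an idempotent `e`, as the quotient by the image of `1 - e`. -/
def image (A : SuperRep V) (e : A.endAlgebra) : SuperRep V := A.quotient (range (1 - e))

/-- The projection onto the image of an idempotent. -/
def toImage (e : A.endAlgebra) : A.Hom (A.image e) := mkHom A _

/-- The inclusion of the image of an idempotent. -/
def ofImage (e : A.endAlgebra) (he : e * e = e) : (A.image e).Hom A :=
  liftHom _ (endHom e) (by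
    rintro _ ⟨x, rfl⟩
    have : e.1 ((1 - e : A.endAlgebra).1 x) = (e * (1 - e) : A.endAlgebra).1 x := rfl
    exact this.trans (by rw [mul_sub, mul_one, he, sub_self]; rfl))

theorem toImage_apply_self (e : A.endAlgebra) (x : A.space.carrier) :
    (toImage e).toLin (e.1 x) = (toImage e).toLin x := by
  refine ((Submodule.Quotient.eq _).2 ⟨-x, ?_⟩)
  rw [map_neg]
  change -(x - e.1 x) = e.1 x - x
  rw [neg_sub]

theorem toImage_ofImage (e : A.endAlgebra) (he : e * e = e) (x : (A.image e).space.carrier) :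
    (toImage e).toLin ((ofImage e he).toLin x) = x := by
  obtain ⟨x, rfl⟩ := mkHom_surjective _ x
  exact toImage_apply_self e x

end SuperRep

/-- The image of a sum of orthogonal idempotents is the biproduct of their images, and `b` and `a`
induce inverse isomorphisms between the images of `a b` and `b a`. This transports identities
between idempotents of the group algebra to classes of representations. -/
theorem isRankFunction_image {R : Type*} [Ring R] (α : R →+* A.endAlgebra) :
    IsRankFunction fun e : R => splitClass (A.image (α e)) where
  add e f he hf hef hfe := by
    have hE : ∀ {e : R}, e * e = e → α e * α e = α e := fun h => by rw [← map_mul, h]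
    have hs : (e + f) * (e + f) = e + f := by simp [mul_add, add_mul, he, hf, hef, hfe]
    have hmul : ∀ (a b : R) (x : A.space.carrier), (α a).1 ((α b).1 x) = (α (a * b)).1 x :=
      fun a b x => by rw [map_mul]; rfl
    have hzero : ∀ x : A.space.carrier, (α (0 : R)).1 x = 0 := fun x => by rw [map_zero]; rfl
    have hadd : ∀ (a b : R) (x : A.space.carrier), (α (a + b)).1 x = (α a).1 x + (α b).1 x :=
      fun a b x => by rw [map_add]; rfl
    refine splitClass_of_biprod ((toImage (α (e + f))).comp (ofImage (α e) (hE he)))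
      ((toImage (α f)).comp (ofImage (α (e + f)) (hE hs)))
      ((toImage (α e)).comp (ofImage (α (e + f)) (hE hs)))
      ((toImage (α (e + f))).comp (ofImage (α f) (hE hf))) ?_ ?_ ?_ ?_ <;> intro x <;>
      obtain ⟨x, rfl⟩ := mkHom_surjective _ x
    · change (toImage (α e)).toLin ((α (e + f)).1 ((α e).1 x)) = (toImage (α e)).toLin x
      rw [hmul, add_mul, he, hfe, add_zero, toImage_apply_self]
    · change (toImage (α f)).toLin ((α (e + f)).1 ((α f).1 x)) = (toImage (α f)).toLin x
      rw [hmul, add_mul, hf, hef, zero_add, toImage_apply_self]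
    · change (toImage (α f)).toLin ((α (e + f)).1 ((α e).1 x)) = 0
      rw [← toImage_apply_self, hmul, mul_add, hf, hfe, zero_add, hmul, hfe, hzero, map_zero]
    · change (toImage (α (e + f))).toLin ((α e).1 ((α (e + f)).1 x)) +
        (toImage (α (e + f))).toLin ((α f).1 ((α (e + f)).1 x)) = (toImage (α (e + f))).toLin x
      rw [← map_add, hmul, hmul, ← hadd, ← add_mul, hs, toImage_apply_self]
  comm a b hab hba := by
    have hE : ∀ {e : R}, e * e = e → α e * α e = α e := fun h => by rw [← map_mul, h]
    have h1 : a * b * (a * b) = a * b := by rw [← mul_assoc, hab]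
    have h2 : b * a * (b * a) = b * a := by rw [← mul_assoc, hba]
    have hmul : ∀ (a b : R) (x : A.space.carrier), (α a).1 ((α b).1 x) = (α (a * b)).1 x :=
      fun a b x => by rw [map_mul]; rfl
    refine splitClass_eq_of_inverse
      (((toImage (α (b * a))).comp (endHom (α b))).comp (ofImage (α (a * b)) (hE h1)))
      (((toImage (α (a * b))).comp (endHom (α a))).comp (ofImage (α (b * a)) (hE h2))) ?_ ?_ <;>
      intro x <;> obtain ⟨x, rfl⟩ := mkHom_surjective _ x
    · change (toImage (α (a * b))).toLin ((α a).1 ((α (b * a)).1 ((α b).1 ((α (a * b)).1 x)))) =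
        (toImage (α (a * b))).toLin x
      rw [hmul, hmul, hmul, ← toImage_apply_self _ x]
      congr 3
      simp only [← mul_assoc, hab]
    · change (toImage (α (b * a))).toLin ((α b).1 ((α (a * b)).1 ((α a).1 ((α (b * a)).1 x)))) =
        (toImage (α (b * a))).toLin x
      rw [hmul, hmul, hmul, ← toImage_apply_self _ x]
      congr 3
      simp only [← mul_assoc, hba]

end SuperGL

end

noncomputable section

namespace SuperGL

variable {K : Type u} [Field K] [CharZero K] {V : Superspace K}

/-! ### Tensor products of morphisms -/

section Pairing

variable {M N P M' N' : Superspace K} {R : SupercommAlgebra K}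

theorem rTensor_map_asc (f : M.carrier →ₗ[K] M'.carrier) (g : N.carrier →ₗ[K] N'.carrier)
    (m : M.carrier) (y : Ext N R) :
    LinearMap.rTensor R.carrier (TensorProduct.map f g) (asc m y) =
      asc (f m) (LinearMap.rTensor R.carrier g y) := by
  induction y using TensorProduct.induction_on with
  | zero => simp
  | add x y hx hy => simp only [map_add, hx, hy]
  | tmul n r => rfl

theorem rTensor_map_braid (f : M.carrier →ₗ[K] M'.carrier) (g : N.carrier →ₗ[K] N'.carrier)
    (hg : ∀ x, g (N.grading.parity x) = N'.grading.parity (g x)) (x : Ext M R) (n : N.carrier) :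
    LinearMap.rTensor R.carrier (TensorProduct.map f g) (braid M N R (x ⊗ₜ n)) =
      braid M' N' R (LinearMap.rTensor R.carrier f x ⊗ₜ g n) := by
  induction x using ext_induction with
  | ha x y hx hy => simp only [map_add, TensorProduct.add_tmul, hx, hy]
  | he m r hr =>
    rw [braid_even _ _ hr, LinearMap.rTensor_tmul, LinearMap.rTensor_tmul, braid_even _ _ hr]
    rfl
  | ho m r hr =>
    rw [braid_odd _ _ hr, LinearMap.rTensor_tmul, LinearMap.rTensor_tmul, braid_odd _ _ hr, ← hg]
    rfl

theorem pairing_tmul_even (m : M.carrier) {r : R.carrier} (hr : r ∈ R.grading.even)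
    (n : N.carrier) (s : R.carrier) :
    pairing ((m ⊗ₜ r : Ext M R) ⊗ₜ (n ⊗ₜ s : Ext N R)) =
      ((m ⊗ₜ n) ⊗ₜ (r * s) : Ext (M.tensor N) R) := by
  rw [pairing_tmul, braid_even _ _ hr, rmul_tmul]

theorem pairing_tmul_odd (m : M.carrier) {r : R.carrier} (hr : r ∈ R.grading.odd)
    (n : N.carrier) (s : R.carrier) :
    pairing ((m ⊗ₜ r : Ext M R) ⊗ₜ (n ⊗ₜ s : Ext N R)) =
      ((m ⊗ₜ N.grading.parity n) ⊗ₜ (r * s) : Ext (M.tensor N) R) := by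
  rw [pairing_tmul, braid_odd _ _ hr, rmul_tmul]

theorem tensor_parity_tmul (m : M.carrier) (n : N.carrier) :
    (M.grading.tensor N.grading).parity (m ⊗ₜ n) = M.grading.parity m ⊗ₜ N.grading.parity n := by
  rw [Grading.parity_tensor, TensorProduct.map_tmul]

/-- The sign rule is consistent: moving a scalar past `n` and then past `p` costs the same sign as
moving it past `n ⊗ p`. This is what makes the associator equivariant. -/
theorem rTensor_assoc_pairing (x : Ext M R) (y : Ext N R) (z : Ext P R) :
    LinearMap.rTensor R.carrier (TensorProduct.assoc K M.carrier N.carrier P.carrier).toLinearMap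
      (pairing (M := M.tensor N) (pairing (x ⊗ₜ y) ⊗ₜ z)) =
      pairing (N := N.tensor P) (x ⊗ₜ pairing (y ⊗ₜ z)) := by
  induction z using TensorProduct.induction_on with
  | zero => simp
  | add z w hz hw => simp only [map_add, TensorProduct.tmul_add, hz, hw]
  | tmul c t =>
    induction x using ext_induction with
    | ha x w hx hw => simp only [map_add, TensorProduct.add_tmul, hx, hw]
    | he a r hr =>
      induction y using ext_induction with
      | ha x w hx hw => simp only [map_add, TensorProduct.add_tmul, TensorProduct.tmul_add, hx, hw]
      | he b s hs =>
        rw [pairing_tmul_even _ hr, pairing_tmul_even _ hs,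
          pairing_tmul_even _ (R.even_mul_even _ hr _ hs), pairing_tmul_even _ hr, mul_assoc]
        rfl
      | ho b s hs =>
        rw [pairing_tmul_even _ hr, pairing_tmul_odd _ hs,
          pairing_tmul_odd _ (R.even_mul_odd _ hr _ hs), pairing_tmul_even _ hr, mul_assoc]
        rfl
    | ho a r hr =>
      induction y using ext_induction with
      | ha x w hx hw => simp only [map_add, TensorProduct.add_tmul, TensorProduct.tmul_add, hx, hw]
      | he b s hs =>
        rw [pairing_tmul_odd _ hr, pairing_tmul_even _ hs,
          pairing_tmul_odd _ (R.odd_mul_even _ hr _ hs), pairing_tmul_odd _ hr, mul_assoc,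
          tensor_parity_tmul]
        rfl
      | ho b s hs =>
        rw [pairing_tmul_odd _ hr, pairing_tmul_odd _ hs,
          pairing_tmul_even _ (R.odd_mul_odd _ hr _ hs), pairing_tmul_odd _ hr, mul_assoc,
          tensor_parity_tmul, Grading.parity_parity]
        rfl

theorem map_parity {f : M.carrier →ₗ[K] M'.carrier} {g : N.carrier →ₗ[K] N'.carrier}
    (hf : ∀ x, f (M.grading.parity x) = M'.grading.parity (f x))
    (hg : ∀ x, g (N.grading.parity x) = N'.grading.parity (g x)) (x : (M.tensor N).carrier) :
    TensorProduct.map f g ((M.tensor N).grading.parity x) =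
      (M'.tensor N').grading.parity (TensorProduct.map f g x) := by
  induction x using TensorProduct.induction_on with
  | zero => simp
  | add x y hx hy => simp only [map_add, hx, hy]
  | tmul a b =>
    rw [tensor_parity_tmul, TensorProduct.map_tmul, TensorProduct.map_tmul, tensor_parity_tmul,
      hf, hg]

theorem rTensor_map_act {f : M.carrier →ₗ[K] M'.carrier} {g : N.carrier →ₗ[K] N'.carrier}
    (hg : ∀ x, g (N.grading.parity x) = N'.grading.parity (g x))
    {a : Ext M R ≃ₗ[K] Ext M R} {a' : Ext M' R ≃ₗ[K] Ext M' R} {b : Ext N R ≃ₗ[K] Ext N R}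
    {b' : Ext N' R ≃ₗ[K] Ext N' R}
    (ha : ∀ x, LinearMap.rTensor R.carrier f (a x) = a' (LinearMap.rTensor R.carrier f x))
    (hb : ∀ x, LinearMap.rTensor R.carrier g (b x) = b' (LinearMap.rTensor R.carrier g x))
    (x : Ext (M.tensor N) R) :
    LinearMap.rTensor R.carrier (TensorProduct.map f g) (actLeft a (actRight b x)) =
      actLeft a' (actRight b' (LinearMap.rTensor R.carrier (TensorProduct.map f g) x)) := by
  have h1 : ∀ x : Ext (M.tensor N) R, LinearMap.rTensor R.carrier (TensorProduct.map f g)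
      (actRight b x) = actRight b' (LinearMap.rTensor R.carrier (TensorProduct.map f g) x) := by
    intro x
    induction x using asc_induction with
    | ha x y hx hy => simp only [map_add, hx, hy]
    | ht m y => rw [actRight_asc, rTensor_map_asc, rTensor_map_asc, actRight_asc, hb]
  have h2 : ∀ x : Ext (M.tensor N) R, LinearMap.rTensor R.carrier (TensorProduct.map f g)
      (actLeft a x) = actLeft a' (LinearMap.rTensor R.carrier (TensorProduct.map f g) x) := by
    intro x
    induction x using braid_induction with
    | ha x y hx hy => simp only [map_add, hx, hy]
    | ht m y => rw [actLeft_braid, rTensor_map_braid _ _ hg, rTensor_map_braid _ _ hg,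
        actLeft_braid, ha]
  rw [h2, h1]

theorem assoc_parity (x : ((M.tensor N).tensor P).carrier) :
    TensorProduct.assoc K M.carrier N.carrier P.carrier (((M.tensor N).tensor P).grading.parity x) =
      (M.tensor (N.tensor P)).grading.parity
        (TensorProduct.assoc K M.carrier N.carrier P.carrier x) := by
  simp only [Grading.parity_tensor]
  induction x using TensorProduct.induction_on with
  | zero => simp
  | add x y hx hy => simp only [map_add, hx, hy]
  | tmul x c =>
    induction x using TensorProduct.induction_on with
    | zero => simp
    | add x y hx hy => simp only [map_add, TensorProduct.add_tmul, hx, hy]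
    | tmul a b => rfl

theorem act_asc {f : Ext M R ≃ₗ[K] Ext M R} (hf : f ∈ GLPoints M R)
    (g : Ext N R ≃ₗ[K] Ext N R) (m : M.carrier) (y : Ext N R) :
    actLeft f (actRight g (asc m y)) = pairing (f (m ⊗ₜ 1) ⊗ₜ g y) := by
  rw [actRight_asc, actLeft_asc hf]

/-- On `(m ⊗ n) ⊗ y`, both sides become iterated pairings of `a (m ⊗ 1)`, `b (n ⊗ 1)` and `c y`, so
the claim is associativity of the pairing. -/
theorem rTensor_assoc_act {a : Ext M R ≃ₗ[K] Ext M R} (ha : a ∈ GLPoints M R)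
    {b : Ext N R ≃ₗ[K] Ext N R} (hb : b ∈ GLPoints N R) {c : Ext P R ≃ₗ[K] Ext P R}
    (x : Ext ((M.tensor N).tensor P) R) :
    LinearMap.rTensor R.carrier (TensorProduct.assoc K M.carrier N.carrier P.carrier).toLinearMap
      (actLeft (actLeft a * actRight b) (actRight c x)) =
    actLeft a (actRight (actLeft b * actRight c) (LinearMap.rTensor R.carrier
      (TensorProduct.assoc K M.carrier N.carrier P.carrier).toLinearMap x)) := by
  have hab : actLeft a * actRight b ∈ GLPoints (M.tensor N) R :=
    mul_mem (actLeft_mem ha) (actRight_mem hb)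
  have key : ∀ (m : M.carrier) (n : N.carrier) (y : Ext P R),
      LinearMap.rTensor R.carrier
        (TensorProduct.assoc K M.carrier N.carrier P.carrier).toLinearMap
        (actLeft (actLeft a * actRight b)
          (actRight c (asc (M := M.tensor N) (N := P) (m ⊗ₜ n) y))) =
      actLeft a (actRight (actLeft b * actRight c) (asc (N := N.tensor P) m (asc n y))) := by
    intro m n y
    rw [act_asc hab, act_asc ha, LinearEquiv.mul_apply, LinearEquiv.mul_apply, act_asc hb,
      ← asc_tmul, act_asc ha, rTensor_assoc_pairing]
  induction x using TensorProduct.induction_on with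
  | zero => simp
  | add x y hx hy => simp only [map_add, hx, hy]
  | tmul x r =>
    induction x using TensorProduct.induction_on with
    | zero => simp
    | add x y hx hy => simp only [map_add, TensorProduct.add_tmul, hx, hy]
    | tmul x c =>
      induction x using TensorProduct.induction_on with
      | zero => simp
      | add x y hx hy => simp only [map_add, TensorProduct.add_tmul, hx, hy]
      | tmul m n => exact key m n (c ⊗ₜ r)

variable (K) in
/-- The purely even line. -/
abbrev Superspace.line : Superspace K := { carrier := K, grading := ⟨⊤, ⊥, isCompl_top_bot⟩ }

theorem lid_parity (x : ((Superspace.line K).tensor N).carrier) :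
    TensorProduct.lid K N.carrier (((Superspace.line K).tensor N).grading.parity x) =
      N.grading.parity (TensorProduct.lid K N.carrier x) := by
  induction x using TensorProduct.induction_on with
  | zero => simp
  | add x y hx hy => simp only [map_add, hx, hy]
  | tmul a b =>
    rw [tensor_parity_tmul, Grading.parity_of_even _ Submodule.mem_top, TensorProduct.lid_tmul,
      TensorProduct.lid_tmul, map_smul]

theorem rTensor_lid_act (b : Ext N R ≃ₗ[K] Ext N R)
    (x : Ext ((Superspace.line K).tensor N) R) :
    LinearMap.rTensor R.carrier (TensorProduct.lid K N.carrier).toLinearMap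
      (actLeft 1 (actRight b x)) =
      b (LinearMap.rTensor R.carrier (TensorProduct.lid K N.carrier).toLinearMap x) := by
  have h : ∀ (k : K) (y : Ext N R), LinearMap.rTensor R.carrier
      (TensorProduct.lid K N.carrier).toLinearMap
        (asc (M := Superspace.line K) k y) = k • y := by
    intro k y
    induction y using TensorProduct.induction_on with
    | zero => simp
    | add x y hx hy => simp only [map_add, smul_add, hx, hy]
    | tmul n r => rfl
  rw [actLeft_one, LinearEquiv.coe_one, id_eq]
  induction x using asc_induction with
  | ha x y hx hy => simp only [map_add, hx, hy]
  | ht m y => rw [actRight_asc, h, h, map_smul]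

end Pairing

namespace SuperRep

variable {A B C A' B' : SuperRep V}

/-- The tensor product of two morphisms. -/
def Hom.tensor (f : A.Hom A') (g : B.Hom B') : (A.tensor B).Hom (A'.tensor B') :=
  Hom.mk' (A := A.tensor B) (B := A'.tensor B') (TensorProduct.map f.toLin g.toLin)
    (map_parity f.parity g.parity)
    fun R k => rTensor_map_act (a := (A.ρ R k).1) (a' := (A'.ρ R k).1) (b := (B.ρ R k).1)
      (b' := (B'.ρ R k).1) g.parity (f.comm R k) (g.comm R k)

/-- The associator. -/
def assocHom (A B C : SuperRep V) : ((A.tensor B).tensor C).Hom (A.tensor (B.tensor C)) :=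
  Hom.mk' (A := (A.tensor B).tensor C) (B := A.tensor (B.tensor C))
    (TensorProduct.assoc K A.space.carrier B.space.carrier C.space.carrier).toLinearMap
    assoc_parity fun R g => rTensor_assoc_act (A.ρ R g).2 (B.ρ R g).2

/-- The left unitor. -/
def lidHom (B : SuperRep V) : ((SuperRep.one V).tensor B).Hom B :=
  Hom.mk' (A := (SuperRep.one V).tensor B) (TensorProduct.lid K B.space.carrier).toLinearMap
    lid_parity fun R g => rTensor_lid_act (B.ρ R g).1

end SuperRep

open SuperRep

variable {A B C : SuperRep V}

/-- The class of the image of an idempotent on a representation isomorphic to a tensor product, on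
which it acts as a tensor product of two idempotents. -/
theorem splitClass_image_tensor (J : (A.tensor B).Hom C) (J' : C.Hom (A.tensor B))
    (h1 : ∀ x, J'.toLin (J.toLin x) = x) (h2 : ∀ x, J.toLin (J'.toLin x) = x)
    {e : A.endAlgebra} {f : B.endAlgebra} {k : C.endAlgebra} (he : e * e = e) (hf : f * f = f)
    (hk : k * k = k) (h : ∀ a b, J.toLin (e.1 a ⊗ₜ f.1 b) = k.1 (J.toLin (a ⊗ₜ b))) :
    splitClass (C.image k) = splitClass (A.image e) * splitClass (B.image f) := by
  rw [← splitClass_tensor]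
  have h' : ∀ x, J.toLin (TensorProduct.map e.1 f.1 x) = k.1 (J.toLin x) := fun x => by
    induction x using TensorProduct.induction_on with
    | zero => exact (map_zero J.toLin).trans ((map_zero k.1).symm.trans
        (congrArg k.1 (map_zero J.toLin).symm))
    | add x y hx hy =>
      exact (congrArg J.toLin (map_add _ x y)).trans ((map_add J.toLin _ _).trans
        ((congrArg₂ _ hx hy).trans ((map_add k.1 _ _).symm.trans
          (congrArg k.1 (map_add J.toLin x y).symm))))
    | tmul a b => exact h a b
  refine splitClass_eq_of_inverse
    ((((toImage e).tensor (toImage f)).comp J').comp (ofImage k hk))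
    (((toImage k).comp J).comp ((ofImage e he).tensor (ofImage f hf))) ?_ ?_
  · intro x
    obtain ⟨x, rfl⟩ := mkHom_surjective _ x
    obtain ⟨x, rfl⟩ : ∃ y, J.toLin y = x := ⟨_, h2 x⟩
    change (toImage k).toLin (J.toLin (TensorProduct.map (ofImage e he).toLin (ofImage f hf).toLin
      (TensorProduct.map (toImage e).toLin (toImage f).toLin (J'.toLin (k.1 (J.toLin x)))))) =
        (toImage k).toLin (J.toLin x)
    have h3 : ∀ y, TensorProduct.map (ofImage e he).toLin (ofImage f hf).toLin
      (TensorProduct.map (toImage e).toLin (toImage f).toLin y) = TensorProduct.map e.1 f.1 y := by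
      intro y
      rw [← LinearMap.comp_apply, ← TensorProduct.map_comp]
      rfl
    refine (congrArg (fun z => (toImage k).toLin (J.toLin z)) (h3 _)).trans ?_
    refine (congrArg (toImage k).toLin (h' _)).trans ?_
    refine (toImage_apply_self _ _).trans ?_
    refine (congrArg (toImage k).toLin (h2 _)).trans (toImage_apply_self _ _)
  · intro x
    have h3 : ∀ y, J'.toLin (k.1 (J.toLin y)) = TensorProduct.map e.1 f.1 y := fun y =>
      (congrArg J'.toLin (h' y).symm).trans (h1 _)
    change TensorProduct.map (toImage e).toLin (toImage f).toLin (J'.toLin (k.1 (J.toLin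
      (TensorProduct.map (ofImage e he).toLin (ofImage f hf).toLin x)))) = x
    refine (congrArg (TensorProduct.map (toImage e).toLin (toImage f).toLin) (h3 _)).trans ?_
    have h4 : TensorProduct.map (toImage e).toLin (toImage f).toLin ∘ₗ TensorProduct.map e.1 f.1 ∘ₗ
      TensorProduct.map (ofImage e he).toLin (ofImage f hf).toLin = LinearMap.id := by
      rw [← TensorProduct.map_comp, ← TensorProduct.map_comp, ← TensorProduct.map_id]
      congr 1
      · ext y
        exact (toImage_apply_self _ _).trans (toImage_ofImage e he _)
      · ext y
        exact (toImage_apply_self _ _).trans (toImage_ofImage f hf _)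
    exact LinearMap.congr_fun h4 x

end SuperGL

end

noncomputable section

namespace SuperGL

open SuperRep

variable {K : Type u} [Field K] [CharZero K] {V : Superspace K}

/-! ### Adjacent transpositions of tensor powers, and concatenation -/

theorem swapFirst_naturality {M N N' : Superspace K} (h : N.carrier →ₗ[K] N'.carrier)
    (z : (M.tensor (M.tensor N)).carrier) :
    swapFirst M N' (LinearMap.lTensor M.carrier (LinearMap.lTensor M.carrier h) z) =
      LinearMap.lTensor M.carrier (LinearMap.lTensor M.carrier h) (swapFirst M N z) := by
  induction z using TensorProduct.induction_on with
  | zero => simp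
  | add x y hx hy => simp only [map_add, hx, hy]
  | tmul v y =>
    induction y using TensorProduct.induction_on with
    | zero => simp
    | add x y hx hy => simp only [map_add, TensorProduct.tmul_add, hx, hy]
    | tmul u w =>
      obtain ⟨a, ha, b, hb, rfl⟩ := M.grading.exists_even_odd v
      simp only [TensorProduct.add_tmul, map_add, swapFirst_even ha, swapFirst_odd hb,
        LinearMap.lTensor_tmul]

variable (V)

/-- The swap of the factors number `i` and `i + 1` of `V^{⊗ n}`, with the sign rule. -/
def adjSwap : ∀ (n : ℕ), ℕ →
    ((tensorPower V n).space.carrier →ₗ[K] (tensorPower V n).space.carrier)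
  | 0, _ => LinearMap.id
  | 1, _ => LinearMap.id
  | n + 2, 0 => swapFirst V (tensorPower V n).space
  | n + 2, i + 1 => LinearMap.lTensor V.carrier (adjSwap (n + 1) i)

theorem adjSwap_succ : ∀ n i : ℕ,
    adjSwap V (n + 1) (i + 1) = LinearMap.lTensor V.carrier (adjSwap V n i)
  | 0, i => (LinearMap.lTensor_id V.carrier (tensorPower V 0).space.carrier).symm
  | _ + 1, _ => rfl

theorem adjSwap_mem : ∀ n i : ℕ, adjSwap V n i ∈ (tensorPower V n).endAlgebra
  | 0, _ => Subalgebra.one_mem _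
  | 1, _ => Subalgebra.one_mem _
  | n + 2, 0 => ⟨swapFirst_parity, fun _ g => extSwap_tensor (SuperRep.std V) (tensorPower V n) g⟩
  | n + 2, i + 1 => ((Hom.id (SuperRep.std V)).tensor
      (endHom ⟨adjSwap V (n + 1) i, adjSwap_mem (n + 1) i⟩)).toEnd.2

/-- Concatenation `V^{⊗ a} ⊗ V^{⊗ b} → V^{⊗ (a + b)}`. -/
def concat (b : ℕ) : ∀ a : ℕ,
    ((tensorPower V a).tensor (tensorPower V b)).Hom (tensorPower V (b + a))
  | 0 => lidHom _
  | a + 1 => ((Hom.id (SuperRep.std V)).tensor (concat b a)).comp (assocHom _ _ _)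

theorem concat_bijective (b : ℕ) : ∀ a : ℕ, Function.Bijective (concat V b a).toLin
  | 0 => (TensorProduct.lid K (tensorPower V b).space.carrier).bijective
  | a + 1 =>
    have h : Function.Bijective (TensorProduct.map LinearMap.id (concat V b a).toLin :
        V.carrier ⊗[K] ((tensorPower V a).tensor (tensorPower V b)).space.carrier →ₗ[K] _) :=
      (LinearEquiv.lTensor V.carrier (LinearEquiv.ofBijective _ (concat_bijective b a))).bijective
    h.comp (TensorProduct.assoc K V.carrier (tensorPower V a).space.carrier
      (tensorPower V b).space.carrier).bijective

/-- For the first two factors, concatenation with a fixed `y` only affects the remaining factors, so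
the claim is naturality of the swap in its last argument. Later swaps reduce to this by removing the
first factor. -/
theorem concat_adjSwap_left (b : ℕ) : ∀ (a i : ℕ) (_ : i + 1 < a)
    (x : (tensorPower V a).space.carrier) (y : (tensorPower V b).space.carrier),
    (concat V b a).toLin (adjSwap V a i x ⊗ₜ y) =
      adjSwap V (b + a) i ((concat V b a).toLin (x ⊗ₜ y))
  | a + 2, 0, _, x, y => by
    let h : (tensorPower V a).space.carrier →ₗ[K] (tensorPower V (b + a)).space.carrier :=
      (concat V b a).toLin ∘ₗ (TensorProduct.mk K (tensorPower V a).space.carrier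
        (tensorPower V b).space.carrier).flip y
    have key : ∀ z : V.carrier ⊗[K] (V.carrier ⊗[K] (tensorPower V a).space.carrier),
        (concat V b (a + 2)).toLin (z ⊗ₜ y) =
          LinearMap.lTensor V.carrier (LinearMap.lTensor V.carrier h) z := by
      intro z
      induction z using TensorProduct.induction_on with
      | zero => exact (congrArg _ (TensorProduct.zero_tmul _ y)).trans (map_zero _)
      | add z w hz hw =>
        exact (congrArg _ (TensorProduct.add_tmul z w y)).trans ((map_add _ _ _).trans
          ((congrArg₂ _ hz hw).trans (map_add _ _ _).symm))
      | tmul v z =>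
        induction z using TensorProduct.induction_on with
        | zero =>
          exact (congrArg (fun t => (concat V b (a + 2)).toLin (t ⊗ₜ y))
            (TensorProduct.tmul_zero _ v)).trans (((congrArg _ (TensorProduct.zero_tmul _ y)).trans
              (map_zero _)).trans (((congrArg _ (TensorProduct.tmul_zero _ v)).trans
                (map_zero _)).symm))
        | add z w hz hw =>
          exact (congrArg (fun t => (concat V b (a + 2)).toLin (t ⊗ₜ y))
            (TensorProduct.tmul_add v z w)).trans ((congrArg _ (TensorProduct.add_tmul _ _ y)).trans
            ((map_add _ _ _).trans ((congrArg₂ _ hz hw).trans ((map_add _ _ _).symm.trans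
              (congrArg _ (TensorProduct.tmul_add v z w).symm)))))
        | tmul u w => rfl
    refine (key _).trans (Eq.trans ?_ (congrArg (swapFirst V (tensorPower V (b + a)).space)
      (key x)).symm)
    exact (swapFirst_naturality (N := (tensorPower V a).space)
      (N' := (tensorPower V (b + a)).space) h x).symm
  | a + 2, i + 1, hi, x, y => by
    have ih := concat_adjSwap_left b (a + 1) i (by omega)
    refine TensorProduct.induction_on (motive := fun x : V.carrier ⊗[K]
      (tensorPower V (a + 1)).space.carrier => (concat V b (a + 2)).toLin
        (adjSwap V (a + 2) (i + 1) x ⊗ₜ y) =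
      adjSwap V (b + (a + 2)) (i + 1) ((concat V b (a + 2)).toLin (x ⊗ₜ y))) x ?_ ?_ ?_
    · have h0 : (concat V b (a + 2)).toLin
          ((0 : (tensorPower V (a + 2)).space.carrier) ⊗ₜ y) = 0 :=
        (congrArg _ (TensorProduct.zero_tmul _ y)).trans (map_zero _)
      exact (congrArg (fun t => (concat V b (a + 2)).toLin (t ⊗ₜ y)) (map_zero _)).trans
        (h0.trans ((congrArg _ h0).trans (map_zero _)).symm)
    · intro v z
      exact congrArg (fun t => (v ⊗ₜ t : V.carrier ⊗[K]
        (tensorPower V (b + (a + 1))).space.carrier)) (ih z y)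
    · intro z w hz hw
      have h0 : ∀ z w, (concat V b (a + 2)).toLin
          ((z + w : (tensorPower V (a + 2)).space.carrier) ⊗ₜ y) =
            (concat V b (a + 2)).toLin (z ⊗ₜ y) + (concat V b (a + 2)).toLin (w ⊗ₜ y) :=
        fun z w => (congrArg _ (TensorProduct.add_tmul _ _ y)).trans (map_add _ _ _)
      exact (congrArg (fun t => (concat V b (a + 2)).toLin (t ⊗ₜ y)) (map_add _ _ _)).trans
        ((h0 _ _).trans ((congrArg₂ _ hz hw).trans ((map_add _ _ _).symm.trans
          (congrArg _ (h0 _ _).symm))))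

theorem concat_adjSwap_right (b i : ℕ) : ∀ (a : ℕ)
    (x : (tensorPower V a).space.carrier) (y : (tensorPower V b).space.carrier),
    (concat V b a).toLin (x ⊗ₜ adjSwap V b i y) =
      adjSwap V (b + a) (i + a) ((concat V b a).toLin (x ⊗ₜ y))
  | 0, x, y => ((adjSwap V b i).map_smul x y).symm
  | a + 1, x, y => by
    have ih := concat_adjSwap_right b i a
    have h0 : ∀ y z w, (concat V b (a + 1)).toLin
          ((z + w : (tensorPower V (a + 1)).space.carrier) ⊗ₜ y) =
            (concat V b (a + 1)).toLin (z ⊗ₜ y) + (concat V b (a + 1)).toLin (w ⊗ₜ y) :=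
        fun y z w => (congrArg _ (TensorProduct.add_tmul _ _ y)).trans (map_add _ _ _)
    have h1 : ∀ y, (concat V b (a + 1)).toLin
          ((0 : (tensorPower V (a + 1)).space.carrier) ⊗ₜ y) = 0 :=
        fun y => (congrArg _ (TensorProduct.zero_tmul _ y)).trans (map_zero _)
    refine TensorProduct.induction_on (motive := fun x : V.carrier ⊗[K]
      (tensorPower V a).space.carrier => (concat V b (a + 1)).toLin (x ⊗ₜ adjSwap V b i y) =
      adjSwap V (b + (a + 1)) (i + (a + 1)) ((concat V b (a + 1)).toLin (x ⊗ₜ y))) x ?_ ?_ ?_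
    · exact (h1 _).trans ((congrArg _ (h1 _)).trans (map_zero _)).symm
    · intro v z
      refine (congrArg (fun t => (v ⊗ₜ t : V.carrier ⊗[K]
        (tensorPower V (b + a)).space.carrier)) (ih z y)).trans ?_
      exact (LinearMap.congr_fun (adjSwap_succ V (b + a) (i + a)) (v ⊗ₜ (concat V b a).toLin (z ⊗ₜ y) :
        V.carrier ⊗[K] (tensorPower V (b + a)).space.carrier)).symm
    · intro z w hz hw
      exact (h0 _ _ _).trans ((congrArg₂ _ hz hw).trans ((map_add _ _ _).symm.trans
          (congrArg _ (h0 _ _ _).symm)))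

end SuperGL

end

noncomputable section

namespace SuperGL

open SuperRep Equiv

variable {K : Type u} [Field K] [CharZero K] (V : Superspace K)

/-! ### The action of the symmetric group on tensor powers -/

/-- The index type of a homogeneous basis of `V`. -/
abbrev Letter : Type :=
  Fin (Module.finrank K V.grading.even) ⊕ Fin (Module.finrank K V.grading.odd)

/-- A homogeneous basis of `V`. -/
def letterBasis : Module.Basis (Letter V) K V.carrier :=
  ((Module.finBasis K V.grading.even).prod (Module.finBasis K V.grading.odd)).map
    (Submodule.prodEquivOfIsCompl _ _ V.grading.isCompl)

theorem letterBasis_inl (i) : letterBasis V (.inl i) ∈ V.grading.even := by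
  simp [letterBasis]

theorem letterBasis_inr (i) : letterBasis V (.inr i) ∈ V.grading.odd := by
  simp [letterBasis]

/-- The basis of `V^{⊗ n}` consisting of words in the homogeneous basis of `V`. -/
def wordBasis : ∀ n : ℕ, Module.Basis (Fin n → Letter V) K (tensorPower V n).space.carrier
  | 0 => (Module.Basis.singleton (Fin 0 → Letter V) K)
  | n + 1 => ((letterBasis V).tensorProduct (wordBasis n)).reindex
      (Fin.consEquiv fun _ : Fin (n + 1) => Letter V)

theorem wordBasis_succ (n : ℕ) (w : Fin (n + 1) → Letter V) :
    wordBasis V (n + 1) w = (letterBasis V (w 0) ⊗ₜ[K] wordBasis V n (Fin.tail w) :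
      V.carrier ⊗[K] (tensorPower V n).space.carrier) :=
  (Module.Basis.reindex_apply ((letterBasis V).tensorProduct (wordBasis V n))
    (Fin.consEquiv fun _ : Fin (n + 1) => Letter V) w).trans
    (Module.Basis.tensorProduct_apply (letterBasis V) (wordBasis V n) (w 0) (Fin.tail w))

theorem swapFirst_letterBasis {N : Superspace K} (x y : Letter V) (z : N.carrier) :
    swapFirst V N (letterBasis V x ⊗ₜ (letterBasis V y ⊗ₜ z)) =
      (if x.isRight = true ∧ y.isRight = true then (-1 : K) else 1) •
        (letterBasis V y ⊗ₜ (letterBasis V x ⊗ₜ z)) := by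
  rcases x with x | x
  · rw [swapFirst_even (letterBasis_inl V x)]
    simp
  · rw [swapFirst_odd (letterBasis_inr V x)]
    rcases y with y | y
    · rw [Grading.parity_of_even _ (letterBasis_inl V y)]
      simp
    · rw [Grading.parity_of_odd _ (letterBasis_inr V y), TensorProduct.neg_tmul]
      simp

theorem adjSwap_wordBasis : ∀ (n i : ℕ) (h : i + 1 < n) (w : Fin n → Letter V),
    adjSwap V n i (wordBasis V n w) =
      (if (w ⟨i, by omega⟩).isRight = true ∧ (w ⟨i + 1, h⟩).isRight = true then (-1 : K) else 1) •
        wordBasis V n (w ∘ swap ⟨i, by omega⟩ ⟨i + 1, h⟩)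
  | n + 2, 0, h, w => by
    have e1 : wordBasis V (n + 2) w = (letterBasis V (w 0) ⊗ₜ[K] (letterBasis V (w 1) ⊗ₜ[K]
        wordBasis V n (Fin.tail (Fin.tail w))) : V.carrier ⊗[K] (V.carrier ⊗[K]
          (tensorPower V n).space.carrier)) :=
      (wordBasis_succ V (n + 1) w).trans (congrArg (fun t => (letterBasis V (w 0) ⊗ₜ[K] t :
        V.carrier ⊗[K] (tensorPower V (n + 1)).space.carrier)) (wordBasis_succ V n (Fin.tail w)))
    have e2 : wordBasis V (n + 2) (w ∘ swap 0 1) = (letterBasis V (w 1) ⊗ₜ[K]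
        (letterBasis V (w 0) ⊗ₜ[K] wordBasis V n (Fin.tail (Fin.tail w))) :
          V.carrier ⊗[K] (V.carrier ⊗[K] (tensorPower V n).space.carrier)) := by
      refine (wordBasis_succ V (n + 1) _).trans ((congrArg (fun t => (_ ⊗ₜ[K] t :
        V.carrier ⊗[K] (tensorPower V (n + 1)).space.carrier)) (wordBasis_succ V n _)).trans ?_)
      have h0 : (w ∘ swap (0 : Fin (n + 2)) 1) 0 = w 1 := by simp
      have h1 : Fin.tail (w ∘ swap (0 : Fin (n + 2)) 1) 0 = w 0 := by
        simp [Fin.tail]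
      have h2 : Fin.tail (Fin.tail (w ∘ swap (0 : Fin (n + 2)) 1)) = Fin.tail (Fin.tail w) := by
        funext i
        simp only [Fin.tail, Function.comp_apply]
        rw [swap_apply_of_ne_of_ne]
        · exact Fin.succ_ne_zero _
        · exact fun h => Fin.succ_ne_zero i (Fin.succ_injective _ h)
      rw [h0, h1, h2]
      rfl
    refine (congrArg (swapFirst V (tensorPower V n).space) e1).trans
      ((swapFirst_letterBasis V (N := (tensorPower V n).space) _ _ _).trans ?_)
    exact congrArg (_ • ·) e2.symm
  | n + 1, i + 1, h, w => by
    have h' : i + 1 < n := by omega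
    have ih := adjSwap_wordBasis n i h' (Fin.tail w)
    have e2 : wordBasis V (n + 1) (w ∘ swap ⟨i + 1, by omega⟩ ⟨i + 1 + 1, h⟩) =
        (letterBasis V (w 0) ⊗ₜ[K] wordBasis V n (Fin.tail w ∘ swap ⟨i, by omega⟩ ⟨i + 1, h'⟩) :
          V.carrier ⊗[K] (tensorPower V n).space.carrier) := by
      refine (wordBasis_succ V n _).trans ?_
      have h0 : (w ∘ swap (⟨i + 1, by omega⟩ : Fin (n + 1)) ⟨i + 1 + 1, h⟩) 0 = w 0 := by
        rw [Function.comp_apply, swap_apply_of_ne_of_ne] <;> simp [Fin.ext_iff]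
      have h1 : Fin.tail (w ∘ swap (⟨i + 1, by omega⟩ : Fin (n + 1)) ⟨i + 1 + 1, h⟩) =
          Fin.tail w ∘ swap ⟨i, by omega⟩ ⟨i + 1, h'⟩ := by
        funext j
        simp only [Fin.tail, Function.comp_apply]
        congr 1
        exact ((Fin.succ_injective n).map_swap ⟨i, by omega⟩ ⟨i + 1, h'⟩ j).symm
      rw [h0, h1]
    refine (congrArg (adjSwap V (n + 1) (i + 1)) (wordBasis_succ V n w)).trans ?_
    refine (LinearMap.congr_fun (adjSwap_succ V n i) (letterBasis V (w 0) ⊗ₜ[K]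
      wordBasis V n (Fin.tail w) : V.carrier ⊗[K] (tensorPower V n).space.carrier)).trans ?_
    refine (congrArg (fun t => (letterBasis V (w 0) ⊗ₜ[K] t :
        V.carrier ⊗[K] (tensorPower V n).space.carrier)) ih).trans ?_
    refine (TensorProduct.tmul_smul _ _ _).trans ?_
    exact congrArg (_ • ·) e2.symm

/-- The action of the symmetric group on `V^{⊗ n}` for which adjacent transpositions act by the
negatives of the swaps with the sign rule. -/
def permAct (n : ℕ) : Perm (Fin n) →* Module.End K (tensorPower V n).space.carrier :=
  wordAct Sum.isRight (wordBasis V n)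

/-- The minus sign turns the exterior relations `x + s_i x` into `x - π x`, so that exterior powers
become coinvariants of this action. -/
theorem permAct_swap (n i : ℕ) (h : i + 1 < n) :
    permAct V n (swap ⟨i, by omega⟩ ⟨i + 1, h⟩) = -adjSwap V n i := by
  refine (wordBasis V n).ext fun w => ?_
  rw [LinearMap.neg_apply, adjSwap_wordBasis V n i h, ← neg_smul]
  refine (wordAct_basis _ _ _ _).trans ?_
  rw [wordSign_swap K _ _ _ rfl, Equiv.symm_swap]
  congr 1
  split_ifs <;> simp

theorem perm_induction {n : ℕ} {p : Perm (Fin n) → Prop} (π : Perm (Fin n)) (h1 : p 1)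
    (hs : ∀ (i : ℕ) (h : i + 1 < n), p (swap ⟨i, by omega⟩ ⟨i + 1, h⟩))
    (hm : ∀ π τ, p π → p τ → p (π * τ)) : p π := by
  cases n with
  | zero => rwa [Subsingleton.elim π 1]
  | succ n =>
    have hπ : π ∈ Submonoid.closure (Set.range fun i : Fin n => swap i.castSucc i.succ) := by
      rw [Perm.mclosure_swap_castSucc_succ]
      trivial
    induction hπ using Submonoid.closure_induction with
    | mem x hx =>
      obtain ⟨i, rfl⟩ := hx
      exact hs i (by omega)
    | one => exact h1
    | mul x y _ _ hx hy => exact hm x y hx hy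

/-- The action is defined through a basis, so its equivariance is not visible; it is inherited from
the adjacent transpositions, which generate. -/
theorem permAct_mem (n : ℕ) (π : Perm (Fin n)) :
    permAct V n π ∈ (tensorPower V n).endAlgebra := by
  induction π using perm_induction with
  | h1 => rw [map_one]; exact one_mem _
  | hs i h => rw [permAct_swap]; exact neg_mem (adjSwap_mem V n i)
  | hm π τ h h' => rw [map_mul]; exact mul_mem h h'

/-- The group algebra of the symmetric group acts on `V^{⊗ n}` by equivariant endomorphisms. -/
def groupAlgebraAct (n : ℕ) :
    MonoidAlgebra K (Perm (Fin n)) →ₐ[K] (tensorPower V n).endAlgebra :=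
  MonoidAlgebra.lift K (tensorPower V n).endAlgebra (Perm (Fin n))
    { toFun := fun π => ⟨permAct V n π, permAct_mem V n π⟩
      map_one' := Subtype.ext (map_one _)
      map_mul' := fun π τ => Subtype.ext (map_mul _ π τ) }

theorem groupAlgebraAct_of (n : ℕ) (π : Perm (Fin n)) :
    (groupAlgebraAct V n (MonoidAlgebra.of K _ π)).1 = permAct V n π :=
  congrArg Subtype.val (MonoidAlgebra.lift_of _ _)

/-! ### Blocks -/

/-- The identification of `Fin a ⊕ Fin b` with `Fin (b + a)`, where `Fin a` comes first. -/
def blockEquiv (a b : ℕ) : Fin a ⊕ Fin b ≃ Fin (b + a) :=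
  finSumFinEquiv.trans (finCongr (add_comm a b))

/-- The embedding of `S_a × S_b` into `S_{a + b}`. -/
def blockPerm (a b : ℕ) : Perm (Fin a) × Perm (Fin b) →* Perm (Fin (b + a)) :=
  (blockEquiv a b).permCongrHom.toMonoidHom.comp (Perm.sumCongrHom (Fin a) (Fin b))

theorem blockPerm_swap_left (a b i : ℕ) (h : i + 1 < a) :
    blockPerm a b (swap ⟨i, by omega⟩ ⟨i + 1, h⟩, 1) =
      swap ⟨i, by omega⟩ ⟨i + 1, by omega⟩ := by
  change (blockEquiv a b).permCongr (Perm.sumCongr _ 1) = _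
  rw [Perm.sumCongr_swap_one, Equiv.permCongr_def, Equiv.symm_trans_swap_trans]
  rfl

theorem blockPerm_swap_right (a b i : ℕ) (h : i + 1 < b) :
    blockPerm a b (1, swap ⟨i, by omega⟩ ⟨i + 1, h⟩) =
      swap ⟨i + a, by omega⟩ ⟨i + a + 1, by omega⟩ := by
  change (blockEquiv a b).permCongr (Perm.sumCongr 1 _) = _
  rw [Perm.sumCongr_one_swap, Equiv.permCongr_def, Equiv.symm_trans_swap_trans]
  congr 1 <;> simp [blockEquiv, Fin.ext_iff] <;> omega

/-- Checking on adjacent transpositions avoids comparing the word signs of a block permutation with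
those of its blocks. -/
theorem concat_permAct_left (a b : ℕ) (π : Perm (Fin a)) (x : (tensorPower V a).space.carrier)
    (y : (tensorPower V b).space.carrier) :
    (concat V b a).toLin (permAct V a π x ⊗ₜ y) =
      permAct V (b + a) (blockPerm a b (π, 1)) ((concat V b a).toLin (x ⊗ₜ y)) := by
  induction π using perm_induction generalizing x with
  | h1 =>
    rw [map_one, ← Prod.one_eq_mk, map_one, map_one]
    rfl
  | hs i h =>
    rw [blockPerm_swap_left, permAct_swap, permAct_swap, LinearMap.neg_apply, LinearMap.neg_apply,
      ← concat_adjSwap_left V b a i h]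
    exact (congrArg _ (TensorProduct.neg_tmul _ _)).trans (map_neg _ _)
  | hm π τ h h' =>
    have : ((π * τ, 1) : Perm (Fin a) × Perm (Fin b)) = (π, 1) * (τ, 1) := by simp
    rw [this, map_mul, map_mul, map_mul]
    exact (h _).trans (congrArg _ (h' _))

theorem concat_permAct_right (a b : ℕ) (π : Perm (Fin b)) (x : (tensorPower V a).space.carrier)
    (y : (tensorPower V b).space.carrier) :
    (concat V b a).toLin (x ⊗ₜ permAct V b π y) =
      permAct V (b + a) (blockPerm a b (1, π)) ((concat V b a).toLin (x ⊗ₜ y)) := by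
  induction π using perm_induction generalizing y with
  | h1 =>
    rw [map_one, ← Prod.one_eq_mk, map_one, map_one]
    rfl
  | hs i h =>
    rw [blockPerm_swap_right, permAct_swap, permAct_swap, LinearMap.neg_apply, LinearMap.neg_apply,
      ← concat_adjSwap_right V b i a]
    exact (congrArg _ (TensorProduct.tmul_neg _ _)).trans (map_neg _ _)
  | hm π τ h h' =>
    have : ((1, π * τ) : Perm (Fin a) × Perm (Fin b)) = (1, π) * (1, τ) := by simp
    rw [this, map_mul, map_mul, map_mul]
    exact (h _).trans (congrArg _ (h' _))

end SuperGL

end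

noncomputable section

namespace SuperGL

open SuperRep Equiv

variable {K : Type u} [Field K] [CharZero K] (V : Superspace K)

/-! ### Exterior powers as images of idempotents of the group algebra -/

theorem groupAlgebraAct_average (n : ℕ) (H : Subgroup (Perm (Fin n))) [Fintype H]
    (x : (tensorPower V n).space.carrier) :
    (groupAlgebraAct V n (H.average K)).1 x =
      (Fintype.card H : K)⁻¹ • ∑ h : H, permAct V n h x := by
  have h1 : (groupAlgebraAct V n (H.average K)).1 =
      (Fintype.card H : K)⁻¹ • ∑ h : H, permAct V n h := by
    rw [Subgroup.average, map_smul, map_sum]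
    refine (congrArg (_ • ·) (map_sum (tensorPower V n).endAlgebra.val _ _)).trans ?_
    simp only [Fintype.card_eq_nat_card]
    congr 1
    exact Finset.sum_congr (by ext; simp) fun h _ => groupAlgebraAct_of V n h.1
  rw [h1, LinearMap.smul_apply, LinearMap.sum_apply]

theorem permAct_average (n : ℕ) (H : Subgroup (Perm (Fin n))) {h : Perm (Fin n)} (hh : h ∈ H)
    (x : (tensorPower V n).space.carrier) :
    (groupAlgebraAct V n (H.average K)).1 (permAct V n h x) =
      (groupAlgebraAct V n (H.average K)).1 x := by
  classical
  rw [groupAlgebraAct_average, groupAlgebraAct_average]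
  congr 1
  refine Fintype.sum_equiv (Equiv.mulRight (⟨h, hh⟩ : H)) _ _ fun k => ?_
  exact (LinearMap.congr_fun (map_mul (permAct V n) k.1 h) x).symm

theorem add_adjSwap_mem_exteriorRel : ∀ (n i : ℕ) (_ : i + 1 < n)
    (x : (tensorPower V n).space.carrier), x + adjSwap V n i x ∈ (exteriorRel V n).carrier
  | n + 2, 0, _, x => Submodule.mem_sup_right
      (S := (SubRep.tensorLeft (SuperRep.std V) (exteriorRel V (n + 1))).carrier) ⟨x, rfl⟩
  | n + 2, i + 1, h, x => by
    refine Submodule.mem_sup_left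
      (T := (SubRep.antisymm (SuperRep.std V) (tensorPower V n)).carrier) ?_
    have ih := add_adjSwap_mem_exteriorRel (n + 1) i (by omega)
    refine TensorProduct.induction_on (motive := fun x : V.carrier ⊗[K]
      (tensorPower V (n + 1)).space.carrier => x + LinearMap.lTensor V.carrier
        (adjSwap V (n + 1) i) x ∈ LinearMap.range (LinearMap.lTensor V.carrier
          (exteriorRel V (n + 1)).carrier.subtype)) x ?_ ?_ ?_
    · simp
    · intro v y
      rw [LinearMap.lTensor_tmul, ← TensorProduct.tmul_add]
      exact ⟨v ⊗ₜ ⟨_, ih y⟩, rfl⟩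
    · intro y z hy hz
      rw [map_add, add_add_add_comm]
      exact add_mem hy hz

/-- With `add_adjSwap_mem_exteriorRel`, this identifies the recursively defined ideal component with
the span of all `x + s_i x`. An arbitrary target map `P` is needed for the recursion: removing a
first factor `v` replaces `P` by `P (v ⊗ ·)`. -/
theorem eq_zero_of_mem_exteriorRel {W : Type*} [AddCommGroup W] [Module K W] :
    ∀ (n : ℕ) (P : (tensorPower V n).space.carrier →ₗ[K] W)
      (_ : ∀ (i : ℕ) (_ : i + 1 < n) (x : (tensorPower V n).space.carrier),
        P (x + adjSwap V n i x) = 0), ∀ x ∈ (exteriorRel V n).carrier, P x = 0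
  | 0, P, _, x, hx => by
    rw [(Submodule.mem_bot K).1 hx, map_zero]
  | 1, P, _, x, hx => by
    rw [(Submodule.mem_bot K).1 hx, map_zero]
  | n + 2, P, hP, x, hx => by
    obtain ⟨y, hy, z, hz, rfl⟩ := Submodule.mem_sup.1 hx
    obtain ⟨z, rfl⟩ := hz
    obtain ⟨y, rfl⟩ := hy
    have h2 : P (LinearMap.lTensor V.carrier (exteriorRel V (n + 1)).carrier.subtype y) = 0 := by
      refine TensorProduct.induction_on (motive := fun y : V.carrier ⊗[K]
        (exteriorRel V (n + 1)).carrier => P (LinearMap.lTensor V.carrier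
          (exteriorRel V (n + 1)).carrier.subtype y) = 0) y ?_ ?_ ?_
      · exact (congrArg P (map_zero _)).trans (map_zero P)
      · rintro v ⟨y, hy⟩
        refine eq_zero_of_mem_exteriorRel (n + 1) (P ∘ₗ (TensorProduct.mk K V.carrier
          (tensorPower V (n + 1)).space.carrier v :
            (tensorPower V (n + 1)).space.carrier →ₗ[K] (tensorPower V (n + 2)).space.carrier))
          ?_ y hy
        intro i hi x
        exact (congrArg P (TensorProduct.tmul_add v x (adjSwap V (n + 1) i x))).trans
          (hP (i + 1) (by omega) (v ⊗ₜ x : V.carrier ⊗[K] (tensorPower V (n + 1)).space.carrier))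
      · intro y z hy hz
        exact (congrArg P (map_add _ _ _)).trans ((map_add P _ _).trans
          ((congrArg₂ _ hy hz).trans (add_zero 0)))
    exact (map_add P _ _).trans ((congrArg₂ _ h2 (hP 0 (by omega) z)).trans (add_zero 0))

theorem sub_permAct_mem_exteriorRel (n : ℕ) (π : Perm (Fin n))
    (x : (tensorPower V n).space.carrier) :
    x - permAct V n π x ∈ (exteriorRel V n).carrier := by
  induction π using perm_induction generalizing x with
  | h1 => rw [map_one, Module.End.one_apply, sub_self]; exact zero_mem _
  | hs i h =>
    rw [permAct_swap, LinearMap.neg_apply, sub_neg_eq_add]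
    exact add_adjSwap_mem_exteriorRel V n i h x
  | hm π τ h h' =>
    rw [map_mul, Module.End.mul_apply, ← sub_add_sub_cancel x (permAct V n τ x)]
    exact add_mem (h' x) (h _)

/-- The idempotent of `V^{⊗ n}` with image `Λ^n V`. -/
def exteriorIdem (n : ℕ) : (tensorPower V n).endAlgebra :=
  groupAlgebraAct V n ((⊤ : Subgroup (Perm (Fin n))).average K)

theorem groupAlgebraAct_average_idem (n : ℕ) (H : Subgroup (Perm (Fin n))) :
    groupAlgebraAct V n (H.average K) * groupAlgebraAct V n (H.average K) =
      groupAlgebraAct V n (H.average K) := by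
  rw [← map_mul, Subgroup.average_mul_average]

/-- The relations are killed by the average `e` because `e π = e`. Conversely `x - e x` is the
average of the `x - π x`, each of which is a relation. So the relations are the image of `1 - e`,
and the quotient by them is the image of `e`. -/
theorem exteriorRel_carrier (n : ℕ) :
    (exteriorRel V n).carrier = (SuperRep.range (1 - exteriorIdem V n)).carrier := by
  classical
  apply le_antisymm
  · intro x hx
    have h : (exteriorIdem V n).1 x = 0 := by
      refine eq_zero_of_mem_exteriorRel V n _ (fun i hi x => ?_) x hx
      have := permAct_average V n ⊤ (Subgroup.mem_top (swap ⟨i, by omega⟩ ⟨i + 1, hi⟩)) x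
      rw [permAct_swap V n i hi, LinearMap.neg_apply, map_neg] at this
      exact (map_add _ _ _).trans ((congrArg (· + _) this.symm).trans (neg_add_cancel _))
    refine ⟨x, ?_⟩
    change x - (exteriorIdem V n).1 x = x
    rw [h, sub_zero]
  · rintro _ ⟨x, rfl⟩
    change x - (exteriorIdem V n).1 x ∈ _
    rw [exteriorIdem, groupAlgebraAct_average]
    have hne : (Fintype.card (⊤ : Subgroup (Perm (Fin n))) : K) ≠ 0 :=
      Nat.cast_ne_zero.2 Fintype.card_ne_zero
    have : x - (Fintype.card (⊤ : Subgroup (Perm (Fin n))) : K)⁻¹ •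
        ∑ h : (⊤ : Subgroup (Perm (Fin n))), permAct V n h x =
        (Fintype.card (⊤ : Subgroup (Perm (Fin n))) : K)⁻¹ •
          ∑ h : (⊤ : Subgroup (Perm (Fin n))), (x - permAct V n h x) := by
      rw [Finset.sum_sub_distrib, Finset.sum_const, Finset.card_univ, smul_sub,
        ← Nat.cast_smul_eq_nsmul K, smul_smul, inv_mul_cancel₀ hne, one_smul]
    rw [this]
    exact Submodule.smul_mem _ _ (Submodule.sum_mem _ fun h _ =>
      sub_permAct_mem_exteriorRel V n h x)

theorem SubRep.ext_carrier {V : Superspace K} {A : SuperRep V} {I J : SubRep A}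
    (h : I.carrier = J.carrier) : I = J := by
  cases I
  cases J
  cases h
  rfl

theorem exteriorPower_natCast (n : ℕ) :
    exteriorPower V n = (tensorPower V n).image (exteriorIdem V n) :=
  congrArg (tensorPower V n).quotient (SubRep.ext_carrier (exteriorRel_carrier V n))

/-! ### Products of exterior powers as images of idempotents -/

/-- The word on `a + b` positions with the letter `0` in the first `a` positions, followed by the
word `c` with its letters raised by one. -/
def blockWord {m : ℕ} (a : ℕ) {b : ℕ} (c : Fin b → Fin m) : Fin (b + a) → Fin (m + 1) :=
  Sum.elim (fun _ => 0) (fun x => (c x).succ) ∘ (blockEquiv a b).symm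

theorem blockPerm_injective (a b : ℕ) : Function.Injective (blockPerm a b) :=
  (Equiv.permCongrHom (blockEquiv a b)).injective.comp Perm.sumCongrHom_injective

theorem blockPerm_apply {a b : ℕ} (π : Perm (Fin a) × Perm (Fin b)) (x : Fin a ⊕ Fin b) :
    blockPerm a b π (blockEquiv a b x) = blockEquiv a b (Sum.map π.1 π.2 x) := by
  change blockEquiv a b (Perm.sumCongr π.1 π.2 ((blockEquiv a b).symm (blockEquiv a b x))) = _
  rw [Equiv.symm_apply_apply]
  rfl

theorem blockWord_apply {m a b : ℕ} (c : Fin b → Fin m) (x : Fin a ⊕ Fin b) :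
    blockWord a c (blockEquiv a b x) = Sum.elim (fun _ => 0) (fun x => (c x).succ) x := by
  simp [blockWord]

theorem blockPerm_mem_wordStabilizer_iff {m a b : ℕ} (c : Fin b → Fin m)
    (π : Perm (Fin a) × Perm (Fin b)) :
    blockPerm a b π ∈ wordStabilizer (blockWord a c) ↔ π.2 ∈ wordStabilizer c := by
  rw [mem_wordStabilizer, mem_wordStabilizer, funext_iff, funext_iff,
    ← (blockEquiv a b).forall_congr_right]
  simp only [Function.comp_apply, blockPerm_apply, blockWord_apply, Sum.forall]
  simp

/-- The letter `0` occurs exactly in the first block, so a permutation preserving the word preserves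
both blocks. -/
theorem exists_blockPerm_eq {m a b : ℕ} {c : Fin b → Fin m} {π : Perm (Fin (b + a))}
    (hπ : π ∈ wordStabilizer (blockWord a c)) : ∃ k, blockPerm a b k = π := by
  have h : (blockEquiv a b).permCongrHom.symm π ∈ (Perm.sumCongrHom (Fin a) (Fin b)).range := by
    refine Perm.mem_sumCongrHom_range_of_perm_mapsTo_inl ?_
    rintro _ ⟨x, rfl⟩
    have h1 := congrFun hπ (blockEquiv a b (.inl x))
    change blockWord a c (π _) = _ at h1
    obtain ⟨y, hy⟩ := (blockEquiv a b).surjective (π (blockEquiv a b (.inl x)))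
    change (blockEquiv a b).symm (π (blockEquiv a b (.inl x))) ∈ _
    rw [← hy, blockWord_apply, blockWord_apply] at h1
    rw [← hy, Equiv.symm_apply_apply]
    rcases y with y | y
    · exact ⟨y, rfl⟩
    · exact absurd h1 (Fin.succ_ne_zero _)
  obtain ⟨k, hk⟩ := h
  refine ⟨k, ?_⟩
  change (blockEquiv a b).permCongrHom (Perm.sumCongrHom (Fin a) (Fin b) k) = π
  rw [hk, MulEquiv.apply_symm_apply]

theorem card_fiber_blockWord {m a b : ℕ} (c : Fin b → Fin m) (i : Fin (m + 1)) :
    Fintype.card {x // blockWord a c x = i} =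
      Fin.cases a (fun i => Fintype.card {x // c x = i}) i := by
  rw [Fintype.card_congr (((blockEquiv a b).subtypeEquiv
    (p := fun x => Sum.elim (fun _ => 0) (fun x => (c x).succ) x = i) fun x => by
      rw [blockWord_apply]).symm.trans (Equiv.subtypeSum)), Fintype.card_sum]
  cases i using Fin.cases with
  | zero => simp [Fin.succ_ne_zero]
  | succ i => simp [(Fin.succ_ne_zero _).symm]

/-- The stabilizer of the block word is the product of `S_a` and the stabilizer of `c`, so its
average is the product of the two averages, acting on the two tensor factors. -/
theorem concat_average {m a b : ℕ} (c : Fin b → Fin m) (x : (tensorPower V a).space.carrier)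
    (y : (tensorPower V b).space.carrier) :
    (concat V b a).toLin ((exteriorIdem V a).1 x ⊗ₜ
      (groupAlgebraAct V b ((wordStabilizer c).average K)).1 y) =
    (groupAlgebraAct V (b + a) ((wordStabilizer (blockWord a c)).average K)).1
      ((concat V b a).toLin (x ⊗ₜ y)) := by
  classical
  let f : (⊤ : Subgroup (Perm (Fin a))) × wordStabilizer c → wordStabilizer (blockWord a c) :=
    fun k => ⟨blockPerm a b (k.1, k.2), (blockPerm_mem_wordStabilizer_iff c _).2 k.2.2⟩
  have hf : Function.Bijective f := by
    constructor
    · intro k k' h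
      have := blockPerm_injective a b (Subtype.ext_iff.1 h)
      exact Prod.ext (Subtype.ext (Prod.ext_iff.1 this).1) (Subtype.ext (Prod.ext_iff.1 this).2)
    · rintro ⟨π, hπ⟩
      obtain ⟨k, rfl⟩ := exists_blockPerm_eq hπ
      exact ⟨(⟨k.1, Subgroup.mem_top _⟩, ⟨k.2, (blockPerm_mem_wordStabilizer_iff c _).1 hπ⟩), rfl⟩
  let L : (tensorPower V a).space.carrier →ₗ[K] (tensorPower V b).space.carrier →ₗ[K]
      (tensorPower V (b + a)).space.carrier :=
    TensorProduct.curry (concat V b a).toLin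
  have hL : ∀ x y, (concat V b a).toLin (x ⊗ₜ y) = L x y := fun _ _ => rfl
  have hact : ∀ (k : (⊤ : Subgroup (Perm (Fin a))) × wordStabilizer c),
      L (permAct V a k.1 x) (permAct V b k.2 y) = permAct V (b + a) (f k) (L x y) := by
    intro k
    refine (concat_permAct_left V a b k.1 x _).trans ((congrArg _
      (concat_permAct_right V a b k.2 x y)).trans ?_)
    rw [← Module.End.mul_apply, ← map_mul, ← map_mul]
    simp only [Prod.mk_mul_mk, one_mul, mul_one]
    rfl
  rw [hL, hL, exteriorIdem, groupAlgebraAct_average, groupAlgebraAct_average,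
    groupAlgebraAct_average, ← Fintype.sum_bijective f hf _ _ hact,
    ← Fintype.card_of_bijective hf, Fintype.card_prod, Fintype.sum_prod_type]
  simp only [map_smul, LinearMap.smul_apply, map_sum, LinearMap.sum_apply]
  rw [Finset.sum_comm, Nat.cast_mul, mul_inv, mul_comm, ← Finset.smul_sum, smul_smul]

/-- Every product of exterior powers of total degree `n` is thus realized inside the same
representation `V^{⊗ n}`, by an idempotent of `K[S_n]`. Factors are split off one at a time as
initial blocks. -/
theorem exists_word_class_eq_prod : ∀ (m : ℕ) (a : Fin m → ℕ) (n : ℕ), ∑ i, a i = n →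
    ∃ c : Fin n → Fin m, (∀ i, Fintype.card {x // c x = i} = a i) ∧
      splitClass ((tensorPower V n).image
        (groupAlgebraAct V n ((wordStabilizer c).average K))) =
      ∏ i, splitClass (exteriorPower V (a i))
  | 0, a, n, h => by
    obtain rfl : n = 0 := by simpa using h.symm
    refine ⟨Fin.elim0, fun i => i.elim0, ?_⟩
    rw [Finset.univ_eq_empty, Finset.prod_empty, ← splitClass_one]
    have he := groupAlgebraAct_average_idem V 0 (wordStabilizer (Fin.elim0 : Fin 0 → Fin 0))
    have h1 : ∀ x, (groupAlgebraAct V 0 ((wordStabilizer (Fin.elim0 : Fin 0 → Fin 0)).average K)).1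
        x = x := by
      classical
      intro x
      have : Unique (wordStabilizer (Fin.elim0 : Fin 0 → Fin 0)) :=
        ⟨⟨1⟩, fun h => Subtype.ext (Subsingleton.elim _ _)⟩
      rw [groupAlgebraAct_average, Fintype.sum_unique, Fintype.card_unique, Nat.cast_one, inv_one,
        one_smul, Subsingleton.elim (default : wordStabilizer _).1 1, map_one,
        Module.End.one_apply]
    exact splitClass_eq_of_inverse (ofImage _ he) (toImage _) (toImage_ofImage _ he) h1
  | m + 1, a, n, h => by
    rw [Fin.sum_univ_succ] at h
    obtain ⟨c, hc, hc'⟩ := exists_word_class_eq_prod m (fun i => a i.succ) _ rfl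
    subst h
    rw [add_comm]
    refine ⟨blockWord (a 0) c, fun i => ?_, ?_⟩
    · rw [card_fiber_blockWord]
      cases i using Fin.cases with
      | zero => rfl
      | succ i => exact hc i
    · rw [Fin.prod_univ_succ, ← hc', exteriorPower_natCast]
      let e := LinearEquiv.ofBijective _ (concat_bijective V (∑ i : Fin m, a i.succ) (a 0))
      exact splitClass_image_tensor (concat V _ (a 0)) ((concat V _ (a 0)).inverse e rfl)
        e.symm_apply_apply e.apply_symm_apply (groupAlgebraAct_average_idem V _ _)
        (groupAlgebraAct_average_idem V _ _) (groupAlgebraAct_average_idem V _ _)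
        (concat_average V c)

end SuperGL

end

noncomputable section

namespace SuperGL

open SuperRep Equiv

variable {K : Type u} [Field K] [CharZero K] (V : Superspace K)

/-! ### Dimensions -/

/-- The dimension of representations, on the split Grothendieck ring. -/
def dimHom : SplitGrothendieckRing V →+* ℤ :=
  Ideal.Quotient.lift _ (MvPolynomial.aeval fun A : SuperRep V =>
    (Module.finrank K A.space.carrier : ℤ)).toRingHom (by
      change Ideal.span _ ≤ RingHom.ker _
      rw [Ideal.span_le]
      rintro x (⟨A, B, C, i, p, ⟨⟨h1, h2, h3⟩, -⟩, rfl⟩ | ⟨A, B, rfl⟩ | rfl)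
      · have h4 := LinearMap.finrank_range_add_finrank_ker p.toLin
        rw [LinearMap.range_eq_top.2 h3, finrank_top, LinearMap.exact_iff.1 h2,
          LinearMap.finrank_range_of_inj h1] at h4
        simp [RingHom.mem_ker, ← h4]
      · have h : Module.finrank K (A.tensor B).space.carrier =
            Module.finrank K A.space.carrier * Module.finrank K B.space.carrier :=
          Module.finrank_tensorProduct
        simp [RingHom.mem_ker, h]
      · have h : Module.finrank K (SuperRep.one V).space.carrier = 1 := Module.finrank_self K
        simp [RingHom.mem_ker, h])

theorem dimHom_splitClass (A : SuperRep V) :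
    dimHom V (splitClass A) = Module.finrank K A.space.carrier :=
  (Ideal.Quotient.lift_mk _ _ _).trans (MvPolynomial.aeval_X _ _)

theorem splitClass_eq_zero_of_dimHom {A : SuperRep V} (h : dimHom V (splitClass A) = 0) :
    splitClass A = 0 := by
  rw [dimHom_splitClass, Nat.cast_eq_zero, Module.finrank_zero_iff] at h
  exact splitClass_zero_of_subsingleton A fun x => Subsingleton.elim _ _

/-- The quotient that defines the image embeds in `A` with range that of `e`, and the rank of an
idempotent is its trace. -/
theorem finrank_image {A : SuperRep V} (e : A.endAlgebra) (he : e * e = e) :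
    (Module.finrank K (A.image e).space.carrier : K) = LinearMap.trace K _ e.1 := by
  rw [trace_eq_finrank_range_of_idem fun x => congrArg (fun e : A.endAlgebra => e.1 x) he]
  congr 1
  have h : Function.Injective (ofImage e he).toLin :=
    Function.LeftInverse.injective (toImage_ofImage e he)
  have hr : LinearMap.range (ofImage e he).toLin = LinearMap.range e.1 := by
    ext x
    constructor
    · rintro ⟨y, rfl⟩
      obtain ⟨y, rfl⟩ := mkHom_surjective _ y
      exact ⟨y, rfl⟩
    · rintro ⟨y, rfl⟩
      exact ⟨(toImage e).toLin y, rfl⟩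
  rw [← LinearMap.finrank_range_of_inj h, hr]

theorem dimHom_exteriorPower (n : ℕ) : dimHom V (splitClass (exteriorPower V n)) =
    wordCount (Module.finrank K V.grading.even) (Module.finrank K V.grading.odd) n := by
  rw [dimHom_splitClass, exteriorPower_natCast, Nat.cast_inj, ← Nat.cast_inj (R := K),
    finrank_image V (exteriorIdem V n) (groupAlgebraAct_average_idem V n ⊤)]
  classical
  have h : (exteriorIdem V n).1 = (n.factorial : K)⁻¹ • ∑ π, permAct V n π := by
    ext x
    rw [exteriorIdem, groupAlgebraAct_average, LinearMap.smul_apply, LinearMap.sum_apply]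
    have hc : Fintype.card (⊤ : Subgroup (Perm (Fin n))) = n.factorial := by
      rw [Fintype.card_congr Subgroup.topEquiv.toEquiv, Fintype.card_perm, Fintype.card_fin]
    rw [hc]
    congr 1
    exact Fintype.sum_equiv Subgroup.topEquiv.toEquiv _ _ fun _ => rfl
  rw [h]
  exact trace_sum_wordAct K Sum.isRight (wordBasis V n)

theorem splitClass_exteriorPower_of_neg {a : ℤ} (ha : a < 0) :
    splitClass (exteriorPower V a) = 0 := by
  obtain ⟨b, rfl⟩ := Int.eq_negSucc_of_lt_zero ha
  exact splitClass_zero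

/-! ### Vanishing of the Hankel determinants -/

theorem dimHom_det {p q : ℕ} (hp : Module.finrank K V.grading.even = p)
    (hq : Module.finrank K V.grading.odd = q) {k : ℤ} (hk : (p : ℤ) - q + 1 ≤ k) :
    dimHom V (Matrix.of fun i j : Fin (q + 1) =>
      splitClass (exteriorPower V (k + (i : ℤ) + (j : ℤ)))).det = 0 := by
  rw [RingHom.map_det]
  refine det_wordCount p q k hk (fun a => dimHom V (splitClass (exteriorPower V a))) ?_ ?_
  · intro n
    rw [dimHom_exteriorPower, hp, hq]
  · intro a ha
    rw [splitClass_exteriorPower_of_neg V ha, map_zero]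

/-- A Hankel determinant of classes of exterior powers is the class of a representation, up to
sign. -/
theorem exists_det_eq (q : ℕ) {k : ℤ} (hk : 0 ≤ k + q) : ∃ A : SuperRep V,
    (Matrix.of fun i j : Fin (q + 1) =>
      splitClass (exteriorPower V (k + (i : ℤ) + (j : ℤ)))).det = splitClass A ∨
    (Matrix.of fun i j : Fin (q + 1) =>
      splitClass (exteriorPower V (k + (i : ℤ) + (j : ℤ)))).det = -splitClass A := by
  obtain ⟨r, hr⟩ : ∃ r : ℕ, (r : ℤ) = k + q := ⟨(k + q).toNat, by omega⟩
  -- With `r = k + q`, the degree `k + i + σ i` equals `μ i - rev (σ i)`: reversing the columns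
  -- turns the Hankel determinant into a Jacobi–Trudi determinant with strictly increasing `μ`.
  let μ : Fin (q + 1) → ℕ := fun i => r + i
  have hμ : Function.Injective μ := fun i j h => Fin.ext (by simpa [μ] using h)
  have hrev : ∀ i : Fin (q + 1), ((Fin.rev i : Fin (q + 1)) : ℤ) = q - i := by
    intro i
    rw [Fin.val_rev, Nat.cast_sub (by omega)]
    push_cast
    ring
  have ha : ∀ (σ : Perm (Fin (q + 1))) (i : Fin (q + 1)),
      k + (i : ℤ) + (σ i : ℤ) = (μ i : ℤ) - (Fin.rev (σ i) : ℕ) := by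
    intro σ i
    rw [hrev]
    push_cast [μ]
    linarith
  -- These are the permutations whose degrees are all nonnegative. For the others the truncated
  -- subtraction would be wrong, and the product of exterior powers is zero.
  let good : Perm (Fin (q + 1)) → Prop := fun σ => ∀ i, (Fin.rev (σ i) : ℕ) ≤ μ i
  obtain ⟨n, hn⟩ : ∃ n, n = (q + 1) * r := ⟨_, rfl⟩
  -- The total degree is independent of `σ`, so all the idempotents live in the same group algebra.
  have hsum : ∀ σ, good σ → ∑ i, (μ i - (Fin.rev (σ i) : ℕ)) = n := by
    intro σ hσ
    have h1 : ∑ i, ((Fin.rev (σ i) : Fin (q + 1)) : ℕ) = ∑ i : Fin (q + 1), (i : ℕ) :=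
      Fintype.sum_equiv (σ.trans Fin.revPerm) _ _ fun _ => rfl
    have h2 : ∑ i, (μ i - (Fin.rev (σ i) : ℕ)) + ∑ i, ((Fin.rev (σ i) : Fin (q + 1)) : ℕ) =
        (q + 1) * r + ∑ i : Fin (q + 1), (i : ℕ) := by
      rw [← Finset.sum_add_distrib, Finset.sum_congr rfl fun i _ => Nat.sub_add_cancel (hσ i)]
      simp [μ, Finset.sum_add_distrib]
    omega
  choose c hc hc' using fun (σ : Perm (Fin (q + 1))) (hσ : good σ) =>
    exists_word_class_eq_prod V (q + 1) _ _ (hsum σ hσ)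
  classical
  let e : Perm (Fin (q + 1)) → MonoidAlgebra K (Perm (Fin n)) := fun σ =>
    if hσ : good σ then (wordStabilizer (c σ hσ)).average K else 0
  have he : ∀ σ, e σ * e σ = e σ := by
    intro σ
    dsimp only [e]
    split_ifs
    · exact Subgroup.average_mul_average K _
    · exact mul_zero 0
  have hΦ := isRankFunction_image (A := tensorPower V n)
    (groupAlgebraAct V n).toRingHom
  have hcorner : ∀ σ τ, cornerTrace K (e σ) (e τ) =
      ((if good σ ∧ good τ then (matrixCount (fun i => μ i - (Fin.rev (σ i) : ℕ))
        (fun i => μ i - (Fin.rev (τ i) : ℕ)) : ℤ) else 0 : ℤ) : K) := by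
    intro σ τ
    dsimp only [e]
    by_cases hσ : good σ
    · by_cases hτ : good τ
      · rw [dif_pos hσ, dif_pos hτ, if_pos ⟨hσ, hτ⟩,
          cornerTrace_wordStabilizer K (hc σ hσ) (hc τ hτ), Int.cast_natCast]
      · rw [dif_neg hτ, cornerTrace_zero_right, if_neg fun h => hτ h.2, Int.cast_zero]
    · rw [dif_neg hσ, cornerTrace_zero_left, if_neg fun h => hσ h.1, Int.cast_zero]
  have hnorm : ∑ σ : Perm (Fin (q + 1)), (Perm.sign σ : ℤ) • ∑ τ : Perm (Fin (q + 1)),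
      (Perm.sign τ : ℤ) • cornerTrace K (e σ) (e τ) = 1 := by
    have h := congrArg (Int.cast (R := K)) (sum_sign_mul_sum_sign_mul_matrixCount hμ)
    rw [Int.cast_one] at h
    rw [← h]
    simp only [hcorner, zsmul_eq_mul]
    push_cast
    rfl
  have hclass : ∀ σ, splitClass ((tensorPower V n).image
      (groupAlgebraAct V n (e σ))) =
      ∏ i : Fin (q + 1), splitClass (exteriorPower V (k + (i : ℤ) + (σ i : ℤ))) := by
    intro σ
    by_cases hσ : good σ
    · dsimp only [e]
      rw [dif_pos hσ, hc' σ hσ]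
      refine Finset.prod_congr rfl fun i _ => ?_
      rw [ha, Nat.cast_sub (hσ i)]
    · have h0 : e σ = 0 := dif_neg hσ
      rw [h0]
      refine hΦ.map_zero.trans ?_
      obtain ⟨i, hi⟩ := not_forall.1 hσ
      refine (Finset.prod_eq_zero (Finset.mem_univ i) ?_).symm
      rw [ha]
      exact splitClass_exteriorPower_of_neg V (by omega)
  obtain ⟨g, -, h⟩ := hΦ.exists_idem_of_norm_eq_one (K := K)
    (MonoidAlgebra.exists_mul_mul_eq K) (fun σ => (Perm.sign σ : ℤ))
    (fun σ => (Int.units_eq_one_or (Perm.sign σ)).imp (by simp +contextual) (by simp +contextual))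
    e he hnorm
  have hdet : (Matrix.of fun i j : Fin (q + 1) =>
      splitClass (exteriorPower V (k + (i : ℤ) + (j : ℤ)))).det =
      ∑ σ : Perm (Fin (q + 1)), (Perm.sign σ : ℤ) • splitClass
        ((tensorPower V n).image (groupAlgebraAct V n (e σ))) := by
    rw [← Matrix.det_transpose, Matrix.det_apply]
    refine Finset.sum_congr rfl fun σ _ => ?_
    rw [hclass]
    rfl
  exact ⟨_, by rw [hdet]; exact h⟩

/-- Dimension detects vanishing on plus or minus the class of a representation, though not on
arbitrary virtual classes; this is why the determinant must first be shown to be such a class. -/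
theorem det_splitClass_eq_zero {p q : ℕ} (hp : Module.finrank K V.grading.even = p)
    (hq : Module.finrank K V.grading.odd = q) {k : ℤ} (hk : (p : ℤ) - q + 1 ≤ k) :
    (Matrix.of fun i j : Fin (q + 1) =>
      splitClass (exteriorPower V (k + (i : ℤ) + (j : ℤ)))).det = 0 := by
  have hdim := dimHom_det V hp hq hk
  obtain ⟨A, hA | hA⟩ := exists_det_eq V q (by omega : 0 ≤ k + q)
  · rw [hA] at hdim ⊢
    exact splitClass_eq_zero_of_dimHom V hdim
  · rw [hA, map_neg, neg_eq_zero] at hdim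
    rw [hA, splitClass_eq_zero_of_dimHom V hdim, neg_zero]

/-- The canonical map from the split Grothendieck ring to the Grothendieck ring. -/
def splitToGrothendieck : SplitGrothendieckRing V →+* GrothendieckRing V :=
  Ideal.Quotient.factor (Ideal.span_mono (Set.union_subset_union_left _ (by
    rintro x ⟨A, B, C, i, p, h, rfl⟩
    exact ⟨A, B, C, i, p, h.1, rfl⟩)))

end SuperGL

end

theorem mainTheorem4 {K : Type u} [Field K] [CharZero K] (V : SuperGL.Superspace K) (p q : ℕ)
    (hp : Module.finrank K V.grading.even = p) (hq : Module.finrank K V.grading.odd = q)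
    (k : ℤ) (hk : (p : ℤ) - q + 1 ≤ k) :
    (Matrix.of fun i j : Fin (q + 1) =>
        SuperGL.grothendieckClass (SuperGL.exteriorPower V (k + (i : ℤ) + (j : ℤ)))).det = 0 ∧
      (Matrix.of fun i j : Fin (q + 1) =>
        SuperGL.splitClass (SuperGL.exteriorPower V (k + (i : ℤ) + (j : ℤ)))).det = 0 := by
  have h := SuperGL.det_splitClass_eq_zero V hp hq hk
  refine ⟨?_, h⟩
  -- A ring homomorphism commutes with determinants, and this one carries the split class of a
  -- representation to its class.
  have h1 := congrArg (SuperGL.splitToGrothendieck V) h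
  rw [RingHom.map_det, map_zero] at h1
  exact h1
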